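/- **Setting.** Let $\Gamma=\mathrm{Span}_{\mathbb Z}\{a_1,\dots,a_d\}\subset\mathbb R^d$ be a Bravais lattice ($a_1,\dots,a_d$ a basis of $\mathbb R^d$), $\Gamma^*=\{\kappa:\kappa\cdot\gamma\in2\pi\mathbb Z\ \forall\gamma\in\Gamma\}$, let $\mathcal C_1$ and $\mathbb B$ be fundamental cells of $\Gamma$ and $\Gamma^*$, and let $\mathcal X$ be either $\mathbb R^d$ with Lebesgue measure or a $\Gamma$-invariant subset of $\mathbb R^d$ which meets every compact set in a finite set, with the counting measure. On $\mathcal H=L^2(\mathcal X,\mathbb C^N)$ let $(X_j\psi)(x)=x_j\psi(x)$ with maximal domain and $(T_\gamma\psi)(x)=M(\gamma,x)\psi(x-\gamma)$, $\gamma\in\Gamma$, where the $M(\gamma,x)$ are unitary $N\times N$ matrices, measurable in $x$, with $M(\gamma_1+\gamma_2,x)=M(\gamma_2,x)M(\gamma_1,x-\gamma_2)$. An operator is *periodic* if it commutes with all $T_\gamma$. Let $\mathcal H_f=\{\varphi\in L^2_{loc}(\mathcal X,\mathbb C^N):T_\gamma\varphi=\varphi\ \forall\gamma\in\Gamma\}$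 with the norm of $L^2(\mathcal C_1,\mathbb C^N)$, $(\varrho(\kappa)\varphi)(y)=e^{-i\kappa\cdot y}\varphi(y)$ for $\kappa\in\Gamma^*$, and let $\mathcal U$ be the Bloch–Floquet–Zak transform $$(\mathcal U\psi)(k,y)=e^{-ik\cdot y}\sum_{\gamma\in\Gamma}e^{ik\cdot\gamma}(T_\gamma\psi)(y),$$ (series in $L^2(\mathbb B,\mathcal H_f)$), which maps $\mathcal H$ onto the locally square integrable $\varphi:\mathbb R^d\to\mathcal H_f$ with $\varphi(k+\kappa)=\varrho(\kappa)\varphi(k)$ for all $\kappa\in\Gamma^*$. *Hamiltonian.* Let $H_0$ be a periodic self-adjoint operator on $\mathcal H$, bounded from below, whose fibration $\mathcal UH_0\mathcal U^{-1}=\int^\oplus H_0(k)\,dk$ consists of self-adjoint operators $H_0(k)$ on $\mathcal H_f$ with a common dense domain $\mathcal D_f$, carrying the graph norm of $H_0(0)$; suppose that $\varrho(\kappa)\mathcal D_f\subseteq\mathcal D_f$ and $H_0(k+\kappa)=\varrho(\kappa)H_0(k)\varrho(\kappa)^{-1}$ for $\kappa\in\Gamma^*$, and that $k\mapsto H_0(k)\in\mathcal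 L(\mathcal D_f,\mathcal H_f)$ is smooth. Let $\mu\in\mathbb R$ lie in the resolvent set of $H_0$ (in a spectral gap), let $\Pi_0=\chi_{(-\infty,\mu)}(H_0)$, and suppose that the fibration of $\Pi_0$ takes values in the finite-rank projections. *Spaces.* For $V_1,V_2\in\{\mathcal H_f,\mathcal D_f\}$ let $\mathcal P(V_1,V_2)$ be the space of periodic operators $A$ with smooth fibration $\mathbb R^d\ni k\mapsto A(k)\in\mathcal L(V_1,V_2)$, with the norm $\sup_{k\in\mathbb B}\|A(k)\|$, and $\mathcal P(V_1)=\mathcal P(V_1,V_1)$. Let $\mathcal K(V_1)\subset\mathcal H$ be the space of all $\psi$ such that $\mathcal U\psi$ is a smooth map $\mathbb R^d\to V_1$. Commutators of an unbounded operator $A$ with a bounded operator $B$ have the domain $\{\psi\in D(A):B\psi\in D(A)\}$, and an overline denotes the operator closure; $\overline{[X_j,\Pi_0]}$ means the closure of $[X_j,\Pi_0]$ restricted to $\mathcal K(\mathcal H_f)$. *Inverse Liouvillian.* Let $C$ be any closed rectifiable contour in the resolvent set of $H_0$ that has winding number $1$ around each point of the spectrum of $H_0$ below $\mu$ and $0$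 around each point above $\mu$, and for bounded $A$ put $$\mathcal I(A)=\frac{i}{2\pi}\oint_C(H_0-z)^{-1}[A,\Pi_0](H_0-z)^{-1}\,dz.$$ **Proposition.** Let $j\in\{1,\dots,d\}$ and $H^\varepsilon=H_0-\varepsilon X_j$ with domain $D(H_0)\cap D(X_j)$, for $\varepsilon\in[0,1]$. The commutator $[X_j,\Pi_0]$ is defined on $\mathcal K(\mathcal H_f)$ and $\overline{[X_j,\Pi_0]}$ is a bounded operator defined on all of $\mathcal H$. Moreover: (i) The operator $\mathcal S:=i\,\mathcal I\big([\overline{[X_j,\Pi_0]},\Pi_0]\big)$ is in $\mathcal P(\mathcal H_f,\mathcal D_f)$ and is self-adjoint. (ii) Let $\Pi^\varepsilon:=e^{-i\varepsilon\mathcal S}\,\Pi_0\,e^{i\varepsilon\mathcal S}$. Then, for $\varepsilon\in[0,1]$, $$\Pi^\varepsilon=\Pi_0+\varepsilon\Pi_1+\varepsilon^2\Pi_r^\varepsilon,\qquad \Pi_1=\mathcal I\big(\overline{[X_j,\Pi_0]}\big),$$ where $\Pi_1$ and $\Pi_r^\varepsilon$ are in $\mathcal P(\mathcal H_f,\mathcal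 D_f)$ and $[0,1]\ni\varepsilon\mapsto\Pi_r^\varepsilon\in\mathcal P(\mathcal H_f,\mathcal D_f)$ is bounded. Moreover, for $\varepsilon\in[0,1]$, $$\overline{[H^\varepsilon,\Pi^\varepsilon]}=\varepsilon^2R^\varepsilon,$$ where $R^\varepsilon$ is in $\mathcal P(\mathcal H_f)$ and $[0,1]\ni\varepsilon\mapsto R^\varepsilon\in\mathcal P(\mathcal H_f)$ is bounded; here $[H^\varepsilon,\Pi^\varepsilon]$ is defined on $\mathcal K(\mathcal D_f)$, and its closure is the same whether it is taken on its natural domain or on $\mathcal K(\mathcal D_f)$. -/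

import Mathlib

open MeasureTheory Set Filter Topology
open scoped ENNReal NNReal ContDiff InnerProductSpace

noncomputable section

namespace Neass

/-! ### Unbounded operators on a complex Hilbert space -/

section Operators

variable {𝓗 : Type*} [NormedAddCommGroup 𝓗] [InnerProductSpace ℂ 𝓗]

/-- A bounded everywhere defined operator, viewed as a partially defined one. -/
def full (A : 𝓗 →L[ℂ] 𝓗) : 𝓗 →ₗ.[ℂ] 𝓗 := (A : 𝓗 →ₗ[ℂ] 𝓗).toPMap ⊤

/-- The commutator `[A, B] = A B - B A` of an unbounded operator `A` and a bounded operator `B`,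
on its natural domain `{ψ ∈ D(A) | B ψ ∈ D(A)}`. -/
def comm (A : 𝓗 →ₗ.[ℂ] 𝓗) (B : 𝓗 →L[ℂ] 𝓗) : 𝓗 →ₗ.[ℂ] 𝓗 where
  domain := A.domain ⊓ A.domain.comap (B : 𝓗 →ₗ[ℂ] 𝓗)
  toFun :=
    { toFun := fun ψ => A ⟨B ψ, ψ.2.2⟩ - B (A ⟨ψ, ψ.2.1⟩)
      map_add' := by
        intro x y
        have h1 : (⟨B ((x + y : _) : 𝓗), (x + y).2.2⟩ : A.domain)
            = ⟨B x, x.2.2⟩ + ⟨B y, y.2.2⟩ := by ext; simp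
        have h2 : (⟨((x + y : _) : 𝓗), (x + y).2.1⟩ : A.domain)
            = ⟨x, x.2.1⟩ + ⟨y, y.2.1⟩ := by ext; simp
        rw [h1, h2, A.map_add, A.map_add, map_add]; abel
      map_smul' := by
        intro c x
        have h1 : (⟨B ((c • x : _) : 𝓗), (c • x).2.2⟩ : A.domain)
            = c • ⟨B x, x.2.2⟩ := by ext; simp
        have h2 : (⟨((c • x : _) : 𝓗), (c • x).2.1⟩ : A.domain)
            = c • ⟨x, x.2.1⟩ := by ext; simp
        rw [h1, h2, A.map_smul, A.map_smul, map_smul, RingHom.id_apply, smul_sub] }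

/-- `R` is the bounded two-sided inverse of `A - z : D(A) → 𝓗`. -/
def IsResolventAt (A : 𝓗 →ₗ.[ℂ] 𝓗) (z : ℂ) (R : 𝓗 →L[ℂ] 𝓗) : Prop :=
  (∀ ψ : 𝓗, ∃ h : R ψ ∈ A.domain, A ⟨R ψ, h⟩ - z • R ψ = ψ) ∧
    ∀ φ : A.domain, R (A φ - z • (φ : 𝓗)) = φ

/-- The resolvent set `ρ(A)`; the spectrum of `A` is its complement. -/
def resolventSet (A : 𝓗 →ₗ.[ℂ] 𝓗) : Set ℂ := {z | ∃ R, IsResolventAt A z R}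

open Classical in
/-- The resolvent `(A - z)⁻¹` for `z ∈ ρ(A)` (and `0` for `z ∉ ρ(A)`). -/
def resolvent (A : 𝓗 →ₗ.[ℂ] 𝓗) (z : ℂ) : 𝓗 →L[ℂ] 𝓗 :=
  if h : z ∈ resolventSet A then h.choose else 0

/-- `A` is bounded from below. -/
def BoundedBelow (A : 𝓗 →ₗ.[ℂ] 𝓗) : Prop :=
  ∃ c : ℝ, ∀ ψ : A.domain, c * ‖(ψ : 𝓗)‖ ^ 2 ≤ (⟪(ψ : 𝓗), A ψ⟫_ℂ).re

/-- `E` is the projection-valued spectral measure of `A`, that is `A = ∫ x dE(x)`: each `E B` is an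
orthogonal projection, `B ↦ ⟨ψ, E(B) ψ⟩ = ‖E(B) ψ‖²` is a measure `m` for every `ψ`, the domain
of `A` is `{ψ | ∫ x² dm(x) < ∞}`, and `⟨ψ, A ψ⟩ = ∫ x dm(x)` there. -/
structure IsSpectralMeasure [CompleteSpace 𝓗] (A : 𝓗 →ₗ.[ℂ] 𝓗) (E : Set ℝ → 𝓗 →L[ℂ] 𝓗) :
    Prop where
  proj : ∀ B, MeasurableSet B → IsStarProjection (E B)
  univ : E Set.univ = 1
  inter : ∀ B B', MeasurableSet B → MeasurableSet B' → E (B ∩ B') = E B * E B'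
  integral : ∀ ψ : 𝓗, ∃ m : Measure ℝ,
    (∀ B, MeasurableSet B → m B = ENNReal.ofReal (‖E B ψ‖ ^ 2)) ∧
    (ψ ∈ A.domain ↔ ∫⁻ x, ENNReal.ofReal (x ^ 2) ∂m < ⊤) ∧
    ∀ h : ψ ∈ A.domain, ⟪ψ, A ⟨ψ, h⟩⟫_ℂ = ((∫ x, x ∂m : ℝ) : ℂ)

/-- `P` is the spectral projection `χ_B(A)`. -/
def IsSpectralProjection [CompleteSpace 𝓗] (A : 𝓗 →ₗ.[ℂ] 𝓗) (B : Set ℝ) (P : 𝓗 →L[ℂ] 𝓗) :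
    Prop :=
  ∃ E, IsSpectralMeasure A E ∧ P = E B

/-- The winding number around `w` of a closed Lipschitz curve `C : [0,1] → ℂ`. -/
def winding (C : ℝ → ℂ) (w : ℂ) : ℂ :=
  (2 * Real.pi * Complex.I)⁻¹ * ∫ t in (0 : ℝ)..1, deriv C t * (C t - w)⁻¹

/-- `C : [0,1] → ρ(A)` is a closed rectifiable (Lipschitz parametrised) curve in the resolvent set
which winds once, in the positive sense, around every point of the spectrum to the left of `μ`, and
does not wind around any point of the spectrum to the right of `μ`. -/
structure IsContour (A : 𝓗 →ₗ.[ℂ] 𝓗) (μ : ℝ) (C : ℝ → ℂ) : Prop where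
  lipschitz : ∃ L : ℝ≥0, LipschitzOnWith L C (Icc 0 1)
  closed : C 0 = C 1
  mem_resolventSet : ∀ t ∈ Icc (0 : ℝ) 1, C t ∈ resolventSet A
  inside : ∀ w : ℂ, w ∉ resolventSet A → w.re < μ → winding C w = 1
  outside : ∀ w : ℂ, w ∉ resolventSet A → μ < w.re → winding C w = 0

/-- `𝓘(B) = (i / 2π) ∮_C (A - z)⁻¹ [B, P] (A - z)⁻¹ dz`. -/
def invLiouvillian (A : 𝓗 →ₗ.[ℂ] 𝓗) (P : 𝓗 →L[ℂ] 𝓗) (C : ℝ → ℂ) (B : 𝓗 →L[ℂ] 𝓗) :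
    𝓗 →L[ℂ] 𝓗 :=
  (Complex.I / (2 * Real.pi)) • ∫ t in (0 : ℝ)..1,
    deriv C t • (resolvent A (C t) * ⁅B, P⁆ * resolvent A (C t))

/-- The domain of `A`, as a type of its own which carries the graph norm
`‖u‖² = ‖u‖_𝓗² + ‖A u‖_𝓗²`. -/
def GraphDomain (A : 𝓗 →ₗ.[ℂ] 𝓗) : Type _ := A.domain

variable (A : 𝓗 →ₗ.[ℂ] 𝓗)

instance : AddCommGroup (GraphDomain A) := inferInstanceAs (AddCommGroup A.domain)

instance : Module ℂ (GraphDomain A) := inferInstanceAs (Module ℂ A.domain)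

/-- The map `u ↦ (u, A u)`. -/
def graphMap : GraphDomain A →ₗ[ℂ] WithLp 2 (𝓗 × 𝓗) :=
  (WithLp.linearEquiv 2 ℂ (𝓗 × 𝓗)).symm.toLinearMap ∘ₗ (A.domain.subtype.prod A.toFun)

theorem graphMap_injective : Function.Injective (graphMap A) := by
  intro u v h
  have h' := congrArg (fun p => (WithLp.ofLp p).1) h
  exact Subtype.ext h'

instance : NormedAddCommGroup (GraphDomain A) :=
  NormedAddCommGroup.induced (GraphDomain A) (WithLp 2 (𝓗 × 𝓗)) (graphMap A) (graphMap_injective A)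

instance : NormedSpace ℂ (GraphDomain A) :=
  NormedSpace.induced ℂ (GraphDomain A) (WithLp 2 (𝓗 × 𝓗)) (graphMap A)

theorem GraphDomain.norm_sq (u : GraphDomain A) :
    ‖u‖ ^ 2 = ‖A.domain.subtype u‖ ^ 2 + ‖A.toFun u‖ ^ 2 := by
  have h : ‖u‖ = ‖graphMap A u‖ := rfl
  rw [h, WithLp.prod_norm_sq_eq_of_L2]
  rfl

/-- The continuous inclusion of the domain of `A`, with the graph norm, into the Hilbert space. -/
def GraphDomain.incl : GraphDomain A →L[ℂ] 𝓗 :=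
  LinearMap.mkContinuous (show GraphDomain A →ₗ[ℂ] 𝓗 from A.domain.subtype) 1 (by
    intro u
    rw [one_mul]
    refine le_of_sq_le_sq ?_ (norm_nonneg _)
    rw [GraphDomain.norm_sq]
    exact le_add_of_nonneg_right (sq_nonneg _))

end Operators

/-! ### Multiplication by a field of isometries -/

section Mul

variable {α F : Type*} [MeasurableSpace α] [NormedAddCommGroup F] [NormedSpace ℂ F]
  [FiniteDimensional ℂ F] {ν : Measure α}

theorem aestronglyMeasurable_apply [MeasurableSpace F] [BorelSpace F] (U : α → F →ₗᵢ[ℂ] F)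
    (hU : ∀ v, Measurable fun x => U x v)
    {f : α → F} (hf : AEStronglyMeasurable f ν) : AEStronglyMeasurable (fun x => U x (f x)) ν := by
  have : ProperSpace F := FiniteDimensional.proper ℂ F
  have h : Measurable (Function.uncurry fun (v : F) (x : α) => U x v) :=
    measurable_uncurry_of_continuous_of_measurable (fun x => (U x).continuous) hU
  have h2 : AEMeasurable (fun x => U x (f x)) ν :=
    h.comp_aemeasurable (hf.aemeasurable.prodMk aemeasurable_id)
  exact h2.aestronglyMeasurable

theorem memLp_apply [MeasurableSpace F] [BorelSpace F] (U : α → F →ₗᵢ[ℂ] F)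
    (hU : ∀ v, Measurable fun x => U x v)
    (f : Lp F 2 ν) : MemLp (fun x => U x (f x)) 2 ν :=
  (Lp.memLp f).of_le (aestronglyMeasurable_apply U hU (Lp.aestronglyMeasurable f))
    (ae_of_all _ fun x => le_of_eq ((U x).norm_map _))

/-- The isometry `f ↦ (x ↦ U x (f x))` of `L²`. -/
def mulIso [MeasurableSpace F] [BorelSpace F] (U : α → F →ₗᵢ[ℂ] F)
    (hU : ∀ v, Measurable fun x => U x v) : Lp F 2 ν →ₗᵢ[ℂ] Lp F 2 ν where
  toFun f := (memLp_apply U hU f).toLp _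
  map_add' f g := by
    refine Lp.ext ?_
    filter_upwards [(memLp_apply U hU (f + g)).coeFn_toLp, (memLp_apply U hU f).coeFn_toLp,
      (memLp_apply U hU g).coeFn_toLp, Lp.coeFn_add f g,
      Lp.coeFn_add ((memLp_apply U hU f).toLp _) ((memLp_apply U hU g).toLp _)]
      with x h1 h2 h3 h4 h5
    rw [h1, h5, Pi.add_apply, h2, h3, h4, Pi.add_apply, map_add]
  map_smul' c f := by
    refine Lp.ext ?_
    filter_upwards [(memLp_apply U hU (c • f)).coeFn_toLp, (memLp_apply U hU f).coeFn_toLp,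
      Lp.coeFn_smul c f, Lp.coeFn_smul c ((memLp_apply U hU f).toLp _)] with x h1 h2 h3 h4
    rw [h1, RingHom.id_apply, h4, Pi.smul_apply, h2, h3, Pi.smul_apply, map_smul]
  norm_map' f := by
    refine le_antisymm (Lp.norm_le_norm_of_ae_le ?_) (Lp.norm_le_norm_of_ae_le ?_)
    · filter_upwards [(memLp_apply U hU f).coeFn_toLp] with x h1
      exact le_of_eq ((congrArg _ h1).trans ((U x).norm_map _))
    · filter_upwards [(memLp_apply U hU f).coeFn_toLp] with x h1
      exact le_of_eq ((congrArg _ h1).trans ((U x).norm_map _)).symm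

theorem coeFn_mulIso [MeasurableSpace F] [BorelSpace F] (U : α → F →ₗᵢ[ℂ] F)
    (hU : ∀ v, Measurable fun x => U x v) (f : Lp F 2 ν) :
    mulIso U hU f =ᵐ[ν] fun x => U x (f x) :=
  (memLp_apply U hU f).coeFn_toLp

/-- The scalar `e^{iθ}` as an isometry. -/
def expIso (θ : ℝ) : F →ₗᵢ[ℂ] F where
  toLinearMap := Complex.exp (θ * Complex.I) • LinearMap.id
  norm_map' v := by simp [norm_smul, Complex.norm_exp_ofReal_mul_I]

end Mul

/-! ### The crystal -/

/-- The ambient space `ℝ^d`. -/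
abbrev Space (d : ℕ) := EuclideanSpace ℝ (Fin d)

/-- The internal degrees of freedom `ℂ^N`. -/
abbrev Spin (N : ℕ) := EuclideanSpace ℂ (Fin N)

/-- A `d`-dimensional crystal for a particle with `N` internal degrees of freedom. -/
structure Crystal (d N : ℕ) where
  /-- generators `a_1, …, a_d` of the Bravais lattice `Γ` -/
  a : Module.Basis (Fin d) ℝ (Space d)
  /-- the configuration space `𝓧 ⊆ ℝ^d` -/
  X : Set (Space d)
  /-- the measure on `𝓧`, extended by zero to `ℝ^d` -/
  ν : Measure (Space d)
  /-- either `𝓧 = ℝ^d` with Lebesgue measure, or `𝓧` is discrete with the counting measure -/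
  config : (X = univ ∧ ν = volume) ∨
    ((∀ K : Set (Space d), IsCompact K → (X ∩ K).Finite) ∧ ν = Measure.count.restrict X)
  /-- the lattice acts on `𝓧` by translations -/
  add_mem : ∀ x ∈ X, ∀ γ ∈ Submodule.span ℤ (Set.range a), x + γ ∈ X
  /-- the unitaries that enter the magnetic translations -/
  M : Submodule.span ℤ (Set.range a) → Space d → (Spin N ≃ₗᵢ[ℂ] Spin N)
  measurable_M : ∀ γ v, Measurable fun x => M γ x v
  cocycle : ∀ γ₁ γ₂, ∀ x ∈ X, M (γ₁ + γ₂) x = M γ₂ x * M γ₁ (x - (γ₂ : Space d))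

namespace Crystal

variable {d N : ℕ} (c : Crystal d N)

/-- The Bravais lattice `Γ`. -/
abbrev lattice : Submodule ℤ (Space d) := Submodule.span ℤ (Set.range c.a)

/-- The primitive unit cell `{∑ t_i a_i | 0 ≤ t_i < 1}`. -/
def cell : Set (Space d) := ZSpan.fundamentalDomain c.a

/-- The reciprocal lattice `Γ^* = {κ | κ · γ ∈ 2πℤ for all γ ∈ Γ}`. -/
def dualLattice : Set (Space d) :=
  {κ | ∀ γ ∈ c.lattice, ∃ n : ℤ, ⟪κ, γ⟫_ℝ = 2 * Real.pi * n}

/-- The fundamental domain `𝔹` of the reciprocal lattice, `{∑ t_i b_i | 0 ≤ t_i < 1}` in terms of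
the basis `b` with `b_i · a_l = 2π δ_il`. -/
def brillouin : Set (Space d) := {k | ∀ i, ⟪k, c.a i⟫_ℝ ∈ Ico 0 (2 * Real.pi)}

/-- The one-particle Hilbert space `𝓗 = L²(𝓧, ℂ^N)`. -/
abbrev H : Type := Lp (Spin N) 2 c.ν

/-- The fibre Hilbert space `𝓗_f`. A locally square integrable `φ` with `T_γ φ = φ` for all
`γ ∈ Γ` is determined by its restriction to the unit cell, which can be an arbitrary `L²` function,
and its norm is the `L²` norm over the cell; `φ` is represented by this restriction. -/
abbrev Hf : Type := Lp (Spin N) 2 (c.ν.restrict c.cell)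

theorem measurableSet_X : MeasurableSet c.X := by
  rcases c.config with ⟨h, -⟩ | ⟨h, -⟩
  · rw [h]; exact MeasurableSet.univ
  · have h1 : c.X = ⋃ n : ℕ, c.X ∩ Metric.closedBall 0 n := by
      rw [← inter_iUnion, Metric.iUnion_closedBall_nat, inter_univ]
    rw [h1]
    exact MeasurableSet.iUnion fun n =>
      (h _ (isCompact_closedBall (0 : Space d) n)).measurableSet

theorem measurePreserving_sub (γ : c.lattice) :
    MeasurePreserving (fun x : Space d => x - (γ : Space d)) c.ν c.ν := by
  rcases c.config with ⟨-, h⟩ | ⟨-, h⟩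
  · rw [h]; exact measurePreserving_sub_right volume (γ : Space d)
  · have h1 : MeasurePreserving (fun x : Space d => x - (γ : Space d)) Measure.count
        Measure.count := measurePreserving_sub_right _ _
    have h2 := h1.restrict_preimage c.measurableSet_X
    have h3 : (fun x : Space d => x - (γ : Space d)) ⁻¹' c.X = c.X := by
      ext x
      constructor
      · intro hx
        simpa using c.add_mem _ hx γ γ.2
      · intro hx
        simpa [sub_eq_add_neg] using c.add_mem x hx (-γ : Space d) (neg_mem γ.2)
    rw [h3] at h2
    rw [h]; exact h2

/-- The magnetic translation `(T_γ ψ)(x) = M(γ, x) ψ(x - γ)`. -/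
def T (γ : c.lattice) : c.H →ₗᵢ[ℂ] c.H :=
  (mulIso (fun x => (c.M γ x).toLinearIsometry) (c.measurable_M γ)).comp
    (Lp.compMeasurePreservingₗᵢ ℂ _ (c.measurePreserving_sub γ))

/-- `A` is `Γ`-periodic: `[A, T_γ] = 0` for all `γ ∈ Γ`. -/
def IsPeriodic (A : c.H →ₗ.[ℂ] c.H) : Prop :=
  ∀ (γ : c.lattice) (ψ : A.domain), ∃ h : c.T γ ψ ∈ A.domain, A ⟨c.T γ ψ, h⟩ = c.T γ (A ψ)

theorem measurable_phase (k : Space d) (v : Spin N) :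
    Measurable fun y : Space d => (expIso ⟪k, y⟫_ℝ : Spin N →ₗᵢ[ℂ] Spin N) v := by
  have : Continuous fun y : Space d => Complex.exp ((⟪k, y⟫_ℝ : ℝ) * Complex.I) • v := by fun_prop
  exact this.measurable

/-- Multiplication by `y ↦ e^{i k·y}` on the unit cell. -/
def phase (k : Space d) : c.Hf →ₗᵢ[ℂ] c.Hf :=
  mulIso (fun y => expIso ⟪k, y⟫_ℝ) (measurable_phase k)

/-- The operator `(ϱ(κ) φ)(y) = e^{-i κ·y} φ(y)` on `𝓗_f`, for `κ` in the reciprocal lattice. -/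
def rho (κ : Space d) : c.Hf →ₗᵢ[ℂ] c.Hf := c.phase (-κ)

/-- The summand `e^{-i k·y} e^{i k·γ} (T_γ ψ)(y)`, `y` in the unit cell, of the
Bloch–Floquet–Zak transform. -/
def bfzTerm (ψ : c.H) (k : Space d) (γ : c.lattice) : c.Hf :=
  Complex.exp ((⟪k, (γ : Space d)⟫_ℝ : ℝ) * Complex.I) •
    c.phase (-k) (LpToLpRestrictCLM (Space d) (Spin N) ℂ c.ν 2 c.cell (c.T γ ψ))

/-- `φ : ℝ^d → 𝓗_f` represents the (magnetic) Bloch–Floquet–Zak transform of `ψ`: it is measurable,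
`ϱ`-equivariant, and on the fundamental domain `𝔹` it is the sum of the series
`(𝓤 ψ)(k, y) = e^{-i k·y} ∑_{γ ∈ Γ} e^{i k·γ} (T_γ ψ)(y)`, which converges
unconditionally in `L²(𝔹, 𝓗_f)` (and is locally finite when `ψ` has compact support). -/
structure IsBFZ (ψ : c.H) (φ : Space d → c.Hf) : Prop where
  meas : AEStronglyMeasurable φ volume
  equivariant : ∀ κ ∈ c.dualLattice, ∀ᵐ k, φ (k + κ) = c.rho κ (φ k)
  tendsto : Tendsto (fun s : Finset c.lattice =>
    eLpNorm (fun k => φ k - ∑ γ ∈ s, c.bfzTerm ψ k γ) 2 (volume.restrict c.brillouin)) atTop (𝓝 0)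

theorem continuous_phase (u : c.Hf) : Continuous fun k => c.phase k u := by
  obtain ⟨R, hR⟩ := (ZSpan.fundamentalDomain_isBounded c.a).exists_norm_le
  have key : ∀ k k', ‖c.phase k u - c.phase k' u‖ ≤ R * ‖u‖ * ‖k - k'‖ := by
    intro k k'
    have h1 : ‖c.phase k u - c.phase k' u‖ ≤ (R * ‖k - k'‖) * ‖u‖ := by
      refine Lp.norm_le_mul_norm_of_ae_le_mul ?_
      filter_upwards [Lp.coeFn_sub (c.phase k u) (c.phase k' u),
        coeFn_mulIso (fun y => expIso ⟪k, y⟫_ℝ) (measurable_phase k) u,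
        coeFn_mulIso (fun y => expIso ⟪k', y⟫_ℝ) (measurable_phase k') u,
        ae_restrict_mem (ZSpan.fundamentalDomain_measurableSet c.a)] with y h1 h2 h3 h4
      have h5 : (c.phase k u - c.phase k' u) y = (Complex.exp (⟪k, y⟫_ℝ * Complex.I)
          - Complex.exp (⟪k', y⟫_ℝ * Complex.I)) • u y := by
        rw [h1, sub_smul]
        exact congrArg₂ (· - ·) h2 h3
      rw [h5, norm_smul]
      refine mul_le_mul_of_nonneg_right ?_ (norm_nonneg _)
      have h6 : Complex.exp (⟪k, y⟫_ℝ * Complex.I) - Complex.exp (⟪k', y⟫_ℝ * Complex.I)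
          = Complex.exp (⟪k', y⟫_ℝ * Complex.I)
            * (Complex.exp (Complex.I * (⟪k - k', y⟫_ℝ : ℝ)) - 1) := by
        rw [mul_sub, mul_one, ← Complex.exp_add, inner_sub_left]
        push_cast
        ring_nf
      rw [h6, norm_mul, Complex.norm_exp_ofReal_mul_I, one_mul]
      calc _ ≤ ‖(⟪k - k', y⟫_ℝ : ℝ)‖ := Real.norm_exp_I_mul_ofReal_sub_one_le
        _ ≤ ‖k - k'‖ * ‖y‖ := norm_inner_le_norm _ _
        _ ≤ ‖k - k'‖ * R := mul_le_mul_of_nonneg_left (hR y h4) (norm_nonneg _)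
        _ = R * ‖k - k'‖ := mul_comm _ _
    linarith
  rw [continuous_iff_continuousAt]
  intro k
  rw [ContinuousAt, tendsto_iff_norm_sub_tendsto_zero]
  refine squeeze_zero (fun _ => norm_nonneg _) (fun k' => key k' k) ?_
  have : Continuous fun k' => R * ‖u‖ * ‖k' - k‖ := by fun_prop
  simpa using this.tendsto k

theorem continuous_bfzTerm (ψ : c.H) (γ : c.lattice) : Continuous fun k => c.bfzTerm ψ k γ := by
  unfold bfzTerm
  exact (by fun_prop : Continuous fun k : Space d =>
    Complex.exp ((⟪k, (γ : Space d)⟫_ℝ : ℝ) * Complex.I)).smul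
      ((c.continuous_phase _).comp continuous_neg)

variable {c}

theorem IsBFZ.zero : c.IsBFZ 0 fun _ => 0 where
  meas := aestronglyMeasurable_const
  equivariant κ _ := ae_of_all _ fun _ => (map_zero _).symm
  tendsto := by simp [bfzTerm]

theorem IsBFZ.add {ψ ψ' : c.H} {φ φ' : Space d → c.Hf} (h : c.IsBFZ ψ φ) (h' : c.IsBFZ ψ' φ') :
    c.IsBFZ (ψ + ψ') fun k => φ k + φ' k where
  meas := h.meas.add h'.meas
  equivariant κ hκ := by
    filter_upwards [h.equivariant κ hκ, h'.equivariant κ hκ] with k h1 h2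
    rw [h1, h2, map_add]
  tendsto := by
    have hm : ∀ {ψ : c.H} {φ : Space d → c.Hf} (_ : c.IsBFZ ψ φ) (s : Finset c.lattice),
        AEStronglyMeasurable (fun k => φ k - ∑ γ ∈ s, c.bfzTerm ψ k γ)
          (volume.restrict c.brillouin) := fun hh s => hh.meas.restrict.sub
      (continuous_finsetSum s fun γ _ => c.continuous_bfzTerm _ γ).aestronglyMeasurable
    refine tendsto_of_tendsto_of_tendsto_of_le_of_le tendsto_const_nhds
      (by simpa using h.tendsto.add h'.tendsto) (fun _ => zero_le) fun s => ?_
    refine le_trans (le_of_eq ?_) (eLpNorm_add_le (hm h s) (hm h' s) one_le_two)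
    congr 1
    funext k
    simp only [bfzTerm, map_add, smul_add, Finset.sum_add_distrib, Pi.add_apply]
    abel

theorem IsBFZ.smul (z : ℂ) {ψ : c.H} {φ : Space d → c.Hf} (h : c.IsBFZ ψ φ) :
    c.IsBFZ (z • ψ) fun k => z • φ k where
  meas := h.meas.const_smul z
  equivariant κ hκ := by
    filter_upwards [h.equivariant κ hκ] with k h1
    rw [h1, map_smul]
  tendsto := by
    have h1 := ENNReal.Tendsto.const_mul (a := ‖z‖ₑ) h.tendsto (Or.inr enorm_ne_top)
    rw [mul_zero] at h1
    refine h1.congr fun s => ?_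
    rw [← eLpNorm_const_smul]
    congr 1
    funext k
    simp only [bfzTerm, map_smul, Pi.smul_apply, smul_sub, Finset.smul_sum]
    congr 1
    exact Finset.sum_congr rfl fun γ _ => smul_comm _ _ _

variable (c)

section Fibration

variable {V₁ V₂ : Type*} [NormedAddCommGroup V₁] [NormedSpace ℂ V₁]
  [NormedAddCommGroup V₂] [NormedSpace ℂ V₂]

/-- For spaces `V₁, V₂` continuously embedded in `𝓗_f` (via `i₁, i₂`), the operator `A` with domain
`𝓤⁻¹ L²_ϱ(ℝ^d, V₁)` acts in Bloch–Floquet–Zak representation as the fibred operator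
`∫^⊕ a(k) dk` with `a(k) ∈ 𝓛(V₁, V₂)`. -/
def IsFibration (A : c.H →ₗ.[ℂ] c.H) (i₁ : V₁ →L[ℂ] c.Hf) (i₂ : V₂ →L[ℂ] c.Hf)
    (a : Space d → V₁ →L[ℂ] V₂) : Prop :=
  ∀ (ψ : c.H) (φ : Space d → c.Hf), c.IsBFZ ψ φ →
    (ψ ∈ A.domain ↔
      ∃ f : Space d → V₁, MemLp f 2 (volume.restrict c.brillouin) ∧ ∀ᵐ k, i₁ (f k) = φ k) ∧
    ∀ (h : ψ ∈ A.domain) (f : Space d → V₁), (∀ᵐ k, i₁ (f k) = φ k) →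
      c.IsBFZ (A ⟨ψ, h⟩) fun k => i₂ (a k (f k))

/-- `A` belongs to `𝓟(V₁, V₂)`, i.e. is periodic with a smooth fibration `k ↦ A(k) ∈ 𝓛(V₁, V₂)`,
and its norm `max_{k ∈ 𝔹} ‖A(k)‖` is at most `B`. -/
def MemPLe (A : c.H →ₗ.[ℂ] c.H) (i₁ : V₁ →L[ℂ] c.Hf) (i₂ : V₂ →L[ℂ] c.Hf) (B : ℝ) : Prop :=
  c.IsPeriodic A ∧ ∃ a : Space d → V₁ →L[ℂ] V₂,
    ContDiff ℝ ∞ a ∧ c.IsFibration A i₁ i₂ a ∧ ∀ k ∈ c.brillouin, ‖a k‖ ≤ B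

/-- `A` belongs to `𝓟(V₁, V₂)`: it is periodic with a smooth fibration
`k ↦ A(k) ∈ 𝓛(V₁, V₂)`. -/
def MemP (A : c.H →ₗ.[ℂ] c.H) (i₁ : V₁ →L[ℂ] c.Hf) (i₂ : V₂ →L[ℂ] c.Hf) : Prop :=
  c.IsPeriodic A ∧ ∃ a : Space d → V₁ →L[ℂ] V₂, ContDiff ℝ ∞ a ∧ c.IsFibration A i₁ i₂ a

/-- `𝓤⁻¹ C^∞_ϱ(ℝ^d, V₁)`: the vectors whose Bloch–Floquet–Zak transform is a smooth
(`ϱ`-equivariant) map `ℝ^d → V₁`. -/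
def smoothCore (i₁ : V₁ →L[ℂ] c.Hf) : Submodule ℂ c.H where
  carrier := {ψ | ∃ φ : Space d → V₁, ContDiff ℝ ∞ φ ∧ c.IsBFZ ψ fun k => i₁ (φ k)}
  add_mem' := by
    rintro ψ ψ' ⟨φ, h1, h2⟩ ⟨φ', h1', h2'⟩
    exact ⟨fun k => φ k + φ' k, h1.add h1', by simpa using h2.add h2'⟩
  zero_mem' := ⟨fun _ => 0, contDiff_const, by simpa using IsBFZ.zero⟩
  smul_mem' := by
    rintro z ψ ⟨φ, h1, h2⟩
    exact ⟨fun k => z • φ k, contDiff_const.smul h1, by simpa using h2.smul z⟩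

end Fibration

/-- The standing assumption on the unperturbed Hamiltonian `H₀` with fibration `k ↦ h k`, the Fermi
energy `μ` and the Fermi projection `P = χ_{(-∞, μ)}(H₀)`. -/
structure IsGapped (H₀ : c.H →ₗ.[ℂ] c.H) (h : Space d → c.Hf →ₗ.[ℂ] c.Hf) (μ : ℝ)
    (P : c.H →L[ℂ] c.H) : Prop where
  selfAdjoint : IsSelfAdjoint H₀
  boundedBelow : BoundedBelow H₀
  periodic : c.IsPeriodic H₀
  /-- the fibres are self-adjoint with a common domain `𝓓_f` -/
  fibre_selfAdjoint : ∀ k, IsSelfAdjoint (h k)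
  fibre_domain : ∀ k, (h k).domain = (h 0).domain
  /-- `ϱ(κ)` maps `𝓓_f` to `𝓓_f`, and `h(k + κ) = ϱ(κ) h(k) ϱ(κ)⁻¹` -/
  rho_domain : ∀ κ ∈ c.dualLattice, ∀ u ∈ (h 0).domain, c.rho κ u ∈ (h 0).domain
  fibre_equivariant : ∀ κ ∈ c.dualLattice, ∀ k, ∀ (u : (h k).domain) (v : (h (k + κ)).domain),
    (v : c.Hf) = c.rho κ u → h (k + κ) v = c.rho κ (h k u)
  /-- `k ↦ h k` is smooth into `𝓛(𝓓_f, 𝓗_f)`, where `𝓓_f` has the graph norm of `h 0`, and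
  it is the fibration of `H₀` -/
  smooth_fibration : ∃ a : Space d → GraphDomain (h 0) →L[ℂ] c.Hf,
    (∀ k, ∀ (u : GraphDomain (h 0)) (v : (h k).domain),
      (v : c.Hf) = GraphDomain.incl (h 0) u → h k v = a k u) ∧
    ContDiff ℝ ∞ a ∧
    c.IsFibration H₀ (GraphDomain.incl (h 0)) (ContinuousLinearMap.id ℂ c.Hf) a
  /-- `μ` lies in a spectral gap -/
  gap : (μ : ℂ) ∈ resolventSet H₀
  fermi : IsSpectralProjection H₀ (Iio μ) P
  /-- the fibration of the Fermi projection takes values in the finite rank projections -/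
  finiteRank : ∃ p : Space d → c.Hf →L[ℂ] c.Hf,
    (∀ k, IsStarProjection (p k) ∧ FiniteDimensional ℂ (LinearMap.range (p k : c.Hf →ₗ[ℂ] c.Hf))) ∧
    c.IsFibration (full P) (ContinuousLinearMap.id ℂ c.Hf) (ContinuousLinearMap.id ℂ c.Hf) p

theorem memLp_position_add (j : Fin d) {f g : c.H} (hf : MemLp (fun x : Space d => x j • f x) 2 c.ν)
    (hg : MemLp (fun x : Space d => x j • g x) 2 c.ν) :
    MemLp (fun x : Space d => x j • (f + g) x) 2 c.ν := by
  refine (hf.add hg).ae_eq ?_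
  filter_upwards [Lp.coeFn_add f g] with x h
  simp only [Pi.add_apply, h, smul_add]

theorem memLp_position_smul (j : Fin d) (z : ℂ) {f : c.H}
    (hf : MemLp (fun x : Space d => x j • f x) 2 c.ν) :
    MemLp (fun x : Space d => x j • (z • f) x) 2 c.ν := by
  refine (hf.const_smul z).ae_eq ?_
  filter_upwards [Lp.coeFn_smul z f] with x h
  simp only [Pi.smul_apply, h]
  rw [smul_comm]

/-- The position operator `(X_j ψ)(x) = x_j ψ(x)` on its maximal domain. -/
def position (j : Fin d) : c.H →ₗ.[ℂ] c.H where
  domain :=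
    { carrier := {ψ | MemLp (fun x : Space d => x j • ψ x) 2 c.ν}
      add_mem' := fun hf hg => c.memLp_position_add j hf hg
      zero_mem' := by
        refine (MemLp.zero (ε := Spin N) (p := 2) (μ := c.ν)).ae_eq ?_
        filter_upwards [Lp.coeFn_zero (Spin N) 2 c.ν] with x h
        change (0 : Spin N) = x j • ((0 : c.H) x)
        rw [h, Pi.zero_apply, smul_zero]
      smul_mem' := fun z _ hf => c.memLp_position_smul j z hf }
  toFun :=
    { toFun := fun ψ => MemLp.toLp (fun x : Space d => x j • (ψ : c.H) x) ψ.2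
      map_add' := by
        intro f g
        rw [← MemLp.toLp_add]
        refine MemLp.toLp_congr _ _ ?_
        filter_upwards [Lp.coeFn_add (f : c.H) (g : c.H)] with x h
        simp only [Submodule.coe_add, Pi.add_apply, h, smul_add]
      map_smul' := by
        intro z f
        rw [RingHom.id_apply, ← MemLp.toLp_const_smul]
        refine MemLp.toLp_congr _ _ ?_
        filter_upwards [Lp.coeFn_smul z (f : c.H)] with x h
        simp only [Submodule.coe_smul, Pi.smul_apply, h]
        rw [smul_comm] }

end Crystal

end Neass

end

open scoped BoundedContinuousFunction

set_option linter.unusedSectionVars false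

noncomputable section

namespace Neass

/-! ### Contour integrals of pseudo-resolvents -/

section PseudoResolvent

/-! The Bloch–Floquet–Zak transform turns multiplication by a continuous equivariant family b(k)
into a bounded periodic operator (`op`), and turns X_j into i∂_j on smooth sections
(`isBFZ_position`). By the Leibniz rule [X_j, op b] has the fibres i∂_j b(k), so it is bounded as
soon as b is smooth and equivariant. The fibres of (H₀ - z)⁻¹ are the resolvents of H₀(k), which
depend smoothly on (k, z) as maps from 𝓗_f to 𝓓_f (`IsGapped.op_resolventFam`,
`IsGapped.contDiffAt_fibResolvent`). Since Π₀ is the Riesz integral of the resolvent over C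
(`IsSpectralMeasure.eq_rieszIntegral`), both Π₀ and the operators that 𝓘 makes out of smooth
families have smooth fibres in 𝓛(𝓗_f, 𝓓_f).

The algebra is as follows. Write P = Π₀ and let K be the closure of [X_j, P]. Differentiating P² = P
gives KP + PK = K, so K is off-diagonal with respect to P and [[K, P], P] = K. The first resolvent
identity gives [H₀, 𝓘(B)] = [[B, P], P], stated between two resolvents so that no domains intervene
(`resolvent_lie_invLiouvillian`). Because P commutes with the resolvents and ad_P³ = ad_P, also
[𝓘([B, P]), P] = 𝓘(B) (`lie_invLiouvillian`). With S = i𝓘([K, P]), the derivative of e^{-iεS} P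
e^{iεS} at ε = 0 is therefore -i[S, P] = 𝓘(K) = P₁, and [H₀, P₁] = K. Hence [H₀ - εX_j, Π^ε] = [H₀,
P] + ε([H₀, P₁] - K) + O(ε²), where the terms of order 0 and 1 vanish.

For the remainders, the fibres of Π^ε and of the commutator are smooth functions of (ε, k), and
Taylor's formula is uniform on the compact set [0,1] × closure 𝔹 (`exists_taylor_bound`). The
commutator of H₀ with a self-adjoint B whose fibres b(k) lift to 𝓓_f is bounded, with fibres
h(k)b(k) - (h(k)b(k))*. Finally, the commutator of a symmetric with a bounded self-adjoint operator
is skew-symmetric on its natural domain, so once it agrees with a bounded operator on a dense core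
it agrees with it everywhere (`comm_eq_of_core`); this is why the choice of domain does not affect
the closure. -/

theorem continuousOn_of_resolvent_identity {𝒜 : Type*} [NormedRing 𝒜] [NormedAlgebra ℂ 𝒜]
    [CompleteSpace 𝒜] {s : Set ℂ} {r : ℂ → 𝒜}
    (h : ∀ z ∈ s, ∀ w ∈ s, r z - r w = (z - w) • (r z * r w)) : ContinuousOn r s := by
  intro w hw
  -- The identity reads `r z * (1 - (z - w) • r w) = r w`. The second factor tends to 1, so it is
  -- eventually a unit, and `Ring.inverse` is continuous at 1. Working in an abstract Banach algebra
  -- serves both the resolvents on 𝓗 and the families of their fibres.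
  have hx : Tendsto (fun z : ℂ => (1 : 𝒜) - (z - w) • r w) (𝓝[s] w) (𝓝 ((1 : 𝒜ˣ) : 𝒜)) := by
    have : Continuous fun z : ℂ => (1 : 𝒜) - (z - w) • r w := by fun_prop
    simpa using (this.tendsto w).mono_left nhdsWithin_le_nhds
  have hinv := ((NormedRing.inverse_continuousAt (1 : 𝒜ˣ)).tendsto.comp hx).const_mul (r w)
  have hu : ∀ᶠ z in 𝓝[s] w, IsUnit ((1 : 𝒜) - (z - w) • r w) :=
    hx.eventually (Units.nhds (1 : 𝒜ˣ))
  have h1 : r w * Ring.inverse ((1 : 𝒜ˣ) : 𝒜) = r w := by simp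
  rw [h1] at hinv
  refine hinv.congr' ?_
  filter_upwards [hu, self_mem_nhdsWithin] with z hz hzs
  have h2 : r z * ((1 : 𝒜) - (z - w) • r w) = r w := by
    have := h z hzs w hw
    rw [mul_sub, mul_one, mul_smul_comm, ← this]; abel
  rw [Function.comp_apply]
  nth_rewrite 1 [← h2]
  rw [mul_assoc, Ring.mul_inverse_cancel _ hz, mul_one]

/-- The Lipschitz constant bounds `deriv C` at every interior point; where C is not differentiable,
`deriv` is 0 and the bound still holds. -/
theorem intervalIntegrable_deriv_smul {V : Type*} [NormedAddCommGroup V] [NormedSpace ℂ V]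
    {L : ℝ≥0} {C : ℝ → ℂ} (hC : LipschitzOnWith L C (Icc 0 1)) {f : ℝ → V}
    (hf : ContinuousOn f (Icc 0 1)) :
    IntervalIntegrable (fun t => deriv C t • f t) volume 0 1 := by
  rw [intervalIntegrable_iff_integrableOn_Ioo_of_le zero_le_one]
  have hfi : IntegrableOn f (Ioo 0 1) volume :=
    (hf.integrableOn_Icc).mono_set Ioo_subset_Icc_self
  refine Integrable.bdd_smul hfi (C := L)
    (measurable_deriv C).aestronglyMeasurable ?_
  filter_upwards [ae_restrict_mem measurableSet_Ioo] with t ht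
  exact norm_deriv_le_of_lipschitzOn (Icc_mem_nhds ht.1 ht.2) hC

end PseudoResolvent

/-! ### Resolvents of partially defined operators -/

section Resolvent

variable {𝓗 : Type*} [NormedAddCommGroup 𝓗] [InnerProductSpace ℂ 𝓗] {A : 𝓗 →ₗ.[ℂ] 𝓗}

theorem IsResolventAt.eq {z : ℂ} {R R' : 𝓗 →L[ℂ] 𝓗} (h : IsResolventAt A z R)
    (h' : IsResolventAt A z R') : R = R' := by
  ext ψ
  obtain ⟨hd, he⟩ := h'.1 ψ
  have := h.2 ⟨R' ψ, hd⟩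
  rw [he] at this
  exact this

theorem isResolventAt_resolvent {z : ℂ} (hz : z ∈ resolventSet A) :
    IsResolventAt A z (resolvent A z) := by
  unfold resolvent
  rw [dif_pos hz]
  exact hz.choose_spec

theorem resolvent_sub {z w : ℂ} (hz : z ∈ resolventSet A) (hw : w ∈ resolventSet A) :
    resolvent A z - resolvent A w = (z - w) • (resolvent A z * resolvent A w) := by
  ext ψ
  obtain ⟨hd, he⟩ := (isResolventAt_resolvent hw).1 ψ
  have h1 := (isResolventAt_resolvent hz).2 ⟨_, hd⟩
  have h2 : A ⟨resolvent A w ψ, hd⟩ - z • resolvent A w ψ = ψ - (z - w) • resolvent A w ψ := by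
    rw [sub_eq_iff_eq_add] at he
    rw [he, sub_smul]; abel
  simp only [h2, map_sub, map_smul] at h1
  change resolvent A z ψ - resolvent A w ψ = (z - w) • resolvent A z (resolvent A w ψ)
  rw [sub_eq_iff_eq_add] at h1
  rw [h1]; abel

theorem commute_resolvent {z w : ℂ} (hz : z ∈ resolventSet A) (hw : w ∈ resolventSet A) :
    Commute (resolvent A z) (resolvent A w) := by
  by_cases h : z = w
  · rw [h]
  · have h1 := resolvent_sub hz hw
    have h2 := resolvent_sub hw hz
    have h3 : (z - w) • (resolvent A z * resolvent A w)
        = (z - w) • (resolvent A w * resolvent A z) := by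
      rw [← h1, ← neg_sub w z, neg_smul, ← h2, neg_sub]
    exact smul_right_injective _ (sub_ne_zero.2 h) h3

theorem continuousOn_resolvent [CompleteSpace 𝓗] :
    ContinuousOn (resolvent A) (resolventSet A) :=
  continuousOn_of_resolvent_identity fun _ hz _ hw => resolvent_sub hz hw

/-- The graph of B is closed and contains the graph of f; conversely each (ψ, Bψ) is a limit of
points of the graph of f by density. Closability is obtained along the way; it has to be, because
`closure` leaves a non-closable operator unchanged. -/
theorem closure_eq_full {f : 𝓗 →ₗ.[ℂ] 𝓗} (hf : Dense (f.domain : Set 𝓗)) (B : 𝓗 →L[ℂ] 𝓗)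
    (h : ∀ ψ : f.domain, f ψ = B ψ) : f.closure = full B := by
  have hg : f.graph.topologicalClosure = (full B).graph := by
    refine le_antisymm ?_ ?_
    · refine Submodule.topologicalClosure_minimal _ ?_ ?_
      · intro x hx
        rw [LinearPMap.mem_graph_iff] at hx ⊢
        obtain ⟨y, hy1, hy2⟩ := hx
        refine ⟨⟨y, trivial⟩, hy1, ?_⟩
        rw [← hy2, h y]; rfl
      · have h1 : ((full B).graph : Set (𝓗 × 𝓗)) = {x | B x.1 = x.2} := by
          ext x
          rw [SetLike.mem_coe, LinearPMap.mem_graph_iff]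
          constructor
          · rintro ⟨y, hy1, hy2⟩
            change B x.1 = x.2
            rw [← hy2, ← hy1]; rfl
          · intro hx
            exact ⟨⟨x.1, trivial⟩, rfl, hx⟩
        rw [h1]
        exact isClosed_eq (by fun_prop) (by fun_prop)
    · intro x hx
      rw [LinearPMap.mem_graph_iff] at hx
      obtain ⟨y, hy1, hy2⟩ := hx
      have h2 : x = (fun ψ => (ψ, B ψ)) (y : 𝓗) := by
        ext
        · exact hy1.symm
        · exact hy2.symm
      rw [h2]
      have hc : Continuous fun ψ : 𝓗 => (ψ, B ψ) := by fun_prop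
      refine map_mem_closure (f := fun ψ : 𝓗 => (ψ, B ψ)) hc (hf _) ?_
      intro ψ hψ
      rw [SetLike.mem_coe]
      refine (LinearPMap.mem_graph_iff f).2 ?_
      exact ⟨⟨ψ, hψ⟩, rfl, h _⟩
  have hcl : f.IsClosable := ⟨_, hg⟩
  exact LinearPMap.eq_of_eq_graph (by rw [← hcl.graph_closure_eq_closure_graph, hg])

theorem isClosed_range_graphMap (hA : A.IsClosed) : IsClosed (Set.range (graphMap A)) := by
  have h : Set.range (graphMap A) = WithLp.ofLp ⁻¹' (A.graph : Set (𝓗 × 𝓗)) := by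
    ext x
    rw [Set.mem_preimage, SetLike.mem_coe, LinearPMap.mem_graph_iff]
    constructor
    · rintro ⟨u, rfl⟩
      exact ⟨u, rfl, rfl⟩
    · rintro ⟨u, hu1, hu2⟩
      refine ⟨u, ?_⟩
      apply WithLp.ofLp_injective
      exact Prod.ext hu1 hu2
  rw [h]
  exact IsClosed.preimage (WithLp.prod_continuous_ofLp 2 𝓗 𝓗) hA

theorem completeSpace_graphDomain [CompleteSpace 𝓗] (hA : A.IsClosed) :
    CompleteSpace (GraphDomain A) := by
  have hi : Isometry (graphMap A) := by
    refine AddMonoidHomClass.isometry_of_norm _ fun _ => rfl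
  rw [completeSpace_iff_isComplete_range hi.isUniformInducing]
  exact (isClosed_range_graphMap hA).isComplete

theorem GraphDomain.incl_injective (A : 𝓗 →ₗ.[ℂ] 𝓗) : Function.Injective (GraphDomain.incl A) :=
  fun _ _ h => Subtype.ext h

theorem GraphDomain.incl_mem (u : GraphDomain A) : GraphDomain.incl A u ∈ A.domain :=
  Subtype.property (p := fun x => x ∈ A.domain) u

variable [CompleteSpace 𝓗]

theorem inner_map_selfAdjoint (hA : IsSelfAdjoint A) (x y : A.domain) :
    ⟪A x, (y : 𝓗)⟫_ℂ = ⟪(x : 𝓗), A y⟫_ℂ := by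
  have h := LinearPMap.adjoint_isFormalAdjoint (T := A) hA.dense_domain
  rw [LinearPMap.isSelfAdjoint_def.1 hA] at h
  exact h x y

theorem mem_domain_of_selfAdjoint (hA : IsSelfAdjoint A) {y w : 𝓗}
    (h : ∀ x : A.domain, ⟪w, (x : 𝓗)⟫_ℂ = ⟪y, A x⟫_ℂ) : ∃ hy : y ∈ A.domain, A ⟨y, hy⟩ = w := by
  have h1 := LinearPMap.mem_adjoint_domain_of_exists (T := A) y ⟨w, h⟩
  have h2 := LinearPMap.adjoint_apply_eq (T := A) hA.dense_domain ⟨y, h1⟩ h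
  have h3 : A.adjoint = A := LinearPMap.isSelfAdjoint_def.1 hA
  -- Application of a partial map carries a proof of membership in its domain, so the equality of A
  -- with its adjoint is used by substituting a variable B.
  have h4 : ∀ (B : 𝓗 →ₗ.[ℂ] 𝓗), B = A → ∀ h : y ∈ B.domain, B ⟨y, h⟩ = w →
      ∃ hy : y ∈ A.domain, A ⟨y, hy⟩ = w := by
    rintro B rfl h h'
    exact ⟨h, h'⟩
  exact h4 _ h3 h1 h2

theorem IsResolventAt.adjoint (hA : IsSelfAdjoint A) {z : ℂ} {R : 𝓗 →L[ℂ] 𝓗}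
    (h : IsResolventAt A z R) : IsResolventAt A (starRingEnd ℂ z) (star R) := by
  have hs : ∀ x y, ⟪star R x, y⟫_ℂ = ⟪x, R y⟫_ℂ := fun x y =>
    ContinuousLinearMap.adjoint_inner_left R y x
  refine ⟨fun ψ => ?_, fun φ => ?_⟩
  · have := mem_domain_of_selfAdjoint hA (y := star R ψ) (w := ψ + starRingEnd ℂ z • star R ψ) ?_
    · obtain ⟨h1, h2⟩ := this
      exact ⟨h1, by rw [h2, add_sub_cancel_right]⟩
    · intro x
      have h1 := h.2 x
      rw [hs, inner_add_left, inner_smul_left, hs, Complex.conj_conj, ← inner_smul_right,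
        ← inner_add_right]
      congr 1
      rw [map_sub, map_smul, sub_eq_iff_eq_add] at h1
      exact h1.symm
  · refine ext_inner_right ℂ fun χ => ?_
    obtain ⟨h1, h2⟩ := h.1 χ
    rw [hs, inner_sub_left, inner_map_selfAdjoint hA φ ⟨_, h1⟩, inner_smul_left, Complex.conj_conj,
      ← inner_smul_right, ← inner_sub_right, h2]

theorem conj_mem_resolventSet (hA : IsSelfAdjoint A) {z : ℂ} (hz : z ∈ resolventSet A) :
    starRingEnd ℂ z ∈ resolventSet A :=
  ⟨_, (isResolventAt_resolvent hz).adjoint hA⟩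

theorem isSelfAdjoint_resolvent (hA : IsSelfAdjoint A) {x : ℝ} (hx : (x : ℂ) ∈ resolventSet A) :
    IsSelfAdjoint (resolvent A x) := by
  have h := (isResolventAt_resolvent hx).adjoint hA
  rw [Complex.conj_ofReal] at h
  exact h.eq (isResolventAt_resolvent hx)

/-- A self-adjoint operator has a bounded resolvent at `z` as soon as `A - z` and `A - conj z` are
bounded from below. -/
theorem mem_resolventSet_of_bounds (hA : IsSelfAdjoint A) {z : ℂ} {M M' : ℝ}
    (h : ∀ u : A.domain, ‖(u : 𝓗)‖ ≤ M * ‖A u - z • (u : 𝓗)‖)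
    (h' : ∀ u : A.domain, ‖(u : 𝓗)‖ ≤ M' * ‖A u - (starRingEnd ℂ z) • (u : 𝓗)‖) :
    z ∈ resolventSet A := by
  let T : A.domain →ₗ[ℂ] 𝓗 := A.toFun - z • A.domain.subtype
  have hT : ∀ u, T u = A u - z • (u : 𝓗) := fun u => rfl
  have hinj : Function.Injective T := by
    rw [injective_iff_map_eq_zero]
    intro u hu
    have := h u
    rw [← hT, hu, norm_zero, mul_zero] at this
    exact Subtype.ext (norm_le_zero_iff.1 this)
  -- the range is closed
  have hclosed : IsClosed (Set.range T) := by
    have : CompleteSpace A.graph := by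
      have hcl : _root_.IsClosed (A.graph : Set (𝓗 × 𝓗)) := hA.isClosed
      exact hcl.completeSpace_coe
    let g : A.graph →L[ℂ] 𝓗 :=
      (ContinuousLinearMap.snd ℂ 𝓗 𝓗 - z • ContinuousLinearMap.fst ℂ 𝓗 𝓗).comp A.graph.subtypeL
    have hgr : Set.range g = Set.range T := by
      ext v
      constructor
      · rintro ⟨⟨x, hx⟩, rfl⟩
        rw [LinearPMap.mem_graph_iff] at hx
        obtain ⟨u, hu1, hu2⟩ := hx
        refine ⟨u, ?_⟩
        change A u - z • (u : 𝓗) = x.2 - z • x.1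
        rw [hu1, hu2]
      · rintro ⟨u, rfl⟩
        exact ⟨⟨((u : 𝓗), A u), LinearPMap.mem_graph _ _⟩, rfl⟩
    -- The graph carries the maximum norm: u is at most M‖(A - z)u‖, and Au = (A - z)u + zu is at
    -- most (1 + ‖z‖M)‖(A - z)u‖.
    have hga : AntilipschitzWith (Real.toNNReal (max M (1 + ‖z‖ * M))) g := by
      refine AddMonoidHomClass.antilipschitz_of_bound g ?_
      rintro ⟨x, hx⟩
      have hx' := hx
      rw [LinearPMap.mem_graph_iff] at hx'
      obtain ⟨u, hu1, hu2⟩ := hx'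
      have hgx : g ⟨x, hx⟩ = A u - z • (u : 𝓗) := by
        change x.2 - z • x.1 = _
        rw [hu1, hu2]
      rw [hgx]
      have hu := h u
      have hb : max M (1 + ‖z‖ * M) * ‖A u - z • (u : 𝓗)‖
          ≤ (Real.toNNReal (max M (1 + ‖z‖ * M)) : ℝ) * ‖A u - z • (u : 𝓗)‖ :=
        mul_le_mul_of_nonneg_right (Real.le_coe_toNNReal _) (norm_nonneg _)
      refine le_trans ?_ hb
      change ‖x‖ ≤ _
      rw [Prod.norm_def, ← hu1, ← hu2]
      refine max_le ?_ ?_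
      · exact hu.trans (mul_le_mul_of_nonneg_right (le_max_left _ _) (norm_nonneg _))
      · refine le_trans ?_ (mul_le_mul_of_nonneg_right (le_max_right _ _) (norm_nonneg _))
        calc ‖A u‖ = ‖(A u - z • (u : 𝓗)) + z • (u : 𝓗)‖ := by rw [sub_add_cancel]
          _ ≤ ‖A u - z • (u : 𝓗)‖ + ‖z‖ * ‖(u : 𝓗)‖ := (norm_add_le _ _).trans (by rw [norm_smul])
          _ ≤ ‖A u - z • (u : 𝓗)‖ + ‖z‖ * (M * ‖A u - z • (u : 𝓗)‖) := by gcongr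
          _ = _ := by ring
    rw [← hgr]
    exact hga.isClosed_range g.uniformContinuous
  have hsurj : Function.Surjective T := by
    rw [← LinearMap.range_eq_top]
    have hcl : IsClosed ((LinearMap.range T : Submodule ℂ 𝓗) : Set 𝓗) := by
      rw [LinearMap.coe_range]; exact hclosed
    have : CompleteSpace (LinearMap.range T) := hcl.completeSpace_coe
    -- A vector w orthogonal to the range of A - z lies in the domain of A* = A and satisfies Aw =
    -- conj(z) w, so the bound at conj(z) forces w = 0.
    rw [← Submodule.orthogonal_eq_bot_iff, Submodule.eq_bot_iff]
    intro w hw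
    rw [Submodule.mem_orthogonal'] at hw
    have hw' : ∀ u : A.domain, ⟪w, A u - z • (u : 𝓗)⟫_ℂ = 0 := fun u => hw _ ⟨u, rfl⟩
    obtain ⟨h1, h2⟩ := mem_domain_of_selfAdjoint hA (y := w) (w := starRingEnd ℂ z • w) (by
      intro x
      have := hw' x
      rw [inner_sub_right, sub_eq_zero, inner_smul_right] at this
      rw [this, inner_smul_left, Complex.conj_conj])
    have h3 := h' ⟨w, h1⟩
    rw [h2, sub_self, norm_zero, mul_zero] at h3
    exact norm_le_zero_iff.1 h3
  let e := LinearEquiv.ofBijective T ⟨hinj, hsurj⟩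
  have he : ∀ ψ, A (e.symm ψ) - z • (e.symm ψ : 𝓗) = ψ := fun ψ => e.apply_symm_apply ψ
  refine ⟨LinearMap.mkContinuous (A.domain.subtype ∘ₗ e.symm.toLinearMap) M ?_, ?_, ?_⟩
  · intro ψ
    have := h (e.symm ψ)
    rw [he] at this
    exact this
  · intro ψ
    exact ⟨(e.symm ψ).2, he ψ⟩
  · intro φ
    exact congrArg Subtype.val (e.symm_apply_apply φ)

end Resolvent

/-! ### Algebra of the inverse Liouvillian -/

section Liouvillian

/-- In the block decomposition given by P, the map ad_P is 0 on the diagonal blocks and ±1 on the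
off-diagonal ones, hence equals its cube. -/
theorem lie_lie_lie_of_idempotent {𝒜 : Type*} [Ring 𝒜] {P : 𝒜} (hP : P * P = P) (B : 𝒜) :
    ⁅⁅⁅B, P⁆, P⁆, P⁆ = ⁅B, P⁆ := by
  have h : ∀ x, P * (P * x) = P * x := fun x => by rw [← mul_assoc, hP]
  simp only [Ring.lie_def, mul_sub, sub_mul, mul_assoc, hP, h]
  abel

theorem mul_intervalIntegral_smul {𝒜 : Type*} [NormedRing 𝒜] [NormedAlgebra ℂ 𝒜]
    [CompleteSpace 𝒜] {L : ℝ≥0} {C : ℝ → ℂ} (hC : LipschitzOnWith L C (Icc 0 1)) {f : ℝ → 𝒜}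
    (hf : ContinuousOn f (Icc 0 1)) (a b : 𝒜) :
    a * (∫ t in (0 : ℝ)..1, deriv C t • f t) * b
      = ∫ t in (0 : ℝ)..1, deriv C t • (a * f t * b) := by
  have h := ((ContinuousLinearMap.mul ℂ 𝒜).flip b ∘L ContinuousLinearMap.mul ℂ 𝒜 a
    ).intervalIntegral_comp_comm (intervalIntegrable_deriv_smul hC hf)
  simp only [ContinuousLinearMap.comp_apply, ContinuousLinearMap.flip_apply,
    ContinuousLinearMap.mul_apply', mul_smul_comm, smul_mul_assoc] at h
  exact h.symm

variable {𝓗 : Type*} [NormedAddCommGroup 𝓗] [InnerProductSpace ℂ 𝓗] [CompleteSpace 𝓗]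
  {A : 𝓗 →ₗ.[ℂ] 𝓗}

/-- The Riesz projection `(i / 2π) ∮_C (A - z)⁻¹ dz`. -/
def rieszIntegral (A : 𝓗 →ₗ.[ℂ] 𝓗) (C : ℝ → ℂ) : 𝓗 →L[ℂ] 𝓗 :=
  (Complex.I / (2 * Real.pi)) • ∫ t in (0 : ℝ)..1, deriv C t • resolvent A (C t)

/-- The sandwiched integral `(i / 2π) ∮_C (A - z)⁻¹ D (A - z)⁻¹ dz`. -/
def sandwich (A : 𝓗 →ₗ.[ℂ] 𝓗) (C : ℝ → ℂ) (D : 𝓗 →L[ℂ] 𝓗) : 𝓗 →L[ℂ] 𝓗 :=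
  (Complex.I / (2 * Real.pi)) • ∫ t in (0 : ℝ)..1,
    deriv C t • (resolvent A (C t) * D * resolvent A (C t))

theorem invLiouvillian_eq (P : 𝓗 →L[ℂ] 𝓗) (C : ℝ → ℂ) (B : 𝓗 →L[ℂ] 𝓗) :
    invLiouvillian A P C B = sandwich A C ⁅B, P⁆ := rfl

variable {μ : ℝ} {C : ℝ → ℂ}

theorem IsContour.continuousOn_resolvent (hC : IsContour A μ C) :
    ContinuousOn (fun t => resolvent A (C t)) (Icc 0 1) := by
  obtain ⟨L, hL⟩ := hC.lipschitz
  exact Neass.continuousOn_resolvent.comp hL.continuousOn hC.mem_resolventSet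

theorem IsContour.continuousOn_sandwich (hC : IsContour A μ C) (D : 𝓗 →L[ℂ] 𝓗) :
    ContinuousOn (fun t => resolvent A (C t) * D * resolvent A (C t)) (Icc 0 1) :=
  (hC.continuousOn_resolvent.mul continuousOn_const).mul hC.continuousOn_resolvent

theorem mul_rieszIntegral_mul (hC : IsContour A μ C) (Z Z' : 𝓗 →L[ℂ] 𝓗) :
    Z * rieszIntegral A C * Z' = (Complex.I / (2 * Real.pi)) • ∫ t in (0 : ℝ)..1,
      deriv C t • (Z * resolvent A (C t) * Z') := by
  obtain ⟨L, hL⟩ := hC.lipschitz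
  rw [rieszIntegral, mul_smul_comm, smul_mul_assoc,
    mul_intervalIntegral_smul hL hC.continuousOn_resolvent]

theorem mul_sandwich_mul (hC : IsContour A μ C) (D Z Z' : 𝓗 →L[ℂ] 𝓗) :
    Z * sandwich A C D * Z' = (Complex.I / (2 * Real.pi)) • ∫ t in (0 : ℝ)..1,
      deriv C t • (Z * (resolvent A (C t) * D * resolvent A (C t)) * Z') := by
  obtain ⟨L, hL⟩ := hC.lipschitz
  rw [sandwich, mul_smul_comm, smul_mul_assoc,
    mul_intervalIntegral_smul hL (hC.continuousOn_sandwich D)]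

theorem commute_rieszIntegral (hC : IsContour A μ C) {Z : 𝓗 →L[ℂ] 𝓗}
    (hZ : ∀ z ∈ resolventSet A, Commute Z (resolvent A z)) : Commute Z (rieszIntegral A C) := by
  have h1 := mul_rieszIntegral_mul hC Z 1
  have h2 := mul_rieszIntegral_mul hC 1 Z
  simp only [mul_one, one_mul] at h1 h2
  rw [commute_iff_eq, h1, h2]
  congr 1
  refine intervalIntegral.integral_congr fun t ht => ?_
  rw [uIcc_of_le zero_le_one] at ht
  simp only [(hZ _ (hC.mem_resolventSet t ht)).eq]

/-- By the resolvent identity, (A - z)⁻¹ = V G with G = (A - w)⁻¹ and V = 1 + (z - w)(A - z)⁻¹, and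
V is the inverse of X = 1 - (z - w)G. An operator that commutes with G commutes with X, hence with
V. -/
theorem commute_resolvent_of_commute {Z : 𝓗 →L[ℂ] 𝓗} {w : ℂ} (hw : w ∈ resolventSet A)
    (hZ : Commute Z (resolvent A w)) {z : ℂ} (hz : z ∈ resolventSet A) :
    Commute Z (resolvent A z) := by
  set G := resolvent A w
  set R := resolvent A z
  have h1 : R - G = (z - w) • (R * G) := resolvent_sub hz hw
  have h2 : R - G = (z - w) • (G * R) := by
    rw [h1, (commute_resolvent hz hw).eq]
  have e1 : R = (1 + (z - w) • R) * G := by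
    rw [add_mul, one_mul, smul_mul_assoc, ← h1]; abel
  have e2 : G = R * (1 - (z - w) • G) := by
    rw [mul_sub, mul_one, mul_smul_comm, ← h1]; abel
  have e3 : G = (1 - (z - w) • G) * R := by
    rw [sub_mul, one_mul, smul_mul_assoc, ← h2]; abel
  have hX : Commute Z (1 - (z - w) • G) := (Commute.one_right Z).sub_right (hZ.smul_right _)
  set X := 1 - (z - w) • G
  set V := 1 + (z - w) • R
  have hVX : V * X = 1 := by
    have : V * X = 1 + (z - w) • (R - G - (z - w) • (R * G)) := by
      simp only [V, X, add_mul, mul_sub, one_mul, mul_one, smul_sub, smul_mul_assoc, mul_smul_comm]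
      module
    rw [this, h1, sub_self, smul_zero, add_zero]
  have hXV : X * V = 1 := by
    have : X * V = 1 + (z - w) • (R - G - (z - w) • (G * R)) := by
      simp only [V, X, sub_mul, mul_add, one_mul, mul_one, smul_sub, smul_mul_assoc, mul_smul_comm]
      module
    rw [this, h2, sub_self, smul_zero, add_zero]
  have hV : Commute Z V := by
    have : Z * V = V * X * (Z * V) := by rw [hVX, one_mul]
    rw [commute_iff_eq, this, mul_assoc V X, ← mul_assoc X Z, ← hX.eq, mul_assoc Z, hXV, mul_one]
  rw [e1]
  exact hV.mul_right hZ

/-- Let G be the resolvent at w and R the one at z. The resolvent identity writes GRDR as GRDG and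
RDRG as GDRG, each plus the same term (z - w)GRDRG, so the difference is G(RD - DR)G and the
integral over z produces the Riesz integral. This is [H₀, ∮RDR] = [D, ∮R] sandwiched between
resolvents, which avoids commutators of unbounded operators. -/
theorem resolvent_lie_sandwich (hC : IsContour A μ C) (D : 𝓗 →L[ℂ] 𝓗) {w : ℂ}
    (hw : w ∈ resolventSet A) :
    resolvent A w * sandwich A C D - sandwich A C D * resolvent A w
      = resolvent A w * ⁅rieszIntegral A C, D⁆ * resolvent A w := by
  obtain ⟨L, hL⟩ := hC.lipschitz
  have hi : ∀ {f : ℝ → 𝓗 →L[ℂ] 𝓗}, ContinuousOn f (Icc 0 1) →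
      IntervalIntegrable (fun t => deriv C t • f t) volume 0 1 :=
    fun h => intervalIntegrable_deriv_smul hL h
  have hr := hC.continuousOn_resolvent
  set G := resolvent A w
  have h1 := mul_sandwich_mul hC D G 1
  have h2 := mul_sandwich_mul hC D 1 G
  have h3 := mul_rieszIntegral_mul hC G (D * G)
  have h4 := mul_rieszIntegral_mul hC (G * D) G
  rw [mul_one] at h1
  rw [one_mul] at h2
  have h5 : G * ⁅rieszIntegral A C, D⁆ * G
      = G * rieszIntegral A C * (D * G) - G * D * rieszIntegral A C * G := by
    rw [Ring.lie_def]; noncomm_ring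
  rw [h1, h2, h5, h3, h4, ← smul_sub, ← smul_sub, ← intervalIntegral.integral_sub,
    ← intervalIntegral.integral_sub]
  · congr 1
    refine intervalIntegral.integral_congr fun t ht => ?_
    rw [uIcc_of_le zero_le_one] at ht
    have hz := hC.mem_resolventSet t ht
    simp only [← smul_sub]
    congr 1
    set z := C t
    set R := resolvent A z
    have e1 : R = G + (z - w) • (R * G) := by
      rw [← resolvent_sub hz hw]; abel
    have e2 : R = G + (z - w) • (G * R) := by
      rw [← (commute_resolvent hz hw).eq]; exact e1
    have a1 : G * R * D * R = G * R * D * G + (z - w) • (G * R * D * R * G) := by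
      have : G * R * D * R = G * R * D * (G + (z - w) • (R * G)) := by rw [← e1]
      exact this.trans (by rw [mul_add, mul_smul_comm, ← mul_assoc (G * R * D) R G])
    have a2 : R * D * R * G = G * D * R * G + (z - w) • (G * R * D * R * G) := by
      have : R * D * R * G = (G + (z - w) • (G * R)) * D * R * G := by rw [← e2]
      rw [this]
      simp only [add_mul, smul_mul_assoc]
    calc _ = G * R * D * R - R * D * R * G := by noncomm_ring
      _ = _ := by rw [a1, a2]; noncomm_ring
  · exact hi ((continuousOn_const.mul hr).mul continuousOn_const)
  · exact hi ((continuousOn_const.mul hr).mul continuousOn_const)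
  · exact hi ((continuousOn_const.mul (hC.continuousOn_sandwich D)).mul continuousOn_const)
  · exact hi ((continuousOn_const.mul (hC.continuousOn_sandwich D)).mul continuousOn_const)

theorem mul_sandwich (hC : IsContour A μ C) {Z : 𝓗 →L[ℂ] 𝓗}
    (hZ : ∀ z ∈ resolventSet A, Commute Z (resolvent A z)) (D : 𝓗 →L[ℂ] 𝓗) :
    Z * sandwich A C D = sandwich A C (Z * D) := by
  have h1 := mul_sandwich_mul hC D Z 1
  rw [mul_one] at h1
  rw [h1, sandwich]
  congr 1
  refine intervalIntegral.integral_congr fun t ht => ?_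
  rw [uIcc_of_le zero_le_one] at ht
  have h := (hZ _ (hC.mem_resolventSet t ht)).eq
  simp only [mul_one, ← mul_assoc, h]

theorem sandwich_mul (hC : IsContour A μ C) {Z : 𝓗 →L[ℂ] 𝓗}
    (hZ : ∀ z ∈ resolventSet A, Commute Z (resolvent A z)) (D : 𝓗 →L[ℂ] 𝓗) :
    sandwich A C D * Z = sandwich A C (D * Z) := by
  have h1 := mul_sandwich_mul hC D 1 Z
  rw [one_mul] at h1
  rw [h1, sandwich]
  congr 1
  refine intervalIntegral.integral_congr fun t ht => ?_
  rw [uIcc_of_le zero_le_one] at ht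
  have h := (hZ _ (hC.mem_resolventSet t ht)).eq
  simp only [one_mul, mul_assoc, ← h]

theorem sandwich_sub (hC : IsContour A μ C) (D D' : 𝓗 →L[ℂ] 𝓗) :
    sandwich A C (D - D') = sandwich A C D - sandwich A C D' := by
  obtain ⟨L, hL⟩ := hC.lipschitz
  simp only [sandwich, mul_sub, sub_mul, smul_sub]
  rw [intervalIntegral.integral_sub, smul_sub]
  · exact intervalIntegrable_deriv_smul hL (hC.continuousOn_sandwich D)
  · exact intervalIntegrable_deriv_smul hL (hC.continuousOn_sandwich D')

theorem sandwich_zero : sandwich A C 0 = 0 := by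
  simp [sandwich]

variable {P : 𝓗 →L[ℂ] 𝓗}

theorem commute_of_eq_rieszIntegral (hC : IsContour A μ C) (hP : P = rieszIntegral A C) :
    ∀ z ∈ resolventSet A, Commute P (resolvent A z) := by
  intro z hz
  rw [hP]
  exact (commute_rieszIntegral hC fun w hw => commute_resolvent hz hw).symm

theorem lie_sandwich (hC : IsContour A μ C) (hP : P = rieszIntegral A C) (D : 𝓗 →L[ℂ] 𝓗) :
    ⁅sandwich A C D, P⁆ = sandwich A C ⁅D, P⁆ := by
  have h := commute_of_eq_rieszIntegral hC hP
  rw [Ring.lie_def, Ring.lie_def, sandwich_sub hC, mul_sandwich hC h, sandwich_mul hC h]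

/-- Read without the outer resolvents: [A, 𝓘(B)] = [[B, P], P]. In particular 𝓘 inverts the
Liouvillian [A, ·] on off-diagonal B, for which the right-hand side is B itself. -/
theorem resolvent_lie_invLiouvillian (hC : IsContour A μ C) (hP : P = rieszIntegral A C)
    (B : 𝓗 →L[ℂ] 𝓗) {w : ℂ} (hw : w ∈ resolventSet A) :
    resolvent A w * invLiouvillian A P C B - invLiouvillian A P C B * resolvent A w
      = -(resolvent A w * ⁅⁅B, P⁆, P⁆ * resolvent A w) := by
  have h : ⁅P, ⁅B, P⁆⁆ = -⁅⁅B, P⁆, P⁆ := by simp only [Ring.lie_def, neg_sub]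
  rw [invLiouvillian_eq, resolvent_lie_sandwich hC _ hw, ← hP, h, mul_neg, neg_mul]

/-- P commutes with the resolvents, so the bracket with P passes under the integral, where ad_P³ =
ad_P applies. For B = K this identifies the first-order term -i[S, P] with 𝓘(K). -/
theorem lie_invLiouvillian (hC : IsContour A μ C) (hP : P = rieszIntegral A C) (hPP : P * P = P)
    (B : 𝓗 →L[ℂ] 𝓗) : ⁅invLiouvillian A P C ⁅B, P⁆, P⁆ = invLiouvillian A P C B := by
  rw [invLiouvillian_eq, invLiouvillian_eq, lie_sandwich hC hP, lie_lie_lie_of_idempotent hPP]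

theorem eq_zero_of_offDiagonal_of_commute {𝒜 : Type*} [Ring 𝒜] {P X : 𝒜} (hPP : P * P = P)
    (h1 : P * X * P = 0) (h2 : (1 - P) * X * (1 - P) = 0) (h : Commute X P) : X = 0 := by
  have e1 : P * X * P = X * P := by rw [← h.eq, mul_assoc, hPP]
  have e2 : (1 - P) * X * (1 - P) = X - X * P := by
    have : (1 - P) * X * (1 - P) = X - P * X - X * P + P * X * P := by noncomm_ring
    rw [this, e1, ← h.eq]; abel
  rw [e1] at h1
  rw [e2, h1, sub_zero] at h2
  exact h2

/-- The contour need not be symmetric under conjugation, so the adjoint cannot be found by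
reflecting the integral. Instead, S and its adjoint are both off-diagonal and have the same
commutator with the self-adjoint resolvent at μ. Their difference then commutes with that resolvent,
hence with P, and an off-diagonal operator that commutes with P is zero. -/
theorem isSelfAdjoint_invLiouvillian (hA : IsSelfAdjoint A) (hC : IsContour A μ C)
    (hμ : (μ : ℂ) ∈ resolventSet A) (hP : P = rieszIntegral A C) (hPP : P * P = P)
    (hPs : IsSelfAdjoint P) {Y : 𝓗 →L[ℂ] 𝓗} (hY : IsSelfAdjoint ⁅⁅Y, P⁆, P⁆) :
    IsSelfAdjoint (Complex.I • invLiouvillian A P C Y) := by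
  obtain ⟨S, hS⟩ : ∃ S, S = Complex.I • invLiouvillian A P C Y := ⟨_, rfl⟩
  rw [← hS]
  set G := resolvent A μ with hG
  have hGs : star G = G := isSelfAdjoint_resolvent hA hμ
  have hPs' : star P = P := hPs
  have h1 : G * S - S * G = -(Complex.I • (G * ⁅⁅Y, P⁆, P⁆ * G)) := by
    rw [hS, mul_smul_comm, smul_mul_assoc, ← smul_sub, resolvent_lie_invLiouvillian hC hP _ hμ,
      smul_neg]
  have h2 : G * star S - star S * G = -(Complex.I • (G * ⁅⁅Y, P⁆, P⁆ * G)) := by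
    have := congrArg star h1
    rw [star_sub, star_mul, star_mul, star_neg, star_smul, star_mul, star_mul, hGs, hY.star_eq,
      ← mul_assoc] at this
    rw [← neg_sub, this, Complex.star_def, Complex.conj_I, neg_smul, neg_neg]
  have hpi : P * (1 - P) = 0 := by rw [mul_sub, mul_one, hPP, sub_self]
  have hip : (1 - P) * P = 0 := by rw [sub_mul, one_mul, hPP, sub_self]
  have hcP := commute_of_eq_rieszIntegral hC hP
  have hcP' : ∀ z ∈ resolventSet A, Commute (1 - P) (resolvent A z) := fun z hz =>
    (Commute.one_left _).sub_left (hcP z hz)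
  have h3 : P * S * P = 0 := by
    rw [hS, invLiouvillian_eq, mul_smul_comm, smul_mul_assoc, mul_sandwich hC hcP,
      sandwich_mul hC hcP]
    have : P * ⁅Y, P⁆ * P = P * Y * (P * P) - (P * P) * Y * P := by
      rw [Ring.lie_def]; noncomm_ring
    rw [this, hPP, sub_self, sandwich_zero, smul_zero]
  have h4 : (1 - P) * S * (1 - P) = 0 := by
    rw [hS, invLiouvillian_eq, mul_smul_comm, smul_mul_assoc, mul_sandwich hC hcP',
      sandwich_mul hC hcP']
    have : (1 - P) * ⁅Y, P⁆ * (1 - P) = (1 - P) * Y * (P * (1 - P)) - ((1 - P) * P) * Y * (1 - P) := by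
      rw [Ring.lie_def]; noncomm_ring
    rw [this, hpi, hip, mul_zero, zero_mul, zero_mul, sub_zero, sandwich_zero, smul_zero]
  have h3' : P * star S * P = 0 := by
    have := congrArg star h3
    simpa only [star_mul, hPs', star_zero, mul_assoc] using this
  have h4' : (1 - P) * star S * (1 - P) = 0 := by
    have := congrArg star h4
    simpa only [star_mul, star_sub, star_one, hPs', star_zero, mul_assoc] using this
  have hc : Commute (S - star S) G := by
    rw [commute_iff_eq, sub_mul, mul_sub]
    have := h1.trans h2.symm
    rw [sub_eq_sub_iff_add_eq_add] at this
    rw [sub_eq_sub_iff_add_eq_add, add_comm, ← this, add_comm]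
  have hc' : Commute (S - star S) P := by
    rw [hP]
    exact commute_rieszIntegral hC fun z hz => commute_resolvent_of_commute hμ hc hz
  have h0 : S - star S = 0 := by
    refine eq_zero_of_offDiagonal_of_commute hPP ?_ ?_ hc'
    · rw [mul_sub, sub_mul, h3, h3', sub_zero]
    · rw [mul_sub (1 - P), sub_mul ((1 - P) * S), h4, h4', sub_zero]
  exact (sub_eq_zero.1 h0).symm

end Liouvillian

/-! ### Spectral projections as Riesz integrals -/

section Spectral

variable {𝓗 : Type*} [NormedAddCommGroup 𝓗] [InnerProductSpace ℂ 𝓗] [CompleteSpace 𝓗]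
  {A : 𝓗 →ₗ.[ℂ] 𝓗} {E : Set ℝ → 𝓗 →L[ℂ] 𝓗}

/-- A symmetric form bound by `δ` gives the operator bound `δ`. -/
theorem norm_le_of_form_bound {T : 𝓗 →ₗ[ℂ] 𝓗} (hT : ∀ x y, ⟪T x, y⟫_ℂ = ⟪x, T y⟫_ℂ) {δ : ℝ}
    (h : ∀ x, |(⟪x, T x⟫_ℂ).re| ≤ δ * ‖x‖ ^ 2) (x : 𝓗) : ‖T x‖ ≤ δ * ‖x‖ := by
  by_cases hx : x = 0
  · simp [hx]
  by_cases hTx : T x = 0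
  · rw [hTx, norm_zero]
    have := (abs_nonneg _).trans (h x)
    have hx' : 0 < ‖x‖ := norm_pos_iff.2 hx
    have : 0 ≤ δ := nonneg_of_mul_nonneg_left this (by positivity)
    positivity
  have hx' : 0 < ‖x‖ := norm_pos_iff.2 hx
  have hTx' : 0 < ‖T x‖ := norm_pos_iff.2 hTx
  -- With y = rTx, scaled so that ‖y‖ = ‖x‖, polarisation gives 4r‖Tx‖² as the difference of the
  -- forms at x + y and x - y, and the parallelogram law bounds this by 4δ‖x‖².
  set r : ℝ := ‖x‖ / ‖T x‖ with hr
  set y : 𝓗 := (r : ℂ) • T x with hy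
  have hny : ‖y‖ = ‖x‖ := by
    rw [hy, norm_smul, Complex.norm_real, Real.norm_of_nonneg (by positivity), hr]
    field_simp
  have h1 := (abs_le.1 (h (x + y))).2
  have h2 := (abs_le.1 (h (x - y))).1
  have h3 : (⟪x + y, T (x + y)⟫_ℂ).re - (⟪x - y, T (x - y)⟫_ℂ).re = 4 * (r * ‖T x‖ ^ 2) := by
    have e1 : ⟪x, T y⟫_ℂ = (r : ℂ) * ((‖T x‖ ^ 2 : ℝ) : ℂ) := by
      rw [← hT, hy, inner_smul_right, inner_self_eq_norm_sq_to_K, Complex.ofReal_pow]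
      rfl
    have e2 : ⟪y, T x⟫_ℂ = (r : ℂ) * ((‖T x‖ ^ 2 : ℝ) : ℂ) := by
      rw [hy, inner_smul_left, Complex.conj_ofReal, inner_self_eq_norm_sq_to_K, Complex.ofReal_pow]
      rfl
    simp only [map_add, map_sub, inner_add_left, inner_add_right, inner_sub_left, inner_sub_right,
      e1, e2, Complex.add_re, Complex.sub_re, ← Complex.ofReal_mul, Complex.ofReal_re]
    ring
  have h4 := parallelogram_law_with_norm ℂ x y
  rw [hny] at h4
  have h5 : 4 * (r * ‖T x‖ ^ 2) ≤ δ * (4 * ‖x‖ ^ 2) := by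
    have : δ * ‖x + y‖ ^ 2 + δ * ‖x - y‖ ^ 2 = δ * (4 * ‖x‖ ^ 2) := by
      rw [← mul_add]
      congr 1
      linarith
    linarith
  have h6 : r * ‖T x‖ ^ 2 = ‖x‖ * ‖T x‖ := by
    rw [hr]; field_simp
  rw [h6] at h5
  have h7 : ‖x‖ * ‖T x‖ ≤ ‖x‖ * (δ * ‖x‖) := by nlinarith
  exact le_of_mul_le_mul_left h7 hx'

namespace IsSpectralMeasure

theorem apply_apply (hE : IsSpectralMeasure A E) {B B' : Set ℝ} (hB : MeasurableSet B)
    (hB' : MeasurableSet B') (ψ : 𝓗) : E B (E B' ψ) = E (B ∩ B') ψ := by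
  rw [hE.inter B B' hB hB']; rfl

theorem inner_left (hE : IsSpectralMeasure A E) {B : Set ℝ} (hB : MeasurableSet B) (x y : 𝓗) :
    ⟪E B x, y⟫_ℂ = ⟪x, E B y⟫_ℂ := by
  have h : star (E B) = E B := (hE.proj B hB).isSelfAdjoint
  conv_lhs => rw [← h]
  exact ContinuousLinearMap.adjoint_inner_left (E B) y x

theorem apply_self (hE : IsSpectralMeasure A E) {B : Set ℝ} (hB : MeasurableSet B) (ψ : 𝓗) :
    E B (E B ψ) = E B ψ := by
  rw [hE.apply_apply hB hB, inter_self]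

theorem empty (hE : IsSpectralMeasure A E) (ψ : 𝓗) : E ∅ ψ = 0 := by
  obtain ⟨m, hm, -⟩ := hE.integral ψ
  have := hm ∅ MeasurableSet.empty
  rw [measure_empty, eq_comm, ENNReal.ofReal_eq_zero] at this
  exact norm_eq_zero.1 (pow_eq_zero_iff (two_ne_zero) |>.1 (le_antisymm this (sq_nonneg _)))

theorem norm_sq_add (hE : IsSpectralMeasure A E) {B : Set ℝ} (hB : MeasurableSet B) (ψ : 𝓗) :
    ‖E B ψ‖ ^ 2 + ‖E Bᶜ ψ‖ ^ 2 = ‖ψ‖ ^ 2 := by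
  obtain ⟨m, hm, -⟩ := hE.integral ψ
  have h := measure_add_measure_compl (μ := m) hB
  rw [hm _ hB, hm _ hB.compl, hm _ MeasurableSet.univ, hE.univ, ← ENNReal.ofReal_add (by positivity)
    (by positivity), ENNReal.ofReal_eq_ofReal_iff (by positivity) (by positivity)] at h
  exact h

theorem norm_apply_le (hE : IsSpectralMeasure A E) {B : Set ℝ} (hB : MeasurableSet B) (ψ : 𝓗) :
    ‖E B ψ‖ ≤ ‖ψ‖ := by
  have := hE.norm_sq_add hB ψ
  refine le_of_sq_le_sq ?_ (norm_nonneg _)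
  nlinarith [sq_nonneg ‖E Bᶜ ψ‖]

/-- Additivity of E itself is not among the axioms, only that of the scalar measures. The defect ψ -
E(B)ψ - E(Bᶜ)ψ is annihilated by E(B) and by E(Bᶜ), and `norm_sq_add` then makes it zero. -/
theorem add_compl (hE : IsSpectralMeasure A E) {B : Set ℝ} (hB : MeasurableSet B) (ψ : 𝓗) :
    E B ψ + E Bᶜ ψ = ψ := by
  have h := hE.norm_sq_add hB (ψ - (E B ψ + E Bᶜ ψ))
  have h1 : E B (ψ - (E B ψ + E Bᶜ ψ)) = 0 := by
    rw [map_sub, map_add, hE.apply_self hB, hE.apply_apply hB hB.compl, inter_compl_self, hE.empty]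
    simp
  have h2 : E Bᶜ (ψ - (E B ψ + E Bᶜ ψ)) = 0 := by
    rw [map_sub, map_add, hE.apply_self hB.compl, hE.apply_apply hB.compl hB, compl_inter_self,
      hE.empty]
    simp
  rw [h1, h2, norm_zero] at h
  have h3 : ψ - (E B ψ + E Bᶜ ψ) = 0 := by
    rw [← norm_eq_zero, ← pow_eq_zero_iff two_ne_zero, ← h]; norm_num
  exact (sub_eq_zero.1 h3).symm

theorem mem_domain (hE : IsSpectralMeasure A E) {B : Set ℝ} (hB : MeasurableSet B) {ψ : 𝓗}
    (h : ψ ∈ A.domain) : E B ψ ∈ A.domain := by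
  obtain ⟨m, hm, hd, -⟩ := hE.integral ψ
  obtain ⟨m', hm', hd', -⟩ := hE.integral (E B ψ)
  rw [hd'] 
  rw [hd] at h
  refine lt_of_le_of_lt (lintegral_mono' (Measure.le_iff.2 fun s hs => ?_) le_rfl) h
  rw [hm _ hs, hm' _ hs]
  refine ENNReal.ofReal_le_ofReal (pow_le_pow_left₀ (norm_nonneg _) ?_ 2)
  rw [hE.apply_apply hs hB, inter_comm, ← hE.apply_apply hB hs]
  exact hE.norm_apply_le hB _

/-- The axioms describe A through its quadratic form, as the first moment of the scalar measure of a
vector, and that measure is determined by the norms ‖E(B)x‖. -/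
theorem form_eq_of_measure_eq (hE : IsSpectralMeasure A E) (x y : A.domain)
    (h : ∀ B, MeasurableSet B → ‖E B x‖ = ‖E B y‖) :
    ⟪(x : 𝓗), A x⟫_ℂ = ⟪(y : 𝓗), A y⟫_ℂ := by
  obtain ⟨m, hm, -, hi⟩ := hE.integral x
  obtain ⟨m', hm', -, hi'⟩ := hE.integral y
  have : m = m' := Measure.ext fun s hs => by rw [hm s hs, hm' s hs, h s hs]
  have h1 := hi x.2
  have h2 := hi' y.2
  rw [← this] at h2
  exact h1.trans h2.symm

/-- For x and y in complementary spectral subspaces, the scalar measure of x + cy does not depend on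
the phase c, hence neither does the quadratic form. Comparing c = 1 with -1 and c = i with -i
isolates ⟨x, Ay⟩, which must vanish. -/
theorem inner_eq_zero (hE : IsSpectralMeasure A E) {B : Set ℝ} (hB : MeasurableSet B)
    (x y : A.domain) (hx : E B x = x) (hy : E Bᶜ y = y) : ⟪(x : 𝓗), A y⟫_ℂ = 0 := by
  have horth : ∀ s, MeasurableSet s → ⟪E s x, E s y⟫_ℂ = 0 := by
    intro s hs
    rw [← hx, ← hy, hE.apply_apply hs hB, inter_comm, ← hE.apply_apply hB hs, hE.inner_left hB,
      hE.apply_apply hs hB.compl, hE.apply_apply hB (hs.inter hB.compl),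
      inter_comm s, ← inter_assoc, inter_compl_self, empty_inter, hE.empty, inner_zero_right]
  have hnorm : ∀ (c : ℂ), ‖c‖ = 1 → ∀ s, MeasurableSet s →
      ‖E s ((x + c • y : A.domain) : 𝓗)‖ ^ 2 = ‖E s x‖ ^ 2 + ‖E s y‖ ^ 2 := by
    intro c hc s hs
    have h1 : E s ((x + c • y : A.domain) : 𝓗) = E s x + c • E s y := by
      rw [Submodule.coe_add, Submodule.coe_smul, map_add, map_smul]
    rw [h1, sq, norm_add_sq_eq_norm_sq_add_norm_sq_of_inner_eq_zero (𝕜 := ℂ), norm_smul, hc, one_mul,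
      sq, sq]
    rw [inner_smul_right, horth s hs, mul_zero]
  have key : ∀ c c' : ℂ, ‖c‖ = 1 → ‖c'‖ = 1 →
      ⟪((x + c • y : A.domain) : 𝓗), A (x + c • y)⟫_ℂ
        = ⟪((x + c' • y : A.domain) : 𝓗), A (x + c' • y)⟫_ℂ := by
    intro c c' hc hc'
    refine hE.form_eq_of_measure_eq _ _ fun s hs => ?_
    rw [← sq_eq_sq₀ (norm_nonneg _) (norm_nonneg _), hnorm c hc s hs, hnorm c' hc' s hs]
  have hexp : ∀ c : ℂ, ‖c‖ = 1 → ⟪((x + c • y : A.domain) : 𝓗), A (x + c • y)⟫_ℂ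
      = ⟪(x : 𝓗), A x⟫_ℂ + ⟪(y : 𝓗), A y⟫_ℂ + (c * ⟪(x : 𝓗), A y⟫_ℂ
        + starRingEnd ℂ c * ⟪(y : 𝓗), A x⟫_ℂ) := by
    intro c hc
    have hcc : starRingEnd ℂ c * c = 1 := by
      rw [mul_comm, Complex.mul_conj, Complex.normSq_eq_norm_sq, hc]; norm_num
    rw [Submodule.coe_add, Submodule.coe_smul, A.map_add, A.map_smul]
    simp only [inner_add_left, inner_add_right, inner_smul_left, inner_smul_right]
    linear_combination hcc * ⟪(y : 𝓗), A y⟫_ℂ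
  have k1 := key 1 (-1) (by simp) (by simp)
  have k2 := key Complex.I (-Complex.I) (by simp) (by simp)
  rw [hexp _ (by simp), hexp _ (by simp)] at k1 k2
  simp only [map_one, map_neg, Complex.conj_I] at k1 k2
  linear_combination (1/4) * k1 + (-Complex.I/4) * k2
    + (⟪(x : 𝓗), A y⟫_ℂ - ⟪(y : 𝓗), A x⟫_ℂ) / 2 * (Complex.I_sq)

/-- By `inner_eq_zero`, A maps the part of its domain in each spectral subspace into that subspace,
so splitting x along B and Bᶜ shows that E(B) commutes with A. -/
theorem apply_map (hE : IsSpectralMeasure A E) (hA : IsSelfAdjoint A) {B : Set ℝ}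
    (hB : MeasurableSet B) (x : A.domain) :
    A ⟨E B x, hE.mem_domain hB x.2⟩ = E B (A x) := by
  have h0 : ∀ {B : Set ℝ} (hB : MeasurableSet B) (x : A.domain),
      E Bᶜ (A ⟨E B x, hE.mem_domain hB x.2⟩) = 0 := by
    intro B hB x
    refine hA.dense_domain.eq_zero_of_inner_right (𝕜 := ℂ) fun χ hχ => ?_
    rw [← hE.inner_left hB.compl]
    have := hE.inner_eq_zero hB.compl ⟨E Bᶜ χ, hE.mem_domain hB.compl hχ⟩
      ⟨E B x, hE.mem_domain hB x.2⟩ (hE.apply_self hB.compl _)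
      (by rw [compl_compl]; exact hE.apply_self hB _)
    exact this
  have h1 : x = ⟨E B x, hE.mem_domain hB x.2⟩ + ⟨E Bᶜ x, hE.mem_domain hB.compl x.2⟩ :=
    Subtype.ext (hE.add_compl hB x).symm
  have h2 := h0 hB x
  have h3 := h0 hB.compl x
  rw [compl_compl] at h3
  conv_rhs => rw [h1, A.map_add, map_add, h3, add_zero]
  have h4 := hE.add_compl hB (A ⟨E B x, hE.mem_domain hB x.2⟩)
  rw [h2, add_zero] at h4
  exact h4.symm

theorem mem_domain_of_bounded (hE : IsSpectralMeasure A E) {J : Set ℝ} (hJ : MeasurableSet J)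
    {a δ : ℝ} (hJa : ∀ x ∈ J, |x - a| ≤ δ) (ψ : 𝓗) : E J ψ ∈ A.domain ∧
      ∀ h : E J ψ ∈ A.domain,
        |(⟪E J ψ, A ⟨E J ψ, h⟩ - (a : ℂ) • E J ψ⟫_ℂ).re| ≤ δ * ‖E J ψ‖ ^ 2 := by
  obtain ⟨m, hm, hd, hi⟩ := hE.integral (E J ψ)
  have hfin : IsFiniteMeasure m := ⟨by rw [hm _ MeasurableSet.univ]; exact ENNReal.ofReal_lt_top⟩
  have hsupp : ∀ᵐ x ∂m, x ∈ J := by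
    rw [ae_iff]
    change m Jᶜ = 0
    rw [hm _ hJ.compl, hE.apply_apply hJ.compl hJ, compl_inter_self, hE.empty]
    simp
  have hab : ∀ᵐ x ∂m, |x - a| ≤ δ := hsupp.mono fun x hx => hJa x hx
  refine ⟨?_, fun h => ?_⟩
  · rw [hd]
    have hle : ∀ᵐ x ∂m, ENNReal.ofReal (x ^ 2) ≤ ENNReal.ofReal ((|a| + δ) ^ 2) := by
      filter_upwards [hab] with x hx
      refine ENNReal.ofReal_le_ofReal ?_
      rw [← sq_abs x]
      refine pow_le_pow_left₀ (abs_nonneg _) ?_ 2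
      calc |x| = |a + (x - a)| := by ring_nf
        _ ≤ |a| + |x - a| := abs_add_le _ _
        _ ≤ |a| + δ := by gcongr
    refine lt_of_le_of_lt (lintegral_mono_ae hle) ?_
    rw [lintegral_const]
    exact ENNReal.mul_lt_top ENNReal.ofReal_lt_top (measure_lt_top _ _)
  · have hint : Integrable (fun x : ℝ => x) m := by
      refine Integrable.of_bound measurable_id.aestronglyMeasurable (|a| + δ) ?_
      filter_upwards [hab] with x hx
      calc ‖x‖ = |a + (x - a)| := by rw [Real.norm_eq_abs]; ring_nf
        _ ≤ |a| + |x - a| := abs_add_le _ _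
        _ ≤ |a| + δ := by gcongr
    have hreal : m.real Set.univ = ‖E J ψ‖ ^ 2 := by
      rw [measureReal_def, hm _ MeasurableSet.univ, hE.univ, ENNReal.toReal_ofReal (by positivity)]
      rfl
    have h1 : (⟪E J ψ, A ⟨E J ψ, h⟩ - (a : ℂ) • E J ψ⟫_ℂ).re = ∫ x, (x - a) ∂m := by
      rw [inner_sub_right, hi h, inner_smul_right, inner_self_eq_norm_sq_to_K,
        integral_sub hint (integrable_const a), integral_const, hreal]
      simp only [Complex.coe_algebraMap, Complex.sub_re, Complex.ofReal_re]
      norm_cast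
      rw [smul_eq_mul, mul_comm]
    rw [h1, ← hreal, ← Real.norm_eq_abs]
    have hab' : ∀ᵐ x ∂m, ‖x - a‖ ≤ δ := hab
    exact norm_integral_le_of_norm_le_const hab'

/-- (A - a)E(J) is everywhere defined and symmetric, and its quadratic form is bounded by δ because
the scalar measure of E(J)ψ lives on J; a symmetric form bound is an operator bound. -/
theorem norm_sub_le (hE : IsSpectralMeasure A E) (hA : IsSelfAdjoint A) {J : Set ℝ}
    (hJ : MeasurableSet J) {a δ : ℝ} (hJa : ∀ x ∈ J, |x - a| ≤ δ) (hδ : 0 ≤ δ) (ψ : 𝓗)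
    (h : E J ψ ∈ A.domain) :
    ‖A ⟨E J ψ, h⟩ - (a : ℂ) • E J ψ‖ ≤ δ * ‖E J ψ‖ := by
  have hdom : ∀ ψ, E J ψ ∈ A.domain := fun ψ => (hE.mem_domain_of_bounded hJ hJa ψ).1
  let T : 𝓗 →ₗ[ℂ] 𝓗 := (A.toFun - (a : ℂ) • A.domain.subtype) ∘ₗ
    ((E J : 𝓗 →ₗ[ℂ] 𝓗).codRestrict A.domain hdom)
  have hT : ∀ ψ, T ψ = A ⟨E J ψ, hdom ψ⟩ - (a : ℂ) • E J ψ := fun ψ => rfl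
  have hTE : ∀ ψ, E J (T ψ) = T ψ := by
    intro ψ
    have h1 := hE.apply_map hA hJ ⟨E J ψ, hdom ψ⟩
    have h2 : (⟨E J ((⟨E J ψ, hdom ψ⟩ : A.domain) : 𝓗), hE.mem_domain hJ (hdom ψ)⟩ : A.domain)
      = ⟨E J ψ, hdom ψ⟩ := Subtype.ext (hE.apply_self hJ ψ)
    rw [h2] at h1
    rw [hT, map_sub, map_smul, ← h1, hE.apply_self hJ]
  have hTi : ∀ x y, ⟪T x, y⟫_ℂ = ⟪A ⟨E J x, hdom x⟩ - (a : ℂ) • E J x, E J y⟫_ℂ := by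
    intro x y
    rw [← hTE x, hE.inner_left hJ, hT]
  have hTi' : ∀ x y, ⟪x, T y⟫_ℂ = ⟪E J x, A ⟨E J y, hdom y⟩ - (a : ℂ) • E J y⟫_ℂ := by
    intro x y
    rw [← hTE y, ← hE.inner_left hJ, hT]
  have hsym : ∀ x y, ⟪T x, y⟫_ℂ = ⟪x, T y⟫_ℂ := by
    intro x y
    rw [hTi, hTi', inner_sub_left, inner_sub_right, inner_smul_left, inner_smul_right,
      Complex.conj_ofReal, inner_map_selfAdjoint hA ⟨E J x, hdom x⟩ ⟨E J y, hdom y⟩]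
  have hform : ∀ x, |(⟪x, T x⟫_ℂ).re| ≤ δ * ‖x‖ ^ 2 := by
    intro x
    rw [hTi']
    refine ((hE.mem_domain_of_bounded hJ hJa x).2 (hdom x)).trans ?_
    have := hE.norm_apply_le hJ x
    gcongr
  have := norm_le_of_form_bound hsym hform (E J ψ)
  have h2 : T (E J ψ) = A ⟨E J ψ, h⟩ - (a : ℂ) • E J ψ := by
    rw [hT]
    have h2 : (⟨E J (E J ψ), hdom _⟩ : A.domain) = ⟨E J ψ, h⟩ := Subtype.ext (hE.apply_self hJ ψ)
    rw [h2, hE.apply_self hJ]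
  rwa [h2] at this

theorem commute_resolvent (hE : IsSpectralMeasure A E) (hA : IsSelfAdjoint A) {B : Set ℝ}
    (hB : MeasurableSet B) {z : ℂ} (hz : z ∈ resolventSet A) : Commute (E B) (resolvent A z) := by
  rw [commute_iff_eq]
  ext ψ
  change E B (resolvent A z ψ) = resolvent A z (E B ψ)
  obtain ⟨h1, h2⟩ := (isResolventAt_resolvent hz).1 ψ
  have h3 := (isResolventAt_resolvent hz).2 ⟨E B (resolvent A z ψ), hE.mem_domain hB h1⟩
  have h4 := hE.apply_map hA hB ⟨resolvent A z ψ, h1⟩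
  simp only [] at h3 h4
  rw [h4, ← map_smul, ← map_sub, h2] at h3
  exact h3.symm

/-- On a short interval around a ∈ J the vector E(J')ψ is almost an eigenvector at a, while the
resolvent at a gives ‖E(J')ψ‖ ≤ ‖R‖δ‖E(J')ψ‖. The choice of δ makes the factor at most 1/2, so the
scalar measure is locally null on J, hence null. -/
theorem apply_eq_zero_of_subset (hE : IsSpectralMeasure A E) (hA : IsSelfAdjoint A) {J : Set ℝ}
    (hJ : MeasurableSet J) (h : ∀ a ∈ J, (a : ℂ) ∈ resolventSet A) (ψ : 𝓗) : E J ψ = 0 := by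
  obtain ⟨m, hm, -⟩ := hE.integral ψ
  have h0 : m J = 0 := by
    refine measure_null_of_locally_null J fun a ha => ?_
    set R := resolvent A a
    set δ : ℝ := (2 * (‖R‖ + 1))⁻¹ with hδ
    have hδ0 : 0 < δ := by positivity
    set J' := J ∩ Icc (a - δ) (a + δ)
    have hJ' : MeasurableSet J' := hJ.inter measurableSet_Icc
    have hJa : ∀ x ∈ J', |x - a| ≤ δ := fun x hx => by
      rw [abs_le]; constructor <;> linarith [hx.2.1, hx.2.2]
    refine ⟨J', inter_mem_nhdsWithin _ (Icc_mem_nhds (by linarith) (by linarith)), ?_⟩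
    rw [hm _ hJ']
    have hd := (hE.mem_domain_of_bounded hJ' hJa ψ).1
    have h1 := hE.norm_sub_le hA hJ' hJa hδ0.le ψ hd
    have h2 := (isResolventAt_resolvent (h a ha)).2 ⟨E J' ψ, hd⟩
    have h3 : ‖E J' ψ‖ ≤ ‖R‖ * (δ * ‖E J' ψ‖) := by
      calc ‖E J' ψ‖ = ‖R (A ⟨E J' ψ, hd⟩ - (a : ℂ) • E J' ψ)‖ := by rw [h2]
        _ ≤ ‖R‖ * (δ * ‖E J' ψ‖) := (R.le_opNorm _).trans (by gcongr)
    have h4 : ‖R‖ * δ ≤ 1 / 2 := by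
      rw [hδ, ← div_eq_mul_inv, div_le_div_iff₀ (by positivity) (by norm_num)]
      nlinarith [norm_nonneg R]
    have h5 : ‖E J' ψ‖ = 0 := by
      nlinarith [norm_nonneg (E J' ψ)]
    rw [h5]; simp
  rw [hm _ hJ, ENNReal.ofReal_eq_zero] at h0
  exact norm_eq_zero.1 (pow_eq_zero_iff (two_ne_zero) |>.1 (le_antisymm h0 (sq_nonneg _)))

/-- On the spectral subspace of a short interval, the Riesz integral is close to the winding
number around a point of the spectrum in that interval. -/
theorem norm_rieszIntegral_sub_le (hE : IsSpectralMeasure A E) (hA : IsSelfAdjoint A) {μ : ℝ}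
    {C : ℝ → ℂ} (hC : IsContour A μ C) {L : ℝ≥0} (hL : LipschitzOnWith L C (Icc 0 1)) {M : ℝ}
    (hM0 : 0 < M) (hM : ∀ t ∈ Icc (0 : ℝ) 1, ‖resolvent A (C t)‖ ≤ M) {J : Set ℝ}
    (hJ : MeasurableSet J) {a δ : ℝ} (hδ : 0 ≤ δ) (hδM : δ ≤ (2 * M)⁻¹)
    (hJa : ∀ x ∈ J, |x - a| ≤ δ) (ψ : 𝓗) :
    ‖rieszIntegral A C (E J ψ) - winding C a • E J ψ‖ ≤ (L * (2 * M * M)) * δ * ‖E J ψ‖ := by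
  by_cases h0 : E J ψ = 0
  · simp [h0]
  have hd := (hE.mem_domain_of_bounded hJ hJa ψ).1
  have hA1 := hE.norm_sub_le hA hJ hJa hδ ψ hd
  set φ := E J ψ with hφ
  have hφ0 : 0 < ‖φ‖ := norm_pos_iff.2 h0
  have hr : ∀ t ∈ Icc (0 : ℝ) 1,
      resolvent A (C t) (A ⟨φ, hd⟩ - (a : ℂ) • φ) = φ - (a - C t) • resolvent A (C t) φ := by
    intro t ht
    have h2 := (isResolventAt_resolvent (hC.mem_resolventSet t ht)).2 ⟨φ, hd⟩
    have h3 : A ⟨φ, hd⟩ - (a : ℂ) • φ = (A ⟨φ, hd⟩ - C t • φ) - (a - C t) • φ := by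
      rw [sub_smul]; abel
    rw [h3, map_sub, h2, map_smul]
  have hb : ∀ t ∈ Icc (0 : ℝ) 1,
      ‖resolvent A (C t) (A ⟨φ, hd⟩ - (a : ℂ) • φ)‖ ≤ M * (δ * ‖φ‖) := fun t ht =>
    ((resolvent A (C t)).le_opNorm _).trans
      (mul_le_mul (hM t ht) hA1 (norm_nonneg _) hM0.le)
  -- The resolvent formula `hr` gives 1 ≤ Mδ + |a - C t|M as φ ≠ 0. Since Mδ ≤ 1/2, the point a
  -- keeps the distance 1/(2M) from the contour.
  have hdist : ∀ t ∈ Icc (0 : ℝ) 1, (2 * M)⁻¹ ≤ ‖(a : ℂ) - C t‖ := by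
    intro t ht
    have h1 : ‖φ‖ ≤ M * (δ * ‖φ‖) + ‖(a : ℂ) - C t‖ * (M * ‖φ‖) := by
      calc ‖φ‖ = ‖resolvent A (C t) (A ⟨φ, hd⟩ - (a : ℂ) • φ)
            + ((a : ℂ) - C t) • resolvent A (C t) φ‖ := by rw [hr t ht, sub_add_cancel]
        _ ≤ _ := by
            refine (norm_add_le _ _).trans (add_le_add (hb t ht) ?_)
            rw [norm_smul]
            gcongr
            exact ((resolvent A (C t)).le_opNorm _).trans (by gcongr; exact hM t ht)
    have h2 : 1 ≤ M * δ + ‖(a : ℂ) - C t‖ * M := by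
      refine le_of_mul_le_mul_right ?_ hφ0
      linarith
    have h3 : M * δ ≤ 1 / 2 := by
      calc M * δ ≤ M * (2 * M)⁻¹ := by gcongr
        _ = 1 / 2 := by field_simp
    rw [inv_le_iff_one_le_mul₀ (by positivity)]
    linarith
  have hne : ∀ t ∈ Icc (0 : ℝ) 1, (a : ℂ) - C t ≠ 0 := by
    intro t ht h
    have := hdist t ht
    rw [h, norm_zero] at this
    have h2 : 0 < (2 * M)⁻¹ := by positivity
    linarith
  have hCc := hL.continuousOn
  have hi1 : IntervalIntegrable (fun t => deriv C t • resolvent A (C t) φ) volume 0 1 :=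
    intervalIntegrable_deriv_smul hL (hC.continuousOn_resolvent.clm_apply continuousOn_const)
  have hi2 : IntervalIntegrable (fun t => deriv C t • (((a : ℂ) - C t)⁻¹ • φ)) volume 0 1 :=
    intervalIntegrable_deriv_smul hL
      (((continuousOn_const.sub hCc).inv₀ hne).smul continuousOn_const)
  have e1 : rieszIntegral A C φ
      = (Complex.I / (2 * Real.pi)) • ∫ t in (0 : ℝ)..1, deriv C t • resolvent A (C t) φ := by
    rw [rieszIntegral]
    change (Complex.I / (2 * Real.pi)) • ((∫ t in (0 : ℝ)..1, deriv C t • resolvent A (C t)) φ) = _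
    rw [ContinuousLinearMap.intervalIntegral_apply
      (intervalIntegrable_deriv_smul hL hC.continuousOn_resolvent)]
    rfl
  -- The sign convention (A - z)⁻¹ accounts for the prefactor: (a - z)⁻¹ = -(z - a)⁻¹ and -i/(2π) =
  -- 1/(2πi).
  have e2 : winding C a • φ = (Complex.I / (2 * Real.pi)) • ∫ t in (0 : ℝ)..1,
      deriv C t • (((a : ℂ) - C t)⁻¹ • φ) := by
    have h1 : ∀ t, deriv C t • (((a : ℂ) - C t)⁻¹ • φ) = (-(deriv C t * (C t - a)⁻¹)) • φ := by
      intro t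
      rw [smul_smul, ← neg_sub (C t) (a : ℂ), inv_neg, mul_neg]
    simp only [h1]
    rw [intervalIntegral.integral_smul_const, smul_smul, intervalIntegral.integral_neg, winding]
    congr 1
    have hpi : (Real.pi : ℂ) ≠ 0 := by exact_mod_cast Real.pi_ne_zero
    field_simp
    rw [Complex.I_sq]; ring
  rw [e1, e2, ← smul_sub, ← intervalIntegral.integral_sub hi1 hi2, norm_smul]
  -- The constant is L from C', 2M from (a - C t)⁻¹, and Mδ from the resolvent applied to (A - a)φ.
  -- The endpoint t = 1 is discarded because the bound on C' needs an interior point.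
  have hI : ‖∫ t in (0 : ℝ)..1, (deriv C t • resolvent A (C t) φ
      - deriv C t • (((a : ℂ) - C t)⁻¹ • φ))‖ ≤ (L * (2 * M * M)) * δ * ‖φ‖ * |(1 : ℝ) - 0| := by
    refine intervalIntegral.norm_integral_le_of_norm_le_const_ae ?_
    have h1 : ∀ᵐ t : ℝ, t ≠ 1 := by simp [ae_iff]
    filter_upwards [h1] with t ht1 ht
    rw [uIoc_of_le zero_le_one] at ht
    have htI : t ∈ Icc (0 : ℝ) 1 := ⟨ht.1.le, ht.2⟩
    have hdC : ‖deriv C t‖ ≤ L :=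
      norm_deriv_le_of_lipschitzOn (Icc_mem_nhds ht.1 (lt_of_le_of_ne ht.2 ht1)) hL
    have h2 : resolvent A (C t) φ - ((a : ℂ) - C t)⁻¹ • φ
        = -(((a : ℂ) - C t)⁻¹ • resolvent A (C t) (A ⟨φ, hd⟩ - (a : ℂ) • φ)) := by
      rw [hr t htI, smul_sub, smul_smul, inv_mul_cancel₀ (hne t htI), one_smul]; abel
    rw [← smul_sub, h2, norm_smul, norm_neg, norm_smul, norm_inv]
    have h3 : ‖(a : ℂ) - C t‖⁻¹ ≤ 2 * M := by
      rw [inv_le_comm₀ (norm_pos_iff.2 (hne t htI)) (by positivity)]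
      exact hdist t htI
    calc ‖deriv C t‖ * (‖(a : ℂ) - C t‖⁻¹ * ‖resolvent A (C t) (A ⟨φ, hd⟩ - (a : ℂ) • φ)‖)
        ≤ L * ((2 * M) * (M * (δ * ‖φ‖))) := by
          gcongr
          exact hb t htI
      _ = _ := by ring
  have hc : ‖Complex.I / (2 * (Real.pi : ℂ))‖ ≤ 1 := by
    rw [norm_div, Complex.norm_I, norm_mul, Complex.norm_real, Complex.norm_two,
      Real.norm_of_nonneg Real.pi_pos.le, div_le_one (by positivity)]
    linarith [Real.pi_gt_three]
  rw [sub_zero, abs_one, mul_one] at hI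
  calc _ ≤ 1 * ((L * (2 * M * M)) * δ * ‖φ‖) :=
        mul_le_mul hc hI (norm_nonneg _) zero_le_one
    _ = _ := one_mul _

/-- Cut ℝ into half-open intervals of length δ starting from μ, so that each lies on one side of μ.
An interval without spectrum has E(J) = 0. On any other, the Riesz integral differs by O(δ) from the
winding number around a spectral point, which is 1 or 0 exactly as E((-∞, μ)) is the identity or
zero there. The pieces are orthogonal, so the errors combine to O(δ)‖ψ‖, and δ → 0. -/
theorem eq_rieszIntegral (hE : IsSpectralMeasure A E) (hA : IsSelfAdjoint A) {μ : ℝ}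
    (hμ : (μ : ℂ) ∈ resolventSet A) {C : ℝ → ℂ} (hC : IsContour A μ C) :
    E (Iio μ) = rieszIntegral A C := by
  obtain ⟨L, hL⟩ := hC.lipschitz
  obtain ⟨M₀, hM₀⟩ := isCompact_Icc.exists_bound_of_continuousOn hC.continuousOn_resolvent
  set M : ℝ := max M₀ 1
  have hM0 : 0 < M := lt_of_lt_of_le one_pos (le_max_right _ _)
  have hM : ∀ t ∈ Icc (0 : ℝ) 1, ‖resolvent A (C t)‖ ≤ M := fun t ht =>
    (hM₀ t ht).trans (le_max_left _ _)
  set D := rieszIntegral A C - E (Iio μ) with hD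
  have hcomm : ∀ {B : Set ℝ}, MeasurableSet B → Commute (E B) D := by
    intro B hB
    refine (commute_rieszIntegral hC fun z hz => hE.commute_resolvent hA hB hz).sub_right ?_
    rw [commute_iff_eq, ← hE.inter _ _ hB measurableSet_Iio, ← hE.inter _ _ measurableSet_Iio hB,
      inter_comm]
  set κ : ℝ := L * (2 * M * M) with hκ
  have hκ0 : 0 ≤ κ := by positivity
  have hloc : ∀ δ : ℝ, 0 < δ → δ ≤ (2 * M)⁻¹ → ∀ (n : ℤ) (ψ : 𝓗),
      ‖D (E (Ico (μ + n • δ) (μ + (n + 1) • δ)) ψ)‖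
        ≤ κ * δ * ‖E (Ico (μ + n • δ) (μ + (n + 1) • δ)) ψ‖ := by
    intro δ hδ hδM n ψ
    set J := Ico (μ + n • δ) (μ + (n + 1) • δ) with hJdef
    have hJ : MeasurableSet J := measurableSet_Ico
    by_cases hex : ∀ a ∈ J, (a : ℂ) ∈ resolventSet A
    · rw [hE.apply_eq_zero_of_subset hA hJ hex ψ]; simp
    push Not at hex
    obtain ⟨a, haJ, ha⟩ := hex
    have hJa : ∀ x ∈ J, |x - a| ≤ δ := by
      intro x hx
      have h1 := hx.1
      have h2 := hx.2
      have h3 := haJ.1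
      have h4 := haJ.2
      simp only [add_smul, one_smul] at h2 h4
      rw [abs_le]
      constructor <;> linarith
    have key := hE.norm_rieszIntegral_sub_le hA hC hL hM0 hM hJ hδ.le hδM hJa ψ
    have hw : winding C a • E J ψ = E (Iio μ) (E J ψ) := by
      rw [hE.apply_apply measurableSet_Iio hJ]
      rcases lt_or_ge n 0 with hn | hn
      · have hle : (((n + 1 : ℤ)) : ℝ) * δ ≤ 0 := by
          have : ((n + 1 : ℤ) : ℝ) ≤ 0 := by exact_mod_cast hn
          exact mul_nonpos_of_nonpos_of_nonneg this hδ.le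
        have hsub : ∀ x ∈ J, x < μ := by
          intro x hx
          have := hx.2
          rw [zsmul_eq_mul] at this
          linarith
        rw [inter_eq_right.2 (show J ⊆ Iio μ from hsub), hC.inside a ha (by simpa using hsub a haJ), one_smul]
      · have hge : 0 ≤ (n : ℝ) * δ := by
          have : (0 : ℝ) ≤ n := by exact_mod_cast hn
          positivity
        have hsub : ∀ x ∈ J, μ ≤ x := by
          intro x hx
          have := hx.1
          rw [zsmul_eq_mul] at this
          linarith
        have hem : Iio μ ∩ J = ∅ := by
          ext x
          simp only [mem_inter_iff, mem_Iio, mem_empty_iff_false, iff_false, not_and]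
          intro h1 h2
          exact absurd (hsub x h2) (not_le.2 h1)
        -- The first interval on the right contains μ itself; the gap condition rules out μ as the
        -- spectral point, so `outside` applies.
        have hne : a ≠ μ := by
          rintro rfl
          exact ha hμ
        have hlt : μ < a := lt_of_le_of_ne (hsub a haJ) hne.symm
        rw [hem, hE.empty, hC.outside a ha (by simpa using hlt), zero_smul]
    rw [hw] at key
    exact key
  have hglob : ∀ δ : ℝ, 0 < δ → δ ≤ (2 * M)⁻¹ → ∀ ψ : 𝓗, ‖D ψ‖ ≤ κ * δ * ‖ψ‖ := by
    intro δ hδ hδM ψ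
    obtain ⟨m, hm, -⟩ := hE.integral ψ
    obtain ⟨m', hm', -⟩ := hE.integral (D ψ)
    have hun : (⋃ n : ℤ, Ico (μ + n • δ) (μ + (n + 1) • δ)) = Set.univ := iUnion_Ico_add_zsmul hδ μ
    have hdis := pairwise_disjoint_Ico_add_zsmul μ δ
    -- D commutes with every E(J), so the scalar measure of Dψ is bounded by (κδ)² times that of ψ
    -- on each interval; countable additivity sums the pieces.
    have h1 : m' Set.univ ≤ ENNReal.ofReal ((κ * δ) ^ 2) * m Set.univ := by
      rw [← hun, measure_iUnion hdis fun _ => measurableSet_Ico,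
        measure_iUnion hdis fun _ => measurableSet_Ico, ← ENNReal.tsum_mul_left]
      refine ENNReal.tsum_le_tsum fun n => ?_
      rw [hm _ measurableSet_Ico, hm' _ measurableSet_Ico, ← ENNReal.ofReal_mul (by positivity),
        ← mul_pow]
      refine ENNReal.ofReal_le_ofReal (pow_le_pow_left₀ (norm_nonneg _) ?_ 2)
      have hc := (hcomm (measurableSet_Ico (a := μ + n • δ) (b := μ + (n + 1) • δ))).eq
      have hc' : E (Ico (μ + n • δ) (μ + (n + 1) • δ)) (D ψ)
          = D (E (Ico (μ + n • δ) (μ + (n + 1) • δ)) ψ) := congrArg (fun T => T ψ) hc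
      rw [hc']
      exact hloc δ hδ hδM n ψ
    rw [hm _ MeasurableSet.univ, hm' _ MeasurableSet.univ, hE.univ,
      ← ENNReal.ofReal_mul (by positivity), ← mul_pow,
      ENNReal.ofReal_le_ofReal_iff (by positivity)] at h1
    exact le_of_sq_le_sq h1 (by positivity)
  have hzero : ∀ ψ, D ψ = 0 := by
    intro ψ
    have htend : Tendsto (fun δ : ℝ => κ * δ * ‖ψ‖) (𝓝[>] 0) (𝓝 0) := by
      have : Continuous fun δ : ℝ => κ * δ * ‖ψ‖ := by fun_prop
      simpa using (this.tendsto 0).mono_left nhdsWithin_le_nhds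
    have hev : ∀ᶠ δ in 𝓝[>] (0 : ℝ), ‖D ψ‖ ≤ κ * δ * ‖ψ‖ := by
      have : Ioc (0 : ℝ) (2 * M)⁻¹ ∈ 𝓝[>] (0 : ℝ) := Ioc_mem_nhdsGT (by positivity)
      filter_upwards [this] with δ hδ
      exact hglob δ hδ.1 hδ.2 ψ
    exact norm_le_zero_iff.1 (ge_of_tendsto htend hev)
  have : D = 0 := ContinuousLinearMap.ext hzero
  exact (sub_eq_zero.1 this).symm

end IsSpectralMeasure

theorem IsSpectralProjection.eq_rieszIntegral {μ : ℝ} {P : 𝓗 →L[ℂ] 𝓗}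
    (hP : IsSpectralProjection A (Iio μ) P) (hA : IsSelfAdjoint A)
    (hμ : (μ : ℂ) ∈ resolventSet A) {C : ℝ → ℂ} (hC : IsContour A μ C) :
    P = rieszIntegral A C := by
  obtain ⟨E, hE, rfl⟩ := hP
  exact hE.eq_rieszIntegral hA hμ hC

theorem IsSpectralProjection.isStarProjection {B : Set ℝ} (hB : MeasurableSet B) {P : 𝓗 →L[ℂ] 𝓗}
    (hP : IsSpectralProjection A B P) : IsStarProjection P := by
  obtain ⟨E, hE, rfl⟩ := hP
  exact hE.proj _ hB

end Spectral

/-! ### Calculus in Banach spaces -/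

section Calculus

/-- Taylor's formula of first order in a real parameter, uniformly on compact sets. -/
theorem exists_taylor_bound {E V : Type*} [NormedAddCommGroup E] [NormedSpace ℝ E]
    [NormedAddCommGroup V] [NormedSpace ℝ V] {F : ℝ × E → V} (hF : ContDiff ℝ ∞ F) {K : Set E}
    (hK : IsCompact K) : ∃ B : ℝ, 0 ≤ B ∧ ∀ ε ∈ Icc (0 : ℝ) 1, ∀ k ∈ K,
      ‖F (ε, k) - F (0, k) - ε • fderiv ℝ F (0, k) (1, 0)‖ ≤ B * ε ^ 2 := by
  set G : ℝ × E → V := fun p => fderiv ℝ F p (1, 0) with hG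
  have hGs : ContDiff ℝ ∞ G := (hF.fderiv_right (m := ∞) (by simp)).clm_apply contDiff_const
  set H : ℝ × E → V := fun p => fderiv ℝ G p (1, 0) with hH
  have hHs : ContDiff ℝ ∞ H := (hGs.fderiv_right (m := ∞) (by simp)).clm_apply contDiff_const
  obtain ⟨B₀, hB₀⟩ := (isCompact_Icc (a := (0 : ℝ)) (b := 1)).prod hK
    |>.exists_bound_of_continuousOn hHs.continuous.continuousOn
  have hder : ∀ {F : ℝ × E → V}, ContDiff ℝ ∞ F → ∀ (k : E) (t : ℝ),
      HasDerivAt (fun t => F (t, k)) (fderiv ℝ F (t, k) (1, 0)) t := by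
    intro F hF k t
    have h1 : HasFDerivAt F (fderiv ℝ F (t, k)) (t, k) :=
      (hF.differentiable (by simp) _).hasFDerivAt
    have h2 : HasDerivAt (fun t : ℝ => (t, k)) (1, 0) t :=
      (hasDerivAt_id t).prodMk (hasDerivAt_const t k)
    exact h1.comp_hasDerivAt t h2
  refine ⟨max B₀ 0, le_max_right _ _, fun ε hε k hk => ?_⟩
  set B := max B₀ 0
  have hB : ∀ t ∈ Icc (0 : ℝ) 1, ‖H (t, k)‖ ≤ B := fun t ht =>
    (hB₀ (t, k) ⟨ht, hk⟩).trans (le_max_left _ _)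
  have hsub : ∀ t ∈ Icc (0 : ℝ) ε, t ∈ Icc (0 : ℝ) 1 := fun t ht => ⟨ht.1, ht.2.trans hε.2⟩
  -- The mean value inequality is applied twice, first to the derivative G and then to F minus its
  -- linear part. This loses the factor 1/2 of Taylor's formula, which is immaterial.
  have h1 : ∀ t ∈ Icc (0 : ℝ) ε, ‖G (t, k) - G (0, k)‖ ≤ B * (t - 0) :=
    norm_image_sub_le_of_norm_deriv_le_segment' (f := fun t => G (t, k))
      (fun t _ => (hder hGs k t).hasDerivWithinAt)
      (fun t ht => hB t (hsub t (Ico_subset_Icc_self ht)))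
  have h2 : ∀ t ∈ Icc (0 : ℝ) ε, ‖(F (t, k) - t • G (0, k)) - (F (0, k) - (0 : ℝ) • G (0, k))‖
      ≤ (B * ε) * (t - 0) := by
    refine norm_image_sub_le_of_norm_deriv_le_segment' (f := fun t => F (t, k) - t • G (0, k))
      (f' := fun t => G (t, k) - G (0, k)) (fun t _ => ?_) (fun t ht => ?_)
    · have := (hder hF k t).sub ((hasDerivAt_id t).smul_const (G (0, k)))
      simp only [one_smul, id] at this
      exact this.hasDerivWithinAt
    · refine (h1 t (Ico_subset_Icc_self ht)).trans ?_
      rw [sub_zero]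
      exact mul_le_mul_of_nonneg_left ht.2.le (le_max_right _ _)
  have h3 := h2 ε ⟨hε.1, le_rfl⟩
  rw [zero_smul, sub_zero, sub_zero] at h3
  calc _ = ‖F (ε, k) - ε • G (0, k) - F (0, k)‖ := by congr 1; abel
    _ ≤ B * ε * ε := h3
    _ = B * ε ^ 2 := by ring

/-- Only the dependence on k is differentiated, since C is merely Lipschitz in t. Each derivative is
again a contour integral of the same kind, with values in 𝓛(E, V); this is why the induction on n
quantifies over V. Compactness of a ball times [0,1] supplies the dominating constants. -/
theorem contDiff_contourIntegral_nat {E : Type} [NormedAddCommGroup E] [NormedSpace ℝ E]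
    [ProperSpace E] {L : ℝ≥0} {C : ℝ → ℂ} (hC : LipschitzOnWith L C (Icc 0 1)) (n : ℕ) :
    ∀ {V : Type} [NormedAddCommGroup V] [NormedSpace ℂ V] [NormedSpace ℝ V] [IsScalarTower ℝ ℂ V]
      {G : E × ℂ → V}, (∀ k, ∀ t ∈ Icc (0 : ℝ) 1, ContDiffAt ℝ ∞ G (k, C t)) →
      ContDiff ℝ n fun k => ∫ t in (0 : ℝ)..1, deriv C t • G (k, C t) := by
  have hCc := hC.continuousOn
  have hcont : ∀ {V : Type} [NormedAddCommGroup V] [NormedSpace ℝ V] {G : E × ℂ → V},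
      (∀ k, ∀ t ∈ Icc (0 : ℝ) 1, ContDiffAt ℝ ∞ G (k, C t)) →
      ContinuousOn (fun p : E × ℝ => G (p.1, C p.2)) (univ ×ˢ Icc 0 1) := by
    intro V _ _ G hG p hp
    have h1 : ContinuousWithinAt (fun p : E × ℝ => (p.1, C p.2)) (univ ×ˢ Icc 0 1) p := by
      refine ContinuousWithinAt.prodMk continuousWithinAt_fst ?_
      exact (hCc p.2 hp.2).comp continuousWithinAt_snd fun q hq => hq.2
    exact ContinuousAt.comp_continuousWithinAt (f := fun p : E × ℝ => (p.1, C p.2))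
      (hG p.1 p.2 hp.2).continuousAt h1
  have hbd : ∀ {V : Type} [NormedAddCommGroup V] [NormedSpace ℝ V] {G : E × ℂ → V},
      (∀ k, ∀ t ∈ Icc (0 : ℝ) 1, ContDiffAt ℝ ∞ G (k, C t)) → ∀ k₀ : E, ∃ B : ℝ,
      ∀ k ∈ Metric.ball k₀ 1, ∀ t ∈ Icc (0 : ℝ) 1, ‖G (k, C t)‖ ≤ B := by
    intro V _ _ G hG k₀
    obtain ⟨B, hB⟩ := ((isCompact_closedBall k₀ 1).prod (isCompact_Icc (a := (0 : ℝ)) (b := 1))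
      ).exists_bound_of_continuousOn ((hcont hG).mono (prod_mono (subset_univ _) subset_rfl))
    exact ⟨B, fun k hk t ht => hB (k, t) ⟨Metric.ball_subset_closedBall hk, ht⟩⟩
  have hsec : ∀ {V : Type} [NormedAddCommGroup V] [NormedSpace ℝ V] {G : E × ℂ → V},
      (∀ k, ∀ t ∈ Icc (0 : ℝ) 1, ContDiffAt ℝ ∞ G (k, C t)) → ∀ k : E,
      ContinuousOn (fun t => G (k, C t)) (Icc 0 1) := by
    intro V _ _ G hG k
    exact (hcont hG).comp (f := fun t => (k, t)) (by fun_prop) fun t ht => ⟨trivial, ht⟩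
  have hae : ∀ᵐ t : ℝ, t ≠ 1 := by simp [ae_iff]
  have hdC : ∀ t ∈ Ioc (0 : ℝ) 1, t ≠ 1 → ‖deriv C t‖ ≤ L := fun t ht h1 =>
    norm_deriv_le_of_lipschitzOn (Icc_mem_nhds ht.1 (lt_of_le_of_ne ht.2 h1)) hC
  induction n with
  | zero =>
    intro V _ _ _ _ G hG
    refine contDiff_zero.2 (continuous_iff_continuousAt.2 fun k₀ => ?_)
    obtain ⟨B, hB⟩ := hbd hG k₀
    refine intervalIntegral.continuousAt_of_dominated_interval (bound := fun _ => L * B) ?_ ?_ ?_ ?_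
    · refine Eventually.of_forall fun k => ?_
      exact (intervalIntegrable_deriv_smul hC (hsec hG k)).1.aestronglyMeasurable.mono_measure
        (by rw [uIoc_of_le zero_le_one])
    · filter_upwards [Metric.ball_mem_nhds k₀ one_pos] with k hk
      filter_upwards [hae] with t ht1 ht
      rw [uIoc_of_le zero_le_one] at ht
      rw [norm_smul]
      exact mul_le_mul (hdC t ht ht1) (hB k hk t ⟨ht.1.le, ht.2⟩) (norm_nonneg _) L.2
    · exact intervalIntegrable_const
    · refine Eventually.of_forall fun t ht => ?_
      rw [uIoc_of_le zero_le_one] at ht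
      have h1 : ContinuousAt (fun k : E => (k, C t)) k₀ := by fun_prop
      have h2 : ContinuousAt (fun k : E => G (k, C t)) k₀ :=
        ContinuousAt.comp (f := fun k : E => (k, C t)) (g := G)
          (hG k₀ t ⟨ht.1.le, ht.2⟩).continuousAt h1
      exact continuousAt_const.smul h2
  | succ n ih =>
    intro V _ _ _ _ G hG
    set G' : E × ℂ → E →L[ℝ] V := fun p =>
      (fderiv ℝ G p).comp (ContinuousLinearMap.inl ℝ E ℂ) with hG'
    have hG's : ∀ k, ∀ t ∈ Icc (0 : ℝ) 1, ContDiffAt ℝ ∞ G' (k, C t) := fun k t ht =>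
      ((hG k t ht).fderiv_right (m := ∞) (by simp)).clm_comp contDiffAt_const
    rw [Nat.cast_succ, contDiff_succ_iff_hasFDerivAt]
    refine ⟨_, ih hG's, fun k₀ => ?_⟩
    obtain ⟨B, hB⟩ := hbd hG's k₀
    refine intervalIntegral.hasFDerivAt_integral_of_dominated_of_fderiv_le
      (F := fun k t => deriv C t • G (k, C t)) (F' := fun k t => deriv C t • G' (k, C t))
      (bound := fun _ => L * B) (Metric.ball_mem_nhds k₀ one_pos) ?_ ?_ ?_ ?_ ?_ ?_
    · refine Eventually.of_forall fun k => ?_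
      exact (intervalIntegrable_deriv_smul hC (hsec hG k)).1.aestronglyMeasurable.mono_measure
        (by rw [uIoc_of_le zero_le_one])
    · exact intervalIntegrable_deriv_smul hC (hsec hG k₀)
    · exact (intervalIntegrable_deriv_smul hC (hsec hG's k₀)).1.aestronglyMeasurable.mono_measure
        (by rw [uIoc_of_le zero_le_one])
    · filter_upwards [hae] with t ht1 ht k hk
      rw [uIoc_of_le zero_le_one] at ht
      rw [norm_smul]
      exact mul_le_mul (hdC t ht ht1) (hB k hk t ⟨ht.1.le, ht.2⟩) (norm_nonneg _) L.2
    · exact intervalIntegrable_const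
    · refine Eventually.of_forall fun t ht k _ => ?_
      rw [uIoc_of_le zero_le_one] at ht
      have h1 : HasFDerivAt (fun k : E => (k, C t)) (ContinuousLinearMap.inl ℝ E ℂ) k :=
        hasFDerivAt_prodMk_left k (C t)
      have h2 : HasFDerivAt G (fderiv ℝ G (k, C t)) (k, C t) :=
        ((hG k t ⟨ht.1.le, ht.2⟩).differentiableAt (by simp)).hasFDerivAt
      exact (HasFDerivAt.comp (f := fun k : E => (k, C t)) k h2 h1).const_smul (deriv C t)

theorem contDiff_contourIntegral {E : Type} [NormedAddCommGroup E] [NormedSpace ℝ E]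
    [ProperSpace E] {L : ℝ≥0} {C : ℝ → ℂ} (hC : LipschitzOnWith L C (Icc 0 1))
    {V : Type} [NormedAddCommGroup V] [NormedSpace ℂ V] {G : E × ℂ → V}
    (hG : ∀ k, ∀ t ∈ Icc (0 : ℝ) 1, ContDiffAt ℝ ∞ G (k, C t)) :
    ContDiff ℝ ∞ fun k => ∫ t in (0 : ℝ)..1, deriv C t • G (k, C t) :=
  contDiff_infty.2 fun n => contDiff_contourIntegral_nat hC n hG

theorem contDiff_exp {𝔸 : Type*} [NormedRing 𝔸] [NormedAlgebra ℂ 𝔸] [CompleteSpace 𝔸] :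
    ContDiff ℝ ∞ (NormedSpace.exp : 𝔸 → 𝔸) := by
  have h : AnalyticOnNhd ℂ (NormedSpace.exp : 𝔸 → 𝔸) univ := fun x _ =>
    NormedSpace.exp_analytic (𝕂 := ℂ) x
  exact (contDiffOn_univ.1 (h.contDiffOn uniqueDiffOn_univ)).restrict_scalars ℝ

/-- The intertwining holds term by term in the power series. It is used with i the inclusion of 𝓓_f,
to lift exponentials to 𝓓_f, and with i = ϱ(κ), to make exponentials of equivariant families
equivariant. -/
theorem comp_exp_of_intertwine {V W : Type*} [NormedAddCommGroup V] [NormedSpace ℂ V]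
    [CompleteSpace V] [NormedAddCommGroup W] [NormedSpace ℂ W] [CompleteSpace W] (i : V →L[ℂ] W)
    {x : V →L[ℂ] V} {y : W →L[ℂ] W} (h : i ∘L x = y ∘L i) :
    i ∘L NormedSpace.exp x = NormedSpace.exp y ∘L i := by
  have hp : ∀ n : ℕ, i ∘L (x ^ n) = (y ^ n) ∘L i := by
    intro n
    induction n with
    | zero => ext v; rfl
    | succ n ih =>
      rw [pow_succ, pow_succ]
      ext v
      have h1 := congrArg (fun T => T v) h
      have h2 := congrArg (fun T => T (x v)) ih
      simp only [ContinuousLinearMap.comp_apply] at h1 h2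
      change i ((x ^ n) (x v)) = (y ^ n) (y (i v))
      rw [h2, h1]
  have h1 := (NormedSpace.exp_series_hasSum_exp' (𝕂 := ℂ) x).mapL
    (ContinuousLinearMap.compL ℂ V V W i)
  have h2 := (NormedSpace.exp_series_hasSum_exp' (𝕂 := ℂ) y).mapL
    ((ContinuousLinearMap.compL ℂ V W W).flip i)
  refine h1.unique ?_
  have h3 : (fun n : ℕ => (ContinuousLinearMap.compL ℂ V V W) i ((n.factorial : ℂ)⁻¹ • x ^ n))
      = fun n : ℕ => (ContinuousLinearMap.compL ℂ V W W).flip i ((n.factorial : ℂ)⁻¹ • y ^ n) := by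
    funext n
    simp only [map_smul, ContinuousLinearMap.compL_apply, ContinuousLinearMap.flip_apply, hp]
  rw [h3]
  exact h2

end Calculus

namespace Crystal

variable {d N : ℕ} (c : Crystal d N)

/-! ### The Brillouin zone -/

theorem two_pi_pos : (0 : ℝ) < 2 * Real.pi := by positivity

/-- The coordinates `⟪k, a_i⟫ / 2π`. -/
def coordₗ : Space d →ₗ[ℝ] (Fin d → ℝ) :=
  LinearMap.pi fun i => ((2 * Real.pi)⁻¹ : ℝ) • (innerSL ℝ (c.a i) : Space d →ₗ[ℝ] ℝ)

theorem coordₗ_apply (k : Space d) (i : Fin d) :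
    c.coordₗ k i = (2 * Real.pi)⁻¹ * ⟪k, c.a i⟫_ℝ := by
  rw [real_inner_comm]; rfl

theorem coordₗ_injective : Function.Injective c.coordₗ := by
  rw [injective_iff_map_eq_zero]
  intro k hk
  refine InnerProductSpace.ext_inner_right_basis c.a fun i => ?_
  have := congrFun hk i
  rw [coordₗ_apply, Pi.zero_apply, mul_eq_zero] at this
  rw [inner_zero_left]
  exact this.resolve_left (inv_ne_zero two_pi_pos.ne')

/-- The coordinates `⟪k, a_i⟫ / 2π` as a linear equivalence. -/
def coord : Space d ≃L[ℝ] (Fin d → ℝ) :=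
  (LinearEquiv.ofInjectiveOfFinrankEq c.coordₗ c.coordₗ_injective (by simp)).toContinuousLinearEquiv

theorem coord_apply (k : Space d) (i : Fin d) : c.coord k i = (2 * Real.pi)⁻¹ * ⟪k, c.a i⟫_ℝ :=
  c.coordₗ_apply k i

theorem inner_eq_coord (k : Space d) (i : Fin d) : ⟪k, c.a i⟫_ℝ = 2 * Real.pi * c.coord k i := by
  rw [coord_apply, mul_inv_cancel_left₀ two_pi_pos.ne']

/-- The basis of the reciprocal lattice dual to `a`. -/
def dualBasis : Module.Basis (Fin d) ℝ (Space d) := Module.Basis.ofEquivFun c.coord.toLinearEquiv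

theorem dualBasis_repr (k : Space d) (i : Fin d) : c.dualBasis.repr k i = c.coord k i := rfl

theorem brillouin_eq : c.brillouin = ZSpan.fundamentalDomain c.dualBasis := by
  ext k
  rw [ZSpan.mem_fundamentalDomain]
  refine forall_congr' fun i => ?_
  rw [dualBasis_repr, inner_eq_coord, mem_Ico, mem_Ico]
  have := two_pi_pos
  refine and_congr ?_ ?_
  · exact mul_nonneg_iff_of_pos_left this
  · exact mul_lt_iff_lt_one_right this

theorem exists_int_repr (γ : c.lattice) (i : Fin d) : ∃ n : ℤ, c.a.repr (γ : Space d) i = n := by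
  obtain ⟨n, hn⟩ := (c.a.mem_span_iff_repr_mem ℤ (γ : Space d)).1 γ.2 i
  exact ⟨n, hn.symm⟩

/-- The integer coordinates of a lattice vector. -/
def intCoord (γ : c.lattice) (i : Fin d) : ℤ := (c.exists_int_repr γ i).choose

theorem intCoord_spec (γ : c.lattice) (i : Fin d) :
    c.a.repr (γ : Space d) i = c.intCoord γ i := (c.exists_int_repr γ i).choose_spec

theorem inner_lattice (k : Space d) (γ : c.lattice) :
    ⟪k, (γ : Space d)⟫_ℝ = 2 * Real.pi * ∑ i, c.intCoord γ i * c.coord k i := by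
  conv_lhs => rw [← c.a.sum_repr (γ : Space d), inner_sum]
  rw [Finset.mul_sum]
  refine Finset.sum_congr rfl fun i _ => ?_
  rw [inner_smul_right, inner_eq_coord, intCoord_spec]
  ring

theorem intCoord_injective : Function.Injective c.intCoord := by
  intro γ γ' h
  apply Subtype.ext
  refine c.a.repr.injective (Finsupp.ext fun i => ?_)
  rw [intCoord_spec, intCoord_spec, h]

theorem intCoord_surjective : Function.Surjective c.intCoord := by
  intro n
  have hmem : ∑ i, n i • c.a i ∈ c.lattice :=
    Submodule.sum_mem _ fun i _ => Submodule.smul_mem _ _ (Submodule.subset_span ⟨i, rfl⟩)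
  refine ⟨⟨_, hmem⟩, funext fun i => ?_⟩
  have h1 := c.intCoord_spec ⟨_, hmem⟩ i
  have h2 : c.a.repr (∑ i, n i • c.a i) i = n i := by
    have : ∑ i, n i • c.a i = ∑ i, (n i : ℝ) • c.a i :=
      Finset.sum_congr rfl fun i _ => (Int.cast_smul_eq_zsmul ℝ (n i) (c.a i)).symm
    rw [this, c.a.repr_sum_self]
  exact_mod_cast h1.symm.trans h2

theorem dualLattice_eq :
    c.dualLattice = (Submodule.span ℤ (Set.range c.dualBasis) : Set (Space d)) := by
  ext κ
  rw [SetLike.mem_coe, c.dualBasis.mem_span_iff_repr_mem ℤ]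
  constructor
  · intro h i
    obtain ⟨n, hn⟩ := h (c.a i) (Submodule.subset_span ⟨i, rfl⟩)
    refine ⟨n, ?_⟩
    rw [inner_eq_coord] at hn
    exact (mul_left_cancel₀ two_pi_pos.ne' hn).symm
  · intro h γ hγ
    choose n hn using h
    refine ⟨∑ i, c.intCoord ⟨γ, hγ⟩ i * n i, ?_⟩
    have := c.inner_lattice κ ⟨γ, hγ⟩
    rw [this]
    congr 1
    push_cast
    refine Finset.sum_congr rfl fun i _ => ?_
    have h2 := hn i
    rw [dualBasis_repr] at h2
    rw [← h2]
    rfl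

theorem measurableSet_brillouin : MeasurableSet c.brillouin := by
  rw [brillouin_eq]; exact ZSpan.fundamentalDomain_measurableSet _

theorem isBounded_brillouin : Bornology.IsBounded c.brillouin := by
  rw [brillouin_eq]; exact ZSpan.fundamentalDomain_isBounded _

theorem isCompact_closure_brillouin : IsCompact (closure c.brillouin) :=
  c.isBounded_brillouin.isCompact_closure

theorem volume_brillouin_ne_zero : volume c.brillouin ≠ 0 := by
  rw [brillouin_eq]; exact ZSpan.measure_fundamentalDomain_ne_zero _

theorem volume_brillouin_ne_top : volume c.brillouin ≠ ⊤ :=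
  c.isBounded_brillouin.measure_lt_top.ne

/-- The normalized measure on the Brillouin zone. -/
def β : Measure (Space d) := (volume c.brillouin)⁻¹ • volume.restrict c.brillouin

instance : IsProbabilityMeasure c.β := by
  refine ⟨?_⟩
  rw [β, Measure.smul_apply, Measure.restrict_apply_univ, smul_eq_mul,
    ENNReal.inv_mul_cancel c.volume_brillouin_ne_zero c.volume_brillouin_ne_top]

theorem ae_β_iff {p : Space d → Prop} :
    (∀ᵐ k ∂c.β, p k) ↔ ∀ᵐ k ∂(volume.restrict c.brillouin), p k :=
  Measure.ae_ennreal_smul_measure_iff (ENNReal.inv_ne_zero.2 c.volume_brillouin_ne_top)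

theorem eLpNorm_β {V : Type*} [NormedAddCommGroup V] (f : Space d → V) :
    eLpNorm f 2 c.β = (volume c.brillouin)⁻¹ ^ (1 / (2 : ℝ)) *
      eLpNorm f 2 (volume.restrict c.brillouin) := by
  rw [β, eLpNorm_smul_measure_of_ne_top (by simp), smul_eq_mul]
  simp

theorem memLp_β_iff {V : Type*} [NormedAddCommGroup V] {f : Space d → V} :
    MemLp f 2 c.β ↔ MemLp f 2 (volume.restrict c.brillouin) := by
  constructor
  · intro h
    have h1 : volume.restrict c.brillouin = (volume c.brillouin) • c.β := by
      rw [β, smul_smul, ENNReal.mul_inv_cancel c.volume_brillouin_ne_zero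
        c.volume_brillouin_ne_top, one_smul]
    rw [h1]
    exact h.smul_measure c.volume_brillouin_ne_top
  · intro h
    exact h.smul_measure (ENNReal.inv_ne_top.2 c.volume_brillouin_ne_zero)

/-! ### Fourier series on the Brillouin zone -/

section Torus

/-- The torus carries the normalized Haar measure. -/
local instance haarMeasureSpace : MeasureSpace UnitAddCircle := ⟨AddCircle.haarAddCircle⟩

local instance haarIsProbabilityMeasure : IsProbabilityMeasure (volume : Measure UnitAddCircle) :=
  inferInstanceAs (IsProbabilityMeasure AddCircle.haarAddCircle)

local instance haarIsAddHaarMeasure : Measure.IsAddHaarMeasure (volume : Measure UnitAddCircle) :=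
  inferInstanceAs (Measure.IsAddHaarMeasure AddCircle.haarAddCircle)

/-- The projection to the torus. -/
def toTorus (k : Space d) : UnitAddTorus (Fin d) := fun i => (c.coord k i : UnitAddCircle)

/-- The representative in the Brillouin zone. -/
def ofTorus (t : UnitAddTorus (Fin d)) : Space d :=
  c.coord.symm fun i => (AddCircle.equivIco 1 0 (t i) : ℝ)

theorem measurable_toTorus : Measurable c.toTorus :=
  measurable_pi_lambda _ fun i => AddCircle.measurable_mk'.comp
    ((continuous_apply i).comp c.coord.continuous).measurable

theorem measurable_ofTorus : Measurable c.ofTorus :=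
  c.coord.symm.continuous.measurable.comp (measurable_pi_lambda _ fun i =>
    measurable_subtype_coe.comp ((AddCircle.measurableEquivIco 1 0).measurable.comp
      (measurable_pi_apply i)))

theorem ofTorus_toTorus {k : Space d} (hk : k ∈ c.brillouin) : c.ofTorus (c.toTorus k) = k := by
  rw [ofTorus, ContinuousLinearEquiv.symm_apply_eq]
  funext i
  rw [brillouin_eq, ZSpan.mem_fundamentalDomain] at hk
  have h := hk i
  rw [dualBasis_repr] at h
  exact congrArg Subtype.val (AddCircle.equivIco_coe_eq (p := (1 : ℝ)) (a := 0) (by simpa using h))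

/-- A linear isomorphism maps Lebesgue measure to a multiple of Lebesgue measure and 𝔹 to the unit
cube, so the image measure is a multiple of Haar measure. Both are probability measures, which fixes
the multiple without computing a determinant. -/
theorem map_toTorus_β : Measure.map c.toTorus c.β = volume := by
  -- up to normalization
  obtain ⟨r, hr⟩ : ∃ r : ℝ≥0∞, Measure.map c.toTorus c.β = r • volume := by
    obtain ⟨a, ha⟩ : ∃ a : ℝ≥0∞, Measure.map c.coord (volume : Measure (Space d)) = a • volume := by
      refine ⟨Measure.addHaarScalarFactor (Measure.map c.coord (volume : Measure (Space d))) volume,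
        ?_⟩
      conv_lhs => rw [Measure.isAddLeftInvariant_eq_smul
        (Measure.map c.coord (volume : Measure (Space d))) volume]
      rfl
    have hpre : c.brillouin = c.coord ⁻¹' (univ.pi fun _ => Ico (0 : ℝ) 1) := by
      rw [brillouin_eq]
      ext k
      simp [ZSpan.mem_fundamentalDomain, dualBasis_repr]
    have h2 : Measure.map c.coord (volume.restrict c.brillouin)
        = a • Measure.pi fun _ : Fin d => (volume.restrict (Ico (0 : ℝ) 1)) := by
      rw [hpre, ← Measure.restrict_map c.coord.continuous.measurable
        (MeasurableSet.univ_pi fun _ => measurableSet_Ico), ha, Measure.restrict_smul]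
      congr 1
      exact (Measure.restrict_pi_pi (fun _ : Fin d => (volume : Measure ℝ)) _)
    have h3 : MeasurePreserving (fun (x : Fin d → ℝ) (i : Fin d) => (x i : UnitAddCircle))
        (Measure.pi fun _ : Fin d => (volume.restrict (Ico (0 : ℝ) 1))) volume := by
      refine measurePreserving_pi _ _ fun i => ?_
      rw [Measure.restrict_congr_set Ico_ae_eq_Ioc]
      have := AddCircle.measurePreserving_mk (1 : ℝ) 0
      rwa [zero_add, AddCircle.volume_eq_smul_haarAddCircle, ENNReal.ofReal_one, one_smul] at this
    have h4 : c.toTorus = (fun (x : Fin d → ℝ) (i : Fin d) => (x i : UnitAddCircle)) ∘ c.coord := rfl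
    refine ⟨(volume c.brillouin)⁻¹ * a, ?_⟩
    rw [β, Measure.map_smul, h4, ← Measure.map_map h3.measurable c.coord.continuous.measurable, h2,
      mul_smul, Measure.map_smul, h3.map_eq]
  have h1 : Measure.map c.toTorus c.β univ = 1 := by
    rw [Measure.map_apply c.measurable_toTorus MeasurableSet.univ, preimage_univ, measure_univ]
  rw [hr, Measure.smul_apply, measure_univ, smul_eq_mul, mul_one] at h1
  rw [hr, h1, one_smul]

theorem measurePreserving_toTorus : MeasurePreserving c.toTorus c.β volume :=
  ⟨c.measurable_toTorus, c.map_toTorus_β⟩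

theorem ae_mem_brillouin : ∀ᵐ k ∂c.β, k ∈ c.brillouin :=
  c.ae_β_iff.2 (ae_restrict_mem c.measurableSet_brillouin)

theorem measurePreserving_ofTorus : MeasurePreserving c.ofTorus volume c.β := by
  refine ⟨c.measurable_ofTorus, ?_⟩
  rw [← c.map_toTorus_β, Measure.map_map c.measurable_ofTorus c.measurable_toTorus]
  conv_rhs => rw [← Measure.map_id (μ := c.β)]
  refine Measure.map_congr ?_
  filter_upwards [c.ae_mem_brillouin] with k hk
  exact c.ofTorus_toTorus hk

/-- The plane wave `k ↦ e^{i k·γ}`. -/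
def wave (γ : c.lattice) (k : Space d) : ℂ :=
  Complex.exp ((⟪k, (γ : Space d)⟫_ℝ : ℝ) * Complex.I)

theorem norm_wave (γ : c.lattice) (k : Space d) : ‖c.wave γ k‖ = 1 :=
  Complex.norm_exp_ofReal_mul_I _

theorem continuous_wave (γ : c.lattice) : Continuous (c.wave γ) := by
  unfold wave; fun_prop

theorem wave_add (γ γ' : c.lattice) (k : Space d) :
    c.wave (γ + γ') k = c.wave γ k * c.wave γ' k := by
  rw [wave, wave, wave, ← Complex.exp_add, Submodule.coe_add, inner_add_right]
  push_cast; ring_nf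

theorem conj_wave (γ : c.lattice) (k : Space d) :
    starRingEnd ℂ (c.wave γ k) = c.wave (-γ) k := by
  rw [wave, wave, ← Complex.exp_conj, map_mul, Complex.conj_ofReal, Complex.conj_I,
    Submodule.coe_neg, inner_neg_right]
  push_cast; ring_nf

theorem wave_eq_mFourier (γ : c.lattice) (k : Space d) :
    c.wave γ k = UnitAddTorus.mFourier (c.intCoord γ) (c.toTorus k) := by
  rw [wave, inner_lattice, UnitAddTorus.mFourier]
  simp only [ContinuousMap.coe_mk, toTorus, fourier_coe_apply]
  rw [← Complex.exp_sum]
  congr 1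
  push_cast
  rw [Finset.mul_sum, Finset.sum_mul]
  refine Finset.sum_congr rfl fun i _ => ?_
  ring

theorem integral_wave (γ : c.lattice) (hγ : γ ≠ 0) : ∫ k, c.wave γ k ∂c.β = 0 := by
  simp only [wave_eq_mFourier]
  have h := integral_map (μ := c.β) c.measurable_toTorus.aemeasurable
    (f := fun t => UnitAddTorus.mFourier (c.intCoord γ) t)
    (ContinuousMap.continuous _).aestronglyMeasurable
  rw [c.map_toTorus_β] at h
  rw [← h]
  have h2 := (orthonormal_iff_ite.1 (UnitAddTorus.orthonormal_mFourier (d := Fin d)))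
    (-c.intCoord γ) 0
  simp only [ContinuousMap.inner_toLp, ← UnitAddTorus.mFourier_neg, ← UnitAddTorus.mFourier_add]
    at h2
  have h3 : -c.intCoord γ ≠ 0 := by
    rw [neg_ne_zero]
    intro h0
    apply hγ
    apply c.intCoord_injective
    rw [h0]
    funext i
    have := c.intCoord_spec 0 i
    simp only [Submodule.coe_zero, map_zero, Finsupp.coe_zero, Pi.zero_apply] at this
    exact_mod_cast this
  rw [if_neg h3] at h2
  simpa using h2

-- Completeness of the Fourier basis of the torus, transported along `toTorus` and `ofTorus`, which
-- are mutually inverse up to null sets.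
set_option maxHeartbeats 800000 in
theorem ae_eq_zero_of_fourier {f : Space d → ℂ} (hf : MemLp f 2 c.β)
    (h : ∀ γ : c.lattice, ∫ k, c.wave γ k * f k ∂c.β = 0) : f =ᵐ[c.β] 0 := by
  have hg : MemLp (f ∘ c.ofTorus) 2 volume := hf.comp_measurePreserving c.measurePreserving_ofTorus
  have hfg : ∀ᵐ k ∂c.β, (f ∘ c.ofTorus) (c.toTorus k) = f k := by
    filter_upwards [c.ae_mem_brillouin] with k hk
    rw [Function.comp_apply, c.ofTorus_toTorus hk]
  have hcoeff : ∀ n, UnitAddTorus.mFourierBasis.repr (hg.toLp _) n = 0 := by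
    intro n
    rw [UnitAddTorus.mFourierBasis_repr, UnitAddTorus.mFourierCoeff]
    obtain ⟨γ, hγ⟩ := c.intCoord_surjective (-n)
    rw [← h γ]
    have e1 : ∫ t, UnitAddTorus.mFourier (-n) t • (hg.toLp _) t
        = ∫ t, UnitAddTorus.mFourier (-n) t • (f ∘ c.ofTorus) t := by
      refine integral_congr_ae ?_
      filter_upwards [hg.coeFn_toLp] with t ht
      rw [ht]
    have e2 := integral_map (μ := c.β) c.measurable_toTorus.aemeasurable
      (f := fun t => UnitAddTorus.mFourier (-n) t • (f ∘ c.ofTorus) t)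
      (by
        rw [c.map_toTorus_β]
        exact (UnitAddTorus.mFourier (-n)).continuous.aestronglyMeasurable.smul hg.1)
    rw [c.map_toTorus_β] at e2
    rw [e1, e2]
    refine integral_congr_ae ?_
    filter_upwards [hfg] with k hk
    rw [hk, ← hγ, ← wave_eq_mFourier, smul_eq_mul]
  have h0 : hg.toLp _ = 0 := by
    rw [← map_eq_zero_iff _ (UnitAddTorus.mFourierBasis (d := Fin d)).repr.injective]
    exact lp.ext (funext hcoeff)
  have h1 : f ∘ c.ofTorus =ᵐ[volume] 0 := by
    have := hg.coeFn_toLp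
    rw [h0] at this
    exact this.symm.trans (Lp.coeFn_zero _ _ _)
  have h2 := c.measurePreserving_toTorus.quasiMeasurePreserving.ae h1
  filter_upwards [h2, hfg] with k hk hk'
  rw [← hk', hk]; rfl

end Torus

end Crystal

namespace Crystal

variable {d N : ℕ} (c : Crystal d N)

/-! ### The phases -/

theorem coeFn_phase (k : Space d) (u : c.Hf) : c.phase k u =ᵐ[c.ν.restrict c.cell]
    fun y => Complex.exp ((⟪k, y⟫_ℝ : ℝ) * Complex.I) • u y :=
  coeFn_mulIso (fun y => expIso ⟪k, y⟫_ℝ) (measurable_phase k) u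

theorem phase_add (k k' : Space d) (u : c.Hf) : c.phase (k + k') u = c.phase k (c.phase k' u) := by
  refine Lp.ext ?_
  filter_upwards [c.coeFn_phase (k + k') u, c.coeFn_phase k (c.phase k' u), c.coeFn_phase k' u]
    with y h1 h2 h3
  rw [h1, h2, h3, smul_smul, ← Complex.exp_add, inner_add_left]
  push_cast
  ring_nf

theorem phase_zero (u : c.Hf) : c.phase 0 u = u := by
  refine Lp.ext ?_
  filter_upwards [c.coeFn_phase 0 u] with y h1
  rw [h1, inner_zero_left]
  simp

theorem phase_neg_phase (k : Space d) (u : c.Hf) : c.phase (-k) (c.phase k u) = u := by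
  rw [← phase_add, neg_add_cancel, phase_zero]

theorem phase_phase_neg (k : Space d) (u : c.Hf) : c.phase k (c.phase (-k) u) = u := by
  rw [← phase_add, add_neg_cancel, phase_zero]

theorem inner_phase_left (k : Space d) (u v : c.Hf) :
    ⟪c.phase k u, v⟫_ℂ = ⟪u, c.phase (-k) v⟫_ℂ := by
  rw [← (c.phase k).inner_map_map u, phase_phase_neg]

theorem rho_apply (κ : Space d) (u : c.Hf) : c.rho κ u = c.phase (-κ) u := rfl

theorem rho_rho_neg (κ : Space d) (u : c.Hf) : c.rho κ (c.rho (-κ) u) = u := by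
  rw [rho_apply, rho_apply, neg_neg, phase_neg_phase]

theorem rho_neg_rho (κ : Space d) (u : c.Hf) : c.rho (-κ) (c.rho κ u) = u := by
  rw [rho_apply, rho_apply, neg_neg, phase_phase_neg]

theorem rho_add (κ κ' : Space d) (u : c.Hf) : c.rho (κ + κ') u = c.rho κ (c.rho κ' u) := by
  rw [rho_apply, rho_apply, rho_apply, ← phase_add, neg_add]

theorem neg_mem_dualLattice {κ : Space d} (h : κ ∈ c.dualLattice) : -κ ∈ c.dualLattice := by
  rw [dualLattice_eq, SetLike.mem_coe] at h ⊢
  exact neg_mem h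

/-! ### Translations -/

theorem ae_mem_X : ∀ᵐ x ∂c.ν, x ∈ c.X := by
  rcases c.config with ⟨h, -⟩ | ⟨-, h⟩
  · rw [h]; exact ae_of_all _ fun _ => mem_univ _
  · rw [h]; exact ae_restrict_mem c.measurableSet_X

theorem coeFn_T (γ : c.lattice) (ψ : c.H) :
    c.T γ ψ =ᵐ[c.ν] fun x => c.M γ x (ψ (x - (γ : Space d))) := by
  have h1 := coeFn_mulIso (fun x => (c.M γ x).toLinearIsometry) (c.measurable_M γ)
    (Lp.compMeasurePreservingₗᵢ ℂ _ (c.measurePreserving_sub γ) ψ)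
  have h2 := Lp.coeFn_compMeasurePreserving ψ (c.measurePreserving_sub γ)
  refine EventuallyEq.trans h1 ?_
  filter_upwards [h2] with x hx
  exact congrArg (c.M γ x) hx

theorem M_zero {x : Space d} (hx : x ∈ c.X) : c.M 0 x = 1 := by
  have h := c.cocycle 0 0 x hx
  rw [add_zero, Submodule.coe_zero, sub_zero] at h
  exact (mul_eq_left.1 h.symm)

theorem T_zero (ψ : c.H) : c.T 0 ψ = ψ := by
  refine Lp.ext ?_
  filter_upwards [c.coeFn_T 0 ψ, c.ae_mem_X] with x h1 h2
  rw [h1, c.M_zero h2, Submodule.coe_zero, sub_zero]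
  rfl

theorem T_T (γ γ' : c.lattice) (ψ : c.H) : c.T γ (c.T γ' ψ) = c.T (γ + γ') ψ := by
  refine Lp.ext ?_
  have h := (c.measurePreserving_sub γ).quasiMeasurePreserving.ae (c.coeFn_T γ' ψ)
  filter_upwards [c.coeFn_T γ (c.T γ' ψ), c.coeFn_T (γ + γ') ψ, h, c.ae_mem_X] with x h1 h2 h3 h4
  rw [h1, h2, h3, add_comm γ γ', c.cocycle γ' γ x h4, Submodule.coe_add, sub_sub,
    add_comm (γ : Space d)]
  rfl

/-- The restriction of `T_γ ψ` to the unit cell. -/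
def res (γ : c.lattice) : c.H →L[ℂ] c.Hf :=
  (LpToLpRestrictCLM (Space d) (Spin N) ℂ c.ν 2 c.cell).comp (c.T γ).toContinuousLinearMap

theorem coeFn_res (γ : c.lattice) (ψ : c.H) : c.res γ ψ =ᵐ[c.ν.restrict c.cell] c.T γ ψ :=
  LpToLpRestrictCLM_coeFn ℂ c.cell (c.T γ ψ)

theorem measurableSet_cell : MeasurableSet c.cell := ZSpan.fundamentalDomain_measurableSet c.a

instance vaddInvariantMeasure : VAddInvariantMeasure c.lattice (Space d) c.ν := by
  refine ⟨fun γ s hs => ?_⟩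
  have h := (c.measurePreserving_sub (-γ)).measure_preimage hs.nullMeasurableSet
  rw [← h]
  congr 1
  ext x
  simp only [mem_preimage, Submodule.vadd_def, vadd_eq_add, Submodule.coe_neg, sub_neg_eq_add,
    add_comm]

theorem isAddFundamentalDomain_cell : IsAddFundamentalDomain c.lattice c.cell c.ν :=
  IsAddFundamentalDomain.mk' c.measurableSet_cell.nullMeasurableSet
    fun x => ZSpan.exist_unique_vadd_mem_fundamentalDomain c.a x

theorem enorm_sq_Lp {α F : Type*} [MeasurableSpace α] {m : Measure α} [NormedAddCommGroup F]
    (f : Lp F 2 m) : ‖f‖ₑ ^ 2 = ∫⁻ x, ‖f x‖ₑ ^ 2 ∂m := by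
  have := eLpNorm_nnreal_pow_eq_lintegral (f := f) (μ := m) (p := 2) two_ne_zero
  rw [Lp.enorm_def]
  simpa only [NNReal.coe_ofNat, ENNReal.rpow_ofNat, ENNReal.coe_ofNat] using this

/-- The translates of the cell tile the space and the matrices M(γ, x) are unitary, so the norm of ψ
over the translate of the cell by -γ is the norm of the restriction of T_γψ. -/
theorem tsum_enorm_res (ψ : c.H) : ∑' γ, ‖c.res γ ψ‖ₑ ^ 2 = ‖ψ‖ₑ ^ 2 := by
  rw [enorm_sq_Lp, c.isAddFundamentalDomain_cell.lintegral_eq_tsum']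
  refine tsum_congr fun γ => ?_
  rw [enorm_sq_Lp]
  refine lintegral_congr_ae ?_
  filter_upwards [c.coeFn_res γ ψ, ae_restrict_of_ae (c.coeFn_T γ ψ)] with x h1 h2
  rw [h1, h2, Submodule.vadd_def, vadd_eq_add, Submodule.coe_neg, neg_add_eq_sub]
  congr 1
  rw [← ofReal_norm, ← ofReal_norm, LinearIsometryEquiv.norm_map]

theorem memℓp_of_tsum {ι V : Type*} [NormedAddCommGroup V] {w : ι → V} {r : ℝ} (hr : 0 ≤ r)
    (h : ∑' i, ‖w i‖ₑ ^ 2 = ENNReal.ofReal r ^ 2) :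
    Summable (fun i => ‖w i‖ ^ 2) ∧ ∑' i, ‖w i‖ ^ 2 = r ^ 2 := by
  have h1 : ∀ i, ‖w i‖ₑ ^ 2 = ENNReal.ofReal (‖w i‖ ^ 2) := fun i => by
    rw [← ofReal_norm, ENNReal.ofReal_pow (norm_nonneg _)]
  simp only [h1] at h
  rw [← ENNReal.ofReal_pow hr] at h
  have hs : Summable fun i => ‖w i‖ ^ 2 := by
    have := ENNReal.summable_toReal (h.trans_ne ENNReal.ofReal_ne_top)
    simpa [ENNReal.toReal_ofReal] using this
  refine ⟨hs, ?_⟩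
  rw [← ENNReal.ofReal_tsum_of_nonneg (fun i => by positivity) hs,
    ENNReal.ofReal_eq_ofReal_iff (tsum_nonneg fun i => by positivity) (by positivity)] at h
  exact h

theorem sum_norm_res (ψ : c.H) :
    Summable (fun γ => ‖c.res γ ψ‖ ^ 2) ∧ ∑' γ, ‖c.res γ ψ‖ ^ 2 = ‖ψ‖ ^ 2 :=
  memℓp_of_tsum (norm_nonneg ψ) (by rw [c.tsum_enorm_res, ofReal_norm])

/-- The decomposition of `L²(𝓧)` along the translates of the unit cell. -/
def decomp : c.H →ₗᵢ[ℂ] lp (fun _ : c.lattice => c.Hf) 2 where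
  toFun ψ := ⟨fun γ => c.res γ ψ, by
    refine (memℓp_gen_iff (by norm_num)).2 ?_
    simpa using (c.sum_norm_res ψ).1⟩
  map_add' ψ ψ' := by ext1; funext γ; exact map_add _ _ _
  map_smul' z ψ := by ext1; funext γ; exact map_smul _ _ _
  norm_map' ψ := by
    have h := lp.norm_rpow_eq_tsum (p := 2) (by norm_num) (⟨fun γ => c.res γ ψ, by
      refine (memℓp_gen_iff (by norm_num)).2 ?_
      simpa using (c.sum_norm_res ψ).1⟩ : lp (fun _ : c.lattice => c.Hf) 2)
    simp only [ENNReal.toReal_ofNat, Real.rpow_ofNat] at h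
    exact (sq_eq_sq₀ (norm_nonneg _) (norm_nonneg _)).1 (h.trans (c.sum_norm_res ψ).2)

theorem decomp_apply (ψ : c.H) (γ : c.lattice) : c.decomp ψ γ = c.res γ ψ := rfl

/-- Extension by zero from the unit cell. -/
def extend (u : c.Hf) : c.H :=
  ((memLp_indicator_iff_restrict c.measurableSet_cell).2 (Lp.memLp u)).toLp _

theorem coeFn_extend (u : c.Hf) : c.extend u =ᵐ[c.ν] c.cell.indicator u :=
  ((memLp_indicator_iff_restrict c.measurableSet_cell).2 (Lp.memLp u)).coeFn_toLp

theorem res_zero_extend (u : c.Hf) : c.res 0 (c.extend u) = u := by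
  refine Lp.ext ?_
  have h := c.coeFn_res 0 (c.extend u)
  rw [T_zero] at h
  filter_upwards [h, ae_restrict_of_ae (c.coeFn_extend u), ae_restrict_mem c.measurableSet_cell]
    with y h1 h2 h3
  rw [h1, h2, indicator_of_mem h3]

theorem res_extend_of_ne {γ : c.lattice} (hγ : γ ≠ 0) (u : c.Hf) : c.res γ (c.extend u) = 0 := by
  refine Lp.ext ?_
  have h := (c.measurePreserving_sub γ).quasiMeasurePreserving.ae (c.coeFn_extend u)
  filter_upwards [c.coeFn_res γ (c.extend u), ae_restrict_of_ae (c.coeFn_T γ (c.extend u)),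
    ae_restrict_of_ae h, ae_restrict_mem c.measurableSet_cell,
    Lp.coeFn_zero (Spin N) 2 (c.ν.restrict c.cell)] with y h1 h2 h3 h4 h5
  have h6 : y - (γ : Space d) ∉ c.cell := by
    intro h6
    obtain ⟨g, -, hg⟩ := ZSpan.exist_unique_vadd_mem_fundamentalDomain c.a y
    have e0 : (-γ) +ᵥ y = y - (γ : Space d) := by
      rw [Submodule.vadd_def, vadd_eq_add, Submodule.coe_neg, neg_add_eq_sub]
    have e1 := hg 0 (by simp only [zero_vadd]; exact h4)
    have e2 := hg (-γ) (by simp only [e0]; exact h6)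
    apply hγ
    rw [← neg_eq_zero, e2, e1]
  rw [h1, h2, h3, indicator_of_notMem h6, map_zero, h5]
  rfl

theorem res_T (γ γ' : c.lattice) (ψ : c.H) : c.res γ (c.T γ' ψ) = c.res (γ + γ') ψ := by
  change LpToLpRestrictCLM (Space d) (Spin N) ℂ c.ν 2 c.cell (c.T γ (c.T γ' ψ)) = _
  rw [T_T]; rfl

theorem decomp_T_extend [DecidableEq c.lattice] (γ : c.lattice) (u : c.Hf) :
    c.decomp (c.T (-γ) (c.extend u)) = lp.single 2 γ u := by
  ext1
  funext γ'
  rw [decomp_apply, res_T, lp.single_apply]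
  by_cases h : γ' = γ
  · subst h
    rw [add_neg_cancel, res_zero_extend, Pi.single_eq_same]
  · rw [Pi.single_eq_of_ne h, res_extend_of_ne]
    rwa [← sub_eq_add_neg, sub_ne_zero]

/-- The range of an isometry is closed, and it contains the sequences supported at one point: these
come from extending by zero and translating. -/
theorem decomp_surjective : Function.Surjective c.decomp := by
  classical
  intro w
  have hclosed : IsClosed (Set.range c.decomp) := c.decomp.isometry.isClosedEmbedding.isClosed_range
  have hs := lp.hasSum_single (p := 2) (by norm_num) w
  refine hclosed.mem_of_tendsto hs (Eventually.of_forall fun s => ?_)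
  refine ⟨∑ γ ∈ s, c.T (-γ) (c.extend (w γ)), ?_⟩
  rw [map_sum]
  exact Finset.sum_congr rfl fun γ _ => c.decomp_T_extend γ (w γ)

/-! ### The Bloch–Floquet–Zak transform -/

/-- `L²(𝔹, 𝓗_f)` with respect to the normalized measure. -/
abbrev LB : Type := Lp c.Hf 2 c.β

/-- The function `k ↦ e^{i k·γ} e^{-i k·y} u(y)`. -/
def waveFun (γ : c.lattice) (u : c.Hf) (k : Space d) : c.Hf := c.wave γ k • c.phase (-k) u

theorem continuous_waveFun (γ : c.lattice) (u : c.Hf) : Continuous (c.waveFun γ u) :=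
  (c.continuous_wave γ).smul ((c.continuous_phase u).comp continuous_neg)

theorem norm_waveFun (γ : c.lattice) (u : c.Hf) (k : Space d) : ‖c.waveFun γ u k‖ = ‖u‖ := by
  rw [waveFun, norm_smul, norm_wave, one_mul, LinearIsometry.norm_map]

theorem wave_add_dual (γ : c.lattice) {κ : Space d} (hκ : κ ∈ c.dualLattice) (k : Space d) :
    c.wave γ (k + κ) = c.wave γ k := by
  obtain ⟨n, hn⟩ := hκ γ γ.2
  rw [wave, wave, inner_add_left, hn, Complex.ofReal_add, add_mul, Complex.exp_add]
  have : Complex.exp (((2 * Real.pi * n : ℝ) : ℂ) * Complex.I) = 1 := by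
    rw [Complex.exp_eq_one_iff]
    exact ⟨n, by push_cast; ring⟩
  rw [this, mul_one]

theorem waveFun_add_dual (γ : c.lattice) (u : c.Hf) {κ : Space d} (hκ : κ ∈ c.dualLattice)
    (k : Space d) : c.waveFun γ u (k + κ) = c.rho κ (c.waveFun γ u k) := by
  rw [waveFun, waveFun, c.wave_add_dual γ hκ, map_smul, rho_apply, ← phase_add, neg_add, add_comm]

theorem memLp_waveFun (γ : c.lattice) (u : c.Hf) : MemLp (c.waveFun γ u) 2 c.β :=
  MemLp.of_bound (c.continuous_waveFun γ u).aestronglyMeasurable ‖u‖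
    (ae_of_all _ fun k => (c.norm_waveFun γ u k).le)

/-- The isometry `u ↦ (k ↦ e^{i k·γ} e^{-i k·y} u(y))`. -/
def waveIso (γ : c.lattice) : c.Hf →ₗᵢ[ℂ] c.LB where
  toFun u := (c.memLp_waveFun γ u).toLp _
  map_add' u v := by
    rw [← MemLp.toLp_add]
    refine MemLp.toLp_congr _ _ (ae_of_all _ fun k => ?_)
    simp only [waveFun, Pi.add_apply, map_add, smul_add]
  map_smul' z u := by
    rw [RingHom.id_apply, ← MemLp.toLp_const_smul]
    refine MemLp.toLp_congr _ _ (ae_of_all _ fun k => ?_)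
    simp only [waveFun, Pi.smul_apply, map_smul]
    rw [smul_comm]
  norm_map' u := by
    have h : eLpNorm (c.waveFun γ u) 2 c.β = ‖u‖ₑ := by
      rw [eLpNorm_congr_norm_ae (g := fun _ => u) (ae_of_all _ fun k => c.norm_waveFun γ u k),
        eLpNorm_const _ (by norm_num) (IsProbabilityMeasure.ne_zero c.β), measure_univ,
        ENNReal.one_rpow, mul_one]
    change ‖(c.memLp_waveFun γ u).toLp _‖ = ‖u‖
    rw [Lp.norm_toLp, h, toReal_enorm]

theorem coeFn_waveIso (γ : c.lattice) (u : c.Hf) : c.waveIso γ u =ᵐ[c.β] c.waveFun γ u :=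
  (c.memLp_waveFun γ u).coeFn_toLp

theorem inner_waveIso (γ : c.lattice) (u : c.Hf) (f : c.LB) :
    ⟪c.waveIso γ u, f⟫_ℂ = ∫ k, c.wave (-γ) k * ⟪u, c.phase k (f k)⟫_ℂ ∂c.β := by
  rw [L2.inner_def]
  refine integral_congr_ae ?_
  filter_upwards [c.coeFn_waveIso γ u] with k hk
  rw [hk, waveFun, inner_smul_left, conj_wave, inner_phase_left, neg_neg]

theorem orthogonalFamily_waveIso :
    OrthogonalFamily ℂ (fun _ : c.lattice => c.Hf) fun γ => c.waveIso γ := by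
  intro γ γ' hne u v
  rw [inner_waveIso]
  have h : ∀ᵐ k ∂c.β, c.wave (-γ) k * ⟪u, c.phase k (c.waveIso γ' v k)⟫_ℂ
      = c.wave (γ' - γ) k * ⟪u, v⟫_ℂ := by
    filter_upwards [c.coeFn_waveIso γ' v] with k hk
    rw [hk, waveFun, map_smul, phase_phase_neg, inner_smul_right, ← mul_assoc, ← wave_add,
      neg_add_eq_sub]
  rw [integral_congr_ae h, integral_mul_const, c.integral_wave _ (sub_ne_zero.2 hne.symm), zero_mul]

theorem continuous_phase_prod : Continuous fun p : Space d × c.Hf => c.phase p.1 p.2 := by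
  rw [continuous_iff_continuousAt]
  intro p
  rw [ContinuousAt, tendsto_iff_norm_sub_tendsto_zero]
  have hb : ∀ q : Space d × c.Hf, ‖c.phase q.1 q.2 - c.phase p.1 p.2‖
      ≤ ‖q.2 - p.2‖ + ‖c.phase q.1 p.2 - c.phase p.1 p.2‖ := by
    intro q
    have h : c.phase q.1 q.2 - c.phase p.1 p.2
        = c.phase q.1 (q.2 - p.2) + (c.phase q.1 p.2 - c.phase p.1 p.2) := by
      rw [map_sub]; abel
    rw [h]
    exact (norm_add_le _ _).trans (by rw [LinearIsometry.norm_map])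
  refine squeeze_zero (fun _ => norm_nonneg _) hb ?_
  have h0 : Continuous fun q : Space d × c.Hf => c.phase q.1 p.2 :=
    (c.continuous_phase p.2).comp continuous_fst
  have h1 : Continuous fun q : Space d × c.Hf =>
      ‖q.2 - p.2‖ + ‖c.phase q.1 p.2 - c.phase p.1 p.2‖ :=
    ((continuous_snd.sub continuous_const).norm).add (h0.sub continuous_const).norm
  have h2 := h1.tendsto p
  simpa only [sub_self, norm_zero, add_zero] using h2

theorem aestronglyMeasurable_phase {m : Measure (Space d)} {f : Space d → c.Hf}
    (hf : AEStronglyMeasurable f m) : AEStronglyMeasurable (fun k => c.phase k (f k)) m := by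
  have h1 : AEStronglyMeasurable (fun k : Space d => k) m :=
    measurable_id.aestronglyMeasurable
  have h2 : AEStronglyMeasurable (fun k : Space d => (k, f k)) m := h1.prodMk hf
  have h3 := c.continuous_phase_prod.comp_aestronglyMeasurable h2
  exact h3

/-- After removing the phase, the hypothesis says that for each u all Fourier coefficients of k ↦
⟨u, g(k)⟩ vanish. The exceptional null set depends on u; essential separability of the range of g
gives a common one. -/
theorem eq_zero_of_forall_inner_waveIso (f : c.LB)
    (h : ∀ γ u, ⟪c.waveIso γ u, f⟫_ℂ = 0) : f = 0 := by
  set g : Space d → c.Hf := fun k => c.phase k (f k) with hg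
  have hnorm : ∀ k, ‖g k‖ = ‖f k‖ := fun k => (c.phase k).norm_map _
  have hmeas : AEStronglyMeasurable g c.β :=
    c.aestronglyMeasurable_phase (Lp.aestronglyMeasurable f)
  have hgL : MemLp g 2 c.β := (Lp.memLp f).of_le hmeas (ae_of_all _ fun k => (hnorm k).le)
  obtain ⟨t, ht, hgt⟩ := hmeas.isSeparable_ae_range
  have hg0 : g =ᵐ[c.β] 0 := by
    refine ae_eq_zero_of_forall_dual_of_isSeparable ℂ ht (fun l => ?_) hgt
    set u := (InnerProductSpace.toDual ℂ c.Hf).symm l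
    have hl : ∀ v, l v = ⟪u, v⟫_ℂ := fun v =>
      (InnerProductSpace.toDual_symm_apply (𝕜 := ℂ) (x := v) (y := l)).symm
    have h2 : (fun k => ⟪u, g k⟫_ℂ) =ᵐ[c.β] 0 := by
      refine c.ae_eq_zero_of_fourier ((innerSL ℂ u).comp_memLp' hgL) fun γ => ?_
      have := h (-γ) u
      rw [inner_waveIso, neg_neg] at this
      exact this
    filter_upwards [h2] with k hk
    change l (g k) = 0
    rw [hl]; exact hk
  refine Lp.ext ?_
  filter_upwards [hg0, Lp.coeFn_zero c.Hf 2 c.β] with k hk h0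
  have : ‖f k‖ = 0 := by rw [← hnorm, hk]; simp
  rw [h0, norm_eq_zero.1 this]; rfl

theorem isHilbertSum_waveIso :
    IsHilbertSum ℂ (fun _ : c.lattice => c.Hf) fun γ => c.waveIso γ := by
  refine IsHilbertSum.mk c.orthogonalFamily_waveIso (top_le_iff.2 ?_)
  rw [Submodule.topologicalClosure_eq_top_iff, Submodule.eq_bot_iff]
  intro f hf
  refine c.eq_zero_of_forall_inner_waveIso f fun γ u => ?_
  exact (Submodule.mem_orthogonal _ _).1 hf _
    (Submodule.mem_iSup_of_mem γ (LinearMap.mem_range.2 ⟨u, rfl⟩))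

/-- The Bloch–Floquet–Zak transform as a unitary map. -/
def bfz : c.H ≃ₗᵢ[ℂ] c.LB :=
  (LinearIsometryEquiv.ofSurjective c.decomp c.decomp_surjective).trans
    c.isHilbertSum_waveIso.linearIsometryEquiv.symm

theorem hasSum_bfz (ψ : c.H) : HasSum (fun γ => c.waveIso γ (c.res γ ψ)) (c.bfz ψ) :=
  c.isHilbertSum_waveIso.hasSum_linearIsometryEquiv_symm (c.decomp ψ)

theorem coeFn_sum_waveIso (s : Finset c.lattice) (w : c.lattice → c.Hf) :
    (∑ γ ∈ s, c.waveIso γ (w γ) : c.LB) =ᵐ[c.β] fun k => ∑ γ ∈ s, c.waveFun γ (w γ) k := by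
  classical
  induction s using Finset.induction_on with
  | empty =>
    simp only [Finset.sum_empty]
    exact Lp.coeFn_zero _ _ _
  | insert γ s hγ ih =>
    simp only [Finset.sum_insert hγ]
    filter_upwards [Lp.coeFn_add (c.waveIso γ (w γ)) (∑ γ ∈ s, c.waveIso γ (w γ)), ih,
      c.coeFn_waveIso γ (w γ)] with k h1 h2 h3
    rw [h1, Pi.add_apply, h2, h3]

theorem β_factor_ne_zero : (volume c.brillouin)⁻¹ ^ (1 / (2 : ℝ)) ≠ 0 := by
  rw [Ne, ENNReal.rpow_eq_zero_iff]
  simp [c.volume_brillouin_ne_top]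

theorem β_factor_ne_top : (volume c.brillouin)⁻¹ ^ (1 / (2 : ℝ)) ≠ ⊤ :=
  ENNReal.rpow_ne_top_of_nonneg (by norm_num) (ENNReal.inv_ne_top.2 c.volume_brillouin_ne_zero)

theorem tendsto_eLpNorm_iff {ι V : Type*} [NormedAddCommGroup V] {l : Filter ι}
    {F : ι → Space d → V} :
    Tendsto (fun i => eLpNorm (F i) 2 (volume.restrict c.brillouin)) l (𝓝 0) ↔
      Tendsto (fun i => eLpNorm (F i) 2 c.β) l (𝓝 0) := by
  simp only [eLpNorm_β]
  constructor
  · intro h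
    have := ENNReal.Tendsto.const_mul h (Or.inr c.β_factor_ne_top)
    rwa [mul_zero] at this
  · intro h
    have := ENNReal.Tendsto.const_mul (a := ((volume c.brillouin)⁻¹ ^ (1 / (2 : ℝ)))⁻¹) h
      (Or.inr (ENNReal.inv_ne_top.2 c.β_factor_ne_zero))
    simpa only [mul_zero, ← mul_assoc, ENNReal.inv_mul_cancel c.β_factor_ne_zero c.β_factor_ne_top,
      one_mul] using this

theorem tendsto_bfz (ψ : c.H) : Tendsto (fun s : Finset c.lattice =>
    eLpNorm (fun k => c.bfz ψ k - ∑ γ ∈ s, c.bfzTerm ψ k γ) 2 c.β) atTop (𝓝 0) := by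
  have h : Tendsto (fun s : Finset c.lattice => ‖∑ γ ∈ s, c.waveIso γ (c.res γ ψ) - c.bfz ψ‖)
      atTop (𝓝 0) := tendsto_iff_norm_sub_tendsto_zero.1 (c.hasSum_bfz ψ)
  have h2 := ENNReal.tendsto_ofReal h
  rw [ENNReal.ofReal_zero] at h2
  refine h2.congr fun s => ?_
  rw [norm_sub_rev, ofReal_norm, Lp.enorm_def]
  refine eLpNorm_congr_ae ?_
  filter_upwards [Lp.coeFn_sub (c.bfz ψ) (∑ γ ∈ s, c.waveIso γ (c.res γ ψ)),
    c.coeFn_sum_waveIso s fun γ => c.res γ ψ] with k h1 h2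
  rw [h1, Pi.sub_apply, h2]
  rfl

theorem aestronglyMeasurable_β {V : Type*} [TopologicalSpace V] {f : Space d → V}
    (h : AEStronglyMeasurable f volume) : AEStronglyMeasurable f c.β :=
  (h.restrict (s := c.brillouin)).mono_ac Measure.smul_absolutelyContinuous

variable {c}

/-- Both φ and `bfz ψ` are L² limits over 𝔹 of the same partial sums. From here on the series is not
needed: a transform is an equivariant measurable function that agrees with `bfz ψ` on 𝔹. -/
theorem isBFZ_iff {ψ : c.H} {φ : Space d → c.Hf} :
    c.IsBFZ ψ φ ↔ AEStronglyMeasurable φ volume ∧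
      (∀ κ ∈ c.dualLattice, ∀ᵐ k, φ (k + κ) = c.rho κ (φ k)) ∧ φ =ᵐ[c.β] (c.bfz ψ : Space d → c.Hf) := by
  have hsum : ∀ s : Finset c.lattice, Continuous fun k => ∑ γ ∈ s, c.bfzTerm ψ k γ := fun s =>
    continuous_finsetSum s fun γ _ => c.continuous_bfzTerm ψ γ
  constructor
  · intro h
    refine ⟨h.meas, h.equivariant, ?_⟩
    have h1 := c.tendsto_eLpNorm_iff.1 h.tendsto
    have h2 := c.tendsto_bfz ψ
    have hm := c.aestronglyMeasurable_β h.meas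
    have hle : ∀ s : Finset c.lattice, eLpNorm (φ - (c.bfz ψ : Space d → c.Hf)) 2 c.β
        ≤ eLpNorm (fun k => φ k - ∑ γ ∈ s, c.bfzTerm ψ k γ) 2 c.β
          + eLpNorm (fun k => c.bfz ψ k - ∑ γ ∈ s, c.bfzTerm ψ k γ) 2 c.β := by
      intro s
      have : φ - (c.bfz ψ : Space d → c.Hf) = (fun k => φ k - ∑ γ ∈ s, c.bfzTerm ψ k γ)
          - fun k => c.bfz ψ k - ∑ γ ∈ s, c.bfzTerm ψ k γ := by
        funext k; simp
      rw [this]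
      exact eLpNorm_sub_le (hm.sub (hsum s).aestronglyMeasurable)
        ((Lp.aestronglyMeasurable _).sub (hsum s).aestronglyMeasurable) one_le_two
    have h0 : eLpNorm (φ - (c.bfz ψ : Space d → c.Hf)) 2 c.β = 0 := by
      have := ge_of_tendsto' (h1.add h2) hle
      simpa using this
    rw [eLpNorm_eq_zero_iff (hm.sub (Lp.aestronglyMeasurable _)) two_ne_zero] at h0
    filter_upwards [h0] with k hk
    exact sub_eq_zero.1 hk
  · rintro ⟨h1, h2, h3⟩
    refine ⟨h1, h2, c.tendsto_eLpNorm_iff.2 ((c.tendsto_bfz ψ).congr fun s => ?_)⟩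
    refine eLpNorm_congr_ae ?_
    filter_upwards [h3] with k hk
    rw [hk]

end Crystal

namespace Crystal

variable {d N : ℕ} (c : Crystal d N)

/-! ### Uniqueness and existence of transforms -/

theorem ae_of_ae_translates {Q : Space d → Prop}
    (h : ∀ κ ∈ c.dualLattice, ∀ᵐ k ∂c.β, Q (k + κ)) : ∀ᵐ k, Q k := by
  have h1 : ∀ κ : Submodule.span ℤ (range c.dualBasis),
      ∀ᵐ k : Space d, k - (κ : Space d) ∈ c.brillouin → Q k := by
    intro κ
    have hκ : (κ : Space d) ∈ c.dualLattice := by rw [dualLattice_eq]; exact κ.2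
    have h2 := (ae_restrict_iff' c.measurableSet_brillouin).1 (c.ae_β_iff.1 (h κ hκ))
    have h3 := (measurePreserving_sub_right volume (κ : Space d)).quasiMeasurePreserving.ae h2
    filter_upwards [h3] with k hk hm
    have := hk hm
    rwa [sub_add_cancel] at this
  filter_upwards [ae_all_iff.2 h1] with k hk
  refine hk (ZSpan.floor c.dualBasis k) ?_
  rw [brillouin_eq]
  exact ZSpan.fract_mem_fundamentalDomain c.dualBasis k

/-- The equivariant function which agrees with `f` on the Brillouin zone. -/
def periodize (f : Space d → c.Hf) (k : Space d) : c.Hf :=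
  c.rho (k - ZSpan.fract c.dualBasis k) (f (ZSpan.fract c.dualBasis k))

theorem periodize_eq {f : Space d → c.Hf} {k : Space d} (hk : k ∈ c.brillouin) :
    c.periodize f k = f k := by
  rw [brillouin_eq] at hk
  rw [periodize, ZSpan.fract_eq_self.2 hk, sub_self, rho_apply, neg_zero, phase_zero]

theorem periodize_add {κ : Space d} (hκ : κ ∈ c.dualLattice) (f : Space d → c.Hf) (k : Space d) :
    c.periodize f (k + κ) = c.rho κ (c.periodize f k) := by
  rw [dualLattice_eq] at hκ
  have h : k + κ - ZSpan.fract c.dualBasis k = κ + (k - ZSpan.fract c.dualBasis k) := by abel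
  rw [periodize, periodize, ZSpan.fract_add_ZSpan _ _ hκ, h, rho_add]

theorem measurable_zspan_fract : Measurable (ZSpan.fract c.dualBasis) := by
  have h : ∀ k, ZSpan.fract c.dualBasis k
      = c.coord.symm fun i => Int.fract (c.coord k i) := by
    intro k
    rw [ContinuousLinearEquiv.eq_symm_apply]
    funext i
    rw [← dualBasis_repr, ZSpan.repr_fract_apply, dualBasis_repr]
  rw [funext h]
  refine c.coord.symm.continuous.measurable.comp (measurable_pi_iff.2 fun i => ?_)
  exact measurable_fract.comp ((measurable_pi_apply (X := fun _ : Fin d => ℝ) i).comp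
    c.coord.continuous.measurable)

theorem aestronglyMeasurable_periodize {f : Space d → c.Hf} (hf : StronglyMeasurable f) :
    AEStronglyMeasurable (c.periodize f) volume := by
  have h1 : StronglyMeasurable fun k => f (ZSpan.fract c.dualBasis k) :=
    hf.comp_measurable c.measurable_zspan_fract
  have h2 : StronglyMeasurable fun k => -(k - ZSpan.fract c.dualBasis k) :=
    ((measurable_id.sub c.measurable_zspan_fract).neg).stronglyMeasurable
  have h3 := c.continuous_phase_prod.comp_stronglyMeasurable (h2.prodMk h1)
  exact h3.aestronglyMeasurable

variable {c}

theorem ae_add {Q : Space d → Prop} (h : ∀ᵐ k, Q k) (κ : Space d) : ∀ᵐ k, Q (k + κ) :=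
  (measurePreserving_add_right volume κ).quasiMeasurePreserving.ae h

theorem ae_β_of_ae {Q : Space d → Prop} (h : ∀ᵐ k, Q k) : ∀ᵐ k ∂c.β, Q k :=
  c.ae_β_iff.2 (ae_restrict_of_ae h)

theorem isBFZ_of_bfz {ψ : c.H} {φ : Space d → c.Hf} (h1 : AEStronglyMeasurable φ volume)
    (h2 : ∀ κ ∈ c.dualLattice, ∀ᵐ k, φ (k + κ) = c.rho κ (φ k))
    (h3 : φ =ᵐ[c.β] (c.bfz ψ : Space d → c.Hf)) : c.IsBFZ ψ φ :=
  isBFZ_iff.2 ⟨h1, h2, h3⟩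

theorem IsBFZ.ae_eq_bfz {ψ : c.H} {φ : Space d → c.Hf} (h : c.IsBFZ ψ φ) :
    φ =ᵐ[c.β] (c.bfz ψ : Space d → c.Hf) := (isBFZ_iff.1 h).2.2

theorem IsBFZ.memLp {ψ : c.H} {φ : Space d → c.Hf} (h : c.IsBFZ ψ φ) : MemLp φ 2 c.β :=
  (Lp.memLp (c.bfz ψ)).ae_eq h.ae_eq_bfz.symm

theorem IsBFZ.enorm_eq {ψ : c.H} {φ : Space d → c.Hf} (h : c.IsBFZ ψ φ) :
    ‖ψ‖ₑ = eLpNorm φ 2 c.β := by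
  rw [eLpNorm_congr_ae h.ae_eq_bfz, ← Lp.enorm_def, ← ofReal_norm, ← ofReal_norm,
    LinearIsometryEquiv.norm_map]

theorem IsBFZ.congr {ψ : c.H} {φ φ' : Space d → c.Hf} (h : c.IsBFZ ψ φ)
    (hφ : φ =ᵐ[volume] φ') : c.IsBFZ ψ φ' := by
  refine isBFZ_of_bfz (h.meas.congr hφ) (fun κ hκ => ?_) ?_
  · filter_upwards [hφ, ae_add hφ κ, h.equivariant κ hκ] with k h1 h2 h3
    rw [← h1, ← h2, h3]
  · filter_upwards [ae_β_of_ae hφ, h.ae_eq_bfz] with k h1 h2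
    rw [← h1, h2]

/-- Equivariant functions which agree on the Brillouin zone agree everywhere. -/
theorem ae_eq_of_ae_eq_β {φ φ' : Space d → c.Hf}
    (h : ∀ κ ∈ c.dualLattice, ∀ᵐ k, φ (k + κ) = c.rho κ (φ k))
    (h' : ∀ κ ∈ c.dualLattice, ∀ᵐ k, φ' (k + κ) = c.rho κ (φ' k)) (hφ : φ =ᵐ[c.β] φ') :
    φ =ᵐ[volume] φ' := by
  refine c.ae_of_ae_translates fun κ hκ => ?_
  filter_upwards [hφ, ae_β_of_ae (h κ hκ), ae_β_of_ae (h' κ hκ)] with k h1 h2 h3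
  rw [h2, h3, h1]

theorem IsBFZ.ae_eq {ψ : c.H} {φ φ' : Space d → c.Hf} (h : c.IsBFZ ψ φ) (h' : c.IsBFZ ψ φ') :
    φ =ᵐ[volume] φ' :=
  ae_eq_of_ae_eq_β h.equivariant h'.equivariant (h.ae_eq_bfz.trans h'.ae_eq_bfz.symm)

theorem IsBFZ.eq_of_ae {ψ ψ' : c.H} {φ φ' : Space d → c.Hf} (h : c.IsBFZ ψ φ)
    (h' : c.IsBFZ ψ' φ') (hφ : φ =ᵐ[c.β] φ') : ψ = ψ' := by
  refine c.bfz.injective (Lp.ext ?_)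
  exact h.ae_eq_bfz.symm.trans (hφ.trans h'.ae_eq_bfz)

theorem IsBFZ.sub {ψ ψ' : c.H} {φ φ' : Space d → c.Hf} (h : c.IsBFZ ψ φ) (h' : c.IsBFZ ψ' φ') :
    c.IsBFZ (ψ - ψ') fun k => φ k - φ' k := by
  have := h.add (h'.smul (-1))
  simpa [sub_eq_add_neg] using this

theorem exists_isBFZ_of_memLp {φ : Space d → c.Hf} (hm : AEStronglyMeasurable φ volume)
    (h : ∀ κ ∈ c.dualLattice, ∀ᵐ k, φ (k + κ) = c.rho κ (φ k)) (hL : MemLp φ 2 c.β) :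
    ∃ ψ, c.IsBFZ ψ φ := by
  refine ⟨c.bfz.symm (hL.toLp φ), isBFZ_of_bfz hm h ?_⟩
  rw [LinearIsometryEquiv.apply_symm_apply]
  exact hL.coeFn_toLp.symm

variable (c) in
theorem exists_isBFZ (ψ : c.H) : ∃ φ, c.IsBFZ ψ φ := by
  refine ⟨c.periodize (c.bfz ψ), isBFZ_of_bfz
    (c.aestronglyMeasurable_periodize (Lp.stronglyMeasurable _))
    (fun κ hκ => ae_of_all _ (c.periodize_add hκ _)) ?_⟩
  filter_upwards [c.ae_mem_brillouin] with k hk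
  exact c.periodize_eq hk

theorem IsBFZ.of_continuous {ψ : c.H} {φ : Space d → c.Hf} (h : c.IsBFZ ψ φ)
    (hφ : Continuous φ) {κ : Space d} (hκ : κ ∈ c.dualLattice) (k : Space d) :
    φ (k + κ) = c.rho κ (φ k) := by
  have h1 : (fun k => φ (k + κ)) =ᵐ[volume] fun k => c.rho κ (φ k) := h.equivariant κ hκ
  exact congrFun (Continuous.ae_eq_iff_eq volume (hφ.comp (by fun_prop))
    ((c.rho κ).continuous.comp hφ) |>.1 h1) k

/-! ### Wave packets and translations -/

variable (c)

theorem bfz_translate_extend (γ : c.lattice) (u : c.Hf) :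
    c.bfz (c.T (-γ) (c.extend u)) = c.waveIso γ u := by
  classical
  refine (c.hasSum_bfz (c.T (-γ) (c.extend u))).unique ?_
  have h : ∀ γ', c.res γ' (c.T (-γ) (c.extend u)) = if γ' = γ then u else 0 := by
    intro γ'
    rw [res_T]
    split_ifs with h
    · rw [h, add_neg_cancel, res_zero_extend]
    · exact c.res_extend_of_ne (by rwa [← sub_eq_add_neg, sub_ne_zero]) u
  have h2 := hasSum_single (f := fun γ' => c.waveIso γ' (c.res γ' (c.T (-γ) (c.extend u)))) γ
    (fun γ' hγ' => by simp only [h, if_neg hγ', map_zero])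
  simpa only [h, if_true] using h2

/-- A vector supported in a single translate of the cell has a one-term series and thus an explicit
smooth transform. These vectors serve as test vectors: their finite sums are dense, and they recover
the fibres of an operator. -/
theorem isBFZ_waveFun (γ : c.lattice) (u : c.Hf) :
    c.IsBFZ (c.T (-γ) (c.extend u)) (c.waveFun γ u) := by
  refine isBFZ_of_bfz (c.continuous_waveFun γ u).aestronglyMeasurable
    (fun κ hκ => ae_of_all _ (c.waveFun_add_dual γ u hκ)) ?_
  rw [bfz_translate_extend]
  exact (c.coeFn_waveIso γ u).symm

theorem inner_waveIso_bfz (γ : c.lattice) (u : c.Hf) (ψ : c.H) :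
    ⟪c.waveIso γ u, c.bfz ψ⟫_ℂ = ⟪u, c.res γ ψ⟫_ℂ := by
  have h := (innerSL ℂ (c.waveIso γ u)).hasSum (c.hasSum_bfz ψ)
  refine h.unique ?_
  have h2 := hasSum_single (f := fun γ' => innerSL ℂ (c.waveIso γ u) (c.waveIso γ' (c.res γ' ψ))) γ
    (fun γ' hγ' => c.orthogonalFamily_waveIso hγ'.symm u (c.res γ' ψ))
  rwa [innerSL_apply_apply, LinearIsometry.inner_map_map] at h2

/-- In the transform, translations act as the scalars e^{-ik·γ}; this is why every fibred operator
is periodic. -/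
theorem bfz_T (γ : c.lattice) (ψ : c.H) :
    c.bfz (c.T γ ψ) =ᵐ[c.β] fun k => c.wave (-γ) k • c.bfz ψ k := by
  have hL : MemLp (fun k => c.wave (-γ) k • c.bfz ψ k) 2 c.β :=
    (Lp.memLp (c.bfz ψ)).of_le
      ((c.continuous_wave (-γ)).aestronglyMeasurable.smul (Lp.aestronglyMeasurable _))
      (ae_of_all _ fun k => by rw [norm_smul, norm_wave, one_mul])
  have h : c.bfz (c.T γ ψ) - hL.toLp _ = 0 := by
    refine c.eq_zero_of_forall_inner_waveIso _ fun γ' u => ?_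
    rw [inner_sub_right, inner_waveIso_bfz, res_T, ← inner_waveIso_bfz, inner_waveIso,
      inner_waveIso, sub_eq_zero]
    refine integral_congr_ae ?_
    filter_upwards [hL.coeFn_toLp] with k hk
    rw [hk, map_smul, inner_smul_right, ← mul_assoc, ← wave_add, neg_add]
  rw [sub_eq_zero] at h
  rw [h]
  exact hL.coeFn_toLp

/-! ### Smoothness of the phases -/

theorem exists_cell_bound : ∃ R : ℝ, 0 ≤ R ∧ ∀ y ∈ c.cell, ‖y‖ ≤ R := by
  obtain ⟨R, hR⟩ := (ZSpan.fundamentalDomain_isBounded c.a).exists_norm_le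
  exact ⟨max R 0, le_max_right _ _, fun y hy => (hR y hy).trans (le_max_left _ _)⟩

theorem memLp_cellMul (h : Space d) (u : c.Hf) :
    MemLp (fun y => ((⟪h, y⟫_ℝ : ℝ) : ℂ) • u y) 2 (c.ν.restrict c.cell) := by
  obtain ⟨R, hR0, hR⟩ := c.exists_cell_bound
  have h1 : Continuous fun y : Space d => ((⟪h, y⟫_ℝ : ℝ) : ℂ) := by fun_prop
  refine (Lp.memLp u).of_le_mul (c := ‖h‖ * R)
    (h1.aestronglyMeasurable.smul (Lp.aestronglyMeasurable u)) ?_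
  filter_upwards [ae_restrict_mem c.measurableSet_cell] with y hy
  rw [norm_smul, Complex.norm_real]
  gcongr
  exact (norm_inner_le_norm h y).trans (mul_le_mul_of_nonneg_left (hR y hy) (norm_nonneg _))

/-- Multiplication by `y ↦ h·y` on the unit cell. -/
def cellMulₗ (h : Space d) : c.Hf →ₗ[ℂ] c.Hf where
  toFun u := (c.memLp_cellMul h u).toLp _
  map_add' u v := by
    rw [← MemLp.toLp_add]
    refine MemLp.toLp_congr _ _ ?_
    filter_upwards [Lp.coeFn_add u v] with y hy
    rw [hy, Pi.add_apply, Pi.add_apply, smul_add]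
  map_smul' z u := by
    rw [RingHom.id_apply, ← MemLp.toLp_const_smul]
    refine MemLp.toLp_congr _ _ ?_
    filter_upwards [Lp.coeFn_smul z u] with y hy
    rw [hy, Pi.smul_apply, Pi.smul_apply, smul_comm]

theorem coeFn_cellMulₗ (h : Space d) (u : c.Hf) :
    c.cellMulₗ h u =ᵐ[c.ν.restrict c.cell] fun y => ((⟪h, y⟫_ℝ : ℝ) : ℂ) • u y :=
  (c.memLp_cellMul h u).coeFn_toLp

theorem exists_norm_cellMulₗ_le (h : Space d) : ∃ B, ∀ u, ‖c.cellMulₗ h u‖ ≤ B * ‖u‖ := by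
  obtain ⟨R, hR0, hR⟩ := c.exists_cell_bound
  refine ⟨‖h‖ * R, fun u => Lp.norm_le_mul_norm_of_ae_le_mul ?_⟩
  filter_upwards [c.coeFn_cellMulₗ h u, ae_restrict_mem c.measurableSet_cell] with y hy hc
  rw [hy, norm_smul, Complex.norm_real]
  gcongr
  exact (norm_inner_le_norm h y).trans (mul_le_mul_of_nonneg_left (hR y hc) (norm_nonneg _))

/-- Multiplication by `y ↦ h·y` on the unit cell. -/
def cellMul : Space d →L[ℝ] (c.Hf →L[ℂ] c.Hf) :=
  LinearMap.toContinuousLinearMap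
    { toFun := fun h => (c.cellMulₗ h).mkContinuousOfExistsBound (c.exists_norm_cellMulₗ_le h)
      map_add' := by
        intro h h'
        refine ContinuousLinearMap.ext fun u => Lp.ext ?_
        change c.cellMulₗ (h + h') u =ᵐ[_] (c.cellMulₗ h u + c.cellMulₗ h' u : c.Hf)
        filter_upwards [c.coeFn_cellMulₗ (h + h') u, c.coeFn_cellMulₗ h u, c.coeFn_cellMulₗ h' u,
          Lp.coeFn_add (c.cellMulₗ h u) (c.cellMulₗ h' u)] with y h1 h2 h3 h4
        rw [h1, h4, Pi.add_apply, h2, h3, inner_add_left, Complex.ofReal_add, add_smul]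
      map_smul' := by
        intro r h
        refine ContinuousLinearMap.ext fun u => Lp.ext ?_
        change c.cellMulₗ (r • h) u =ᵐ[_] (r • c.cellMulₗ h u : c.Hf)
        filter_upwards [c.coeFn_cellMulₗ (r • h) u, c.coeFn_cellMulₗ h u,
          Lp.coeFn_smul r (c.cellMulₗ h u)] with y h1 h2 h3
        rw [h1, h3, Pi.smul_apply, h2, real_inner_smul_left, Complex.ofReal_mul, mul_smul,
          Complex.coe_smul] }

theorem coeFn_cellMul (h : Space d) (u : c.Hf) :
    c.cellMul h u =ᵐ[c.ν.restrict c.cell] fun y => ((⟪h, y⟫_ℝ : ℝ) : ℂ) • u y :=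
  c.coeFn_cellMulₗ h u

/-- The phases as bounded operators. -/
def phaseL (k : Space d) : c.Hf →L[ℂ] c.Hf := (c.phase k).toContinuousLinearMap

theorem phaseL_apply (k : Space d) (u : c.Hf) : c.phaseL k u = c.phase k u := rfl

/-- The cell is bounded, so the estimate |eˣ - 1 - x| ≤ |x|² holds uniformly in y; the phases are
therefore differentiable in operator norm and not only strongly. -/
theorem norm_phaseL_sub_le {R : ℝ} (hR : ∀ y ∈ c.cell, ‖y‖ ≤ R) (k k' : Space d)
    (h : ‖k' - k‖ * R ≤ 1) :
    ‖c.phaseL k' - c.phaseL k - (Complex.I • c.cellMul (k' - k)) * c.phaseL k‖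
      ≤ R ^ 2 * ‖k' - k‖ ^ 2 := by
  refine ContinuousLinearMap.opNorm_le_bound _ (by positivity) fun u => ?_
  have e : (c.phaseL k' - c.phaseL k - (Complex.I • c.cellMul (k' - k)) * c.phaseL k) u
      = c.phase k' u - c.phase k u - Complex.I • c.cellMul (k' - k) (c.phase k u) := rfl
  rw [e]
  refine Lp.norm_le_mul_norm_of_ae_le_mul ?_
  filter_upwards [Lp.coeFn_sub (c.phase k' u - c.phase k u)
      (Complex.I • c.cellMul (k' - k) (c.phase k u)), Lp.coeFn_sub (c.phase k' u) (c.phase k u),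
    Lp.coeFn_smul Complex.I (c.cellMul (k' - k) (c.phase k u)), c.coeFn_cellMul (k' - k)
      (c.phase k u), c.coeFn_phase k u, c.coeFn_phase k' u, ae_restrict_mem c.measurableSet_cell]
    with y h1 h2 h3 h4 h5 h6 hy
  rw [h1, Pi.sub_apply, h2, h3, Pi.sub_apply, Pi.smul_apply, h4, h5, h6, smul_smul, smul_smul,
    ← sub_smul, ← sub_smul, norm_smul]
  refine mul_le_mul_of_nonneg_right ?_ (norm_nonneg _)
  set x : ℂ := (⟪k' - k, y⟫_ℝ : ℝ) * Complex.I with hx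
  have h7 : Complex.exp ((⟪k', y⟫_ℝ : ℝ) * Complex.I) - Complex.exp ((⟪k, y⟫_ℝ : ℝ) * Complex.I)
      - Complex.I * (⟪k' - k, y⟫_ℝ : ℝ) * Complex.exp ((⟪k, y⟫_ℝ : ℝ) * Complex.I)
      = Complex.exp ((⟪k, y⟫_ℝ : ℝ) * Complex.I) * (Complex.exp x - 1 - x) := by
    rw [mul_sub, mul_sub, mul_one, ← Complex.exp_add, hx, ← add_mul, ← Complex.ofReal_add,
      ← inner_add_left, add_sub_cancel]
    ring
  have h8 : ‖x‖ ≤ ‖k' - k‖ * R := by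
    rw [hx, norm_mul, Complex.norm_I, mul_one, Complex.norm_real]
    exact (norm_inner_le_norm _ _).trans (mul_le_mul_of_nonneg_left (hR y hy) (norm_nonneg _))
  rw [h7, norm_mul, Complex.norm_exp_ofReal_mul_I, one_mul]
  calc ‖Complex.exp x - 1 - x‖ ≤ ‖x‖ ^ 2 := Complex.norm_exp_sub_one_sub_id_le (h8.trans h)
    _ ≤ (‖k' - k‖ * R) ^ 2 := by gcongr
    _ = R ^ 2 * ‖k' - k‖ ^ 2 := by ring

/-- `B ↦ (h ↦ i (h·y) B)`. -/
def phaseDeriv : (c.Hf →L[ℂ] c.Hf) →L[ℝ] Space d →L[ℝ] (c.Hf →L[ℂ] c.Hf) :=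
  (((ContinuousLinearMap.mul ℝ (c.Hf →L[ℂ] c.Hf)).comp
    ((Complex.I • ContinuousLinearMap.id ℂ (c.Hf →L[ℂ] c.Hf)).restrictScalars ℝ)).comp
      c.cellMul).flip

theorem phaseDeriv_apply (B : c.Hf →L[ℂ] c.Hf) (h : Space d) :
    c.phaseDeriv B h = (Complex.I • c.cellMul h) * B := rfl

set_option synthInstance.maxHeartbeats 200000 in
theorem hasFDerivAt_phaseL (k : Space d) :
    HasFDerivAt c.phaseL (c.phaseDeriv (c.phaseL k)) k := by
  obtain ⟨R, -, hR⟩ := c.exists_cell_bound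
  have h1 : (fun k' => c.phaseL k' - c.phaseL k - c.phaseDeriv (c.phaseL k) (k' - k))
      =O[𝓝 k] fun k' => ‖k' - k‖ ^ 2 := by
    refine Asymptotics.IsBigO.of_bound (R ^ 2) ?_
    have h2 : Tendsto (fun k' => ‖k' - k‖ * R) (𝓝 k) (𝓝 0) := by
      have : Continuous fun k' => ‖k' - k‖ * R := by fun_prop
      simpa using this.tendsto k
    filter_upwards [h2.eventually (ge_mem_nhds zero_lt_one)] with k' hk'
    rw [phaseDeriv_apply, norm_pow, norm_norm]
    exact c.norm_phaseL_sub_le hR k k' hk'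
  have h3 := h1.hasFDerivAt (𝕜 := ℝ) one_lt_two
  have h4 : HasFDerivAt (fun k' => c.phaseL k + c.phaseDeriv (c.phaseL k) (k' - k))
      (c.phaseDeriv (c.phaseL k)) k :=
    ((c.phaseDeriv (c.phaseL k)).hasFDerivAt.comp k
      ((hasFDerivAt_id (𝕜 := ℝ) k).sub_const k)).const_add (c.phaseL k)
  have h5 := h3.add h4
  rw [zero_add] at h5
  refine h5.congr_of_eventuallyEq (Eventually.of_forall fun k' => ?_)
  simp only [Pi.add_apply]
  abel

theorem contDiff_apply {E V W : Type*} [NormedAddCommGroup E] [NormedSpace ℝ E]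
    [NormedAddCommGroup V] [NormedSpace ℂ V] [NormedAddCommGroup W] [NormedSpace ℂ W]
    {n : WithTop ℕ∞} {b : E → V →L[ℂ] W} {f : E → V} (hb : ContDiff ℝ n b) (hf : ContDiff ℝ n f) :
    ContDiff ℝ n fun x => b x (f x) :=
  ((isBoundedBilinearMap_apply (𝕜 := ℂ) (E := V) (F := W)).contDiff.restrict_scalars ℝ).comp
    (hb.prodMk hf)

theorem contDiff_comp {E U V W : Type*} [NormedAddCommGroup E] [NormedSpace ℝ E]
    [NormedAddCommGroup U] [NormedSpace ℂ U] [NormedAddCommGroup V] [NormedSpace ℂ V]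
    [NormedAddCommGroup W] [NormedSpace ℂ W] {n : WithTop ℕ∞} {b : E → V →L[ℂ] W}
    {b' : E → U →L[ℂ] V} (hb : ContDiff ℝ n b) (hb' : ContDiff ℝ n b') :
    ContDiff ℝ n fun x => (b x).comp (b' x) :=
  ((isBoundedBilinearMap_comp (𝕜 := ℂ) (E := U) (F := V) (G := W)).contDiff.restrict_scalars
    ℝ).comp (hb.prodMk hb')

theorem contDiffAt_comp {E U V W : Type*} [NormedAddCommGroup E] [NormedSpace ℝ E]
    [NormedAddCommGroup U] [NormedSpace ℂ U] [NormedAddCommGroup V] [NormedSpace ℂ V]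
    [NormedAddCommGroup W] [NormedSpace ℂ W] {n : WithTop ℕ∞} {b : E → V →L[ℂ] W}
    {b' : E → U →L[ℂ] V} {x : E} (hb : ContDiffAt ℝ n b x) (hb' : ContDiffAt ℝ n b' x) :
    ContDiffAt ℝ n (fun x => (b x).comp (b' x)) x :=
  ContDiffAt.comp x ((isBoundedBilinearMap_comp (𝕜 := ℂ) (E := U) (F := V)
    (G := W)).contDiff.restrict_scalars ℝ).contDiffAt (hb.prodMk hb')

/-- Bootstrapping of a linear differential equation: the derivative L(Φ) is as regular as Φ, so each
order of regularity yields the next. -/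
theorem contDiff_of_hasFDerivAt_linear {E V : Type*} [NormedAddCommGroup E] [NormedSpace ℝ E]
    [NormedAddCommGroup V] [NormedSpace ℝ V] {Φ : E → V} (L : V →L[ℝ] E →L[ℝ] V)
    (h : ∀ x, HasFDerivAt Φ (L (Φ x)) x) : ContDiff ℝ ∞ Φ := by
  rw [contDiff_infty]
  intro n
  induction n with
  | zero => exact contDiff_zero.2 (continuous_iff_continuousAt.2 fun x => (h x).continuousAt)
  | succ n ih =>
    push_cast
    rw [contDiff_succ_iff_fderiv]
    refine ⟨fun x => (h x).differentiableAt, by simp, ?_⟩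
    have : fderiv ℝ Φ = fun x => L (Φ x) := funext fun x => (h x).fderiv
    rw [this]
    exact L.contDiff.comp ih

theorem contDiff_phaseL : ContDiff ℝ ∞ c.phaseL :=
  contDiff_of_hasFDerivAt_linear c.phaseDeriv c.hasFDerivAt_phaseL

theorem contDiff_waveFun (γ : c.lattice) (u : c.Hf) : ContDiff ℝ ∞ (c.waveFun γ u) := by
  have h1 : ContDiff ℝ ∞ (c.wave γ) := by
    have h0 : ContDiff ℝ ∞ fun k : Space d => ((⟪k, (γ : Space d)⟫_ℝ : ℝ) : ℂ) :=
      Complex.ofRealCLM.contDiff.comp (contDiff_id.inner ℝ contDiff_const)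
    exact (h0.mul contDiff_const).cexp
  have h2 : ContDiff ℝ ∞ fun k => c.phaseL (-k) u := by
    have h3 : ContDiff ℝ ∞ fun k => c.phaseL (-k) := c.contDiff_phaseL.comp contDiff_neg
    exact contDiff_apply h3 contDiff_const
  exact h1.smul h2

theorem translate_mem_smoothCore (γ : c.lattice) (u : c.Hf) :
    c.T (-γ) (c.extend u) ∈ c.smoothCore (ContinuousLinearMap.id ℂ c.Hf) :=
  ⟨c.waveFun γ u, c.contDiff_waveFun γ u, c.isBFZ_waveFun γ u⟩

/-- Every ψ is the unconditional sum of its restrictions to the translates of the cell, and each of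
them has a smooth transform. -/
theorem dense_smoothCore : Dense (c.smoothCore (ContinuousLinearMap.id ℂ c.Hf) : Set c.H) := by
  classical
  intro ψ
  have h : HasSum (fun γ => c.T (-γ) (c.extend (c.res γ ψ))) ψ := by
    have h1 := lp.hasSum_single (p := 2) (by norm_num) (c.decomp ψ)
    have h2 : (fun γ => lp.single 2 γ (c.decomp ψ γ))
        = fun γ => c.decomp (c.T (-γ) (c.extend (c.res γ ψ))) :=
      funext fun γ => (c.decomp_T_extend γ _).symm
    rw [h2] at h1
    set D := LinearIsometryEquiv.ofSurjective c.decomp c.decomp_surjective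
    have h3 := D.symm.toContinuousLinearEquiv.toContinuousLinearMap.hasSum h1
    have h4 : ∀ χ, D.symm (c.decomp χ) = χ := fun χ => D.symm_apply_apply χ
    simpa only [ContinuousLinearEquiv.coe_coe, LinearIsometryEquiv.coe_toContinuousLinearEquiv,
      Function.comp_def, h4] using h3
  refine mem_closure_of_tendsto h (Eventually.of_forall fun s => ?_)
  exact Submodule.sum_mem _ fun γ _ => c.translate_mem_smoothCore γ _

end Crystal

namespace Crystal

variable {d N : ℕ} (c : Crystal d N)

/-! ### Fibred operators -/

/-- Bounded continuous families of operators on the fibre space. -/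
abbrev Fam : Type := Space d →ᵇ (c.Hf →L[ℂ] c.Hf)

theorem isTopologicalRing_boundedContinuousFunction (X R : Type*) [TopologicalSpace X]
    [NormedRing R] : IsTopologicalRing (X →ᵇ R) := inferInstance

instance : NormedRing c.Fam := inferInstance

instance : NormedAlgebra ℂ c.Fam := inferInstance

instance : Ring c.Fam := inferInstance

instance : Semiring c.Fam := inferInstance

instance : Algebra ℂ c.Fam := inferInstance

instance : NormedAddCommGroup c.Fam := inferInstance

instance : AddCommGroup c.Fam := inferInstance

instance : AddCommMonoid c.Fam := inferInstance

instance : Module ℂ c.Fam := inferInstance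

instance : PseudoMetricSpace c.Fam := inferInstance

instance : TopologicalSpace c.Fam := inferInstance

instance : IsTopologicalRing c.Fam :=
  isTopologicalRing_boundedContinuousFunction (Space d) (c.Hf →L[ℂ] c.Hf)

variable {c}

theorem aestronglyMeasurable_fam (b : c.Fam) {m : Measure (Space d)} {f : Space d → c.Hf}
    (hf : AEStronglyMeasurable f m) : AEStronglyMeasurable (fun k => b k (f k)) m := by
  have h1 : AEStronglyMeasurable (fun k => b k) m := b.continuous.aestronglyMeasurable
  have h2 : AEStronglyMeasurable (fun k => (b k, f k)) m := h1.prodMk hf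
  exact (isBoundedBilinearMap_apply (𝕜 := ℂ) (E := c.Hf) (F := c.Hf)).continuous
    |>.comp_aestronglyMeasurable h2

theorem memLp_fam (b : c.Fam) {f : Space d → c.Hf} (hf : MemLp f 2 c.β) :
    MemLp (fun k => b k (f k)) 2 c.β :=
  hf.of_le_mul (c := ‖b‖) (aestronglyMeasurable_fam b hf.1) (ae_of_all _ fun k =>
    ((b k).le_opNorm _).trans (mul_le_mul_of_nonneg_right (b.norm_coe_le_norm k) (norm_nonneg _)))

/-- The action of a family on `L²(𝔹, 𝓗_f)`. -/
def mulFamₗ (b : c.Fam) : c.LB →ₗ[ℂ] c.LB where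
  toFun f := (memLp_fam b (Lp.memLp f)).toLp _
  map_add' f g := by
    rw [← MemLp.toLp_add]
    refine MemLp.toLp_congr _ _ ?_
    filter_upwards [Lp.coeFn_add f g] with k hk
    rw [hk, Pi.add_apply, Pi.add_apply, map_add]
  map_smul' z f := by
    rw [RingHom.id_apply, ← MemLp.toLp_const_smul]
    refine MemLp.toLp_congr _ _ ?_
    filter_upwards [Lp.coeFn_smul z f] with k hk
    rw [hk, Pi.smul_apply, Pi.smul_apply, map_smul]

theorem coeFn_mulFamₗ (b : c.Fam) (f : c.LB) : mulFamₗ b f =ᵐ[c.β] fun k => b k (f k) :=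
  (memLp_fam b (Lp.memLp f)).coeFn_toLp

theorem norm_mulFamₗ_le (b : c.Fam) (f : c.LB) : ‖mulFamₗ b f‖ ≤ ‖b‖ * ‖f‖ := by
  refine Lp.norm_le_mul_norm_of_ae_le_mul ?_
  filter_upwards [coeFn_mulFamₗ b f] with k hk
  rw [hk]
  exact ((b k).le_opNorm _).trans
    (mul_le_mul_of_nonneg_right (b.norm_coe_le_norm k) (norm_nonneg _))

/-- The operator on `𝓗` with the given family of fibres. -/
def opL (b : c.Fam) : c.H →L[ℂ] c.H :=
  (c.bfz.symm.toContinuousLinearEquiv.toContinuousLinearMap.comp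
    ((mulFamₗ b).mkContinuous ‖b‖ (norm_mulFamₗ_le b))).comp
      c.bfz.toContinuousLinearEquiv.toContinuousLinearMap

theorem bfz_opL (b : c.Fam) (ψ : c.H) : c.bfz (opL b ψ) = mulFamₗ b (c.bfz ψ) :=
  c.bfz.apply_symm_apply _

theorem coeFn_bfz_opL (b : c.Fam) (ψ : c.H) :
    c.bfz (opL b ψ) =ᵐ[c.β] fun k => b k (c.bfz ψ k) := by
  rw [bfz_opL]
  exact coeFn_mulFamₗ b _

theorem opL_ext {A : c.H →L[ℂ] c.H} {b : c.Fam}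
    (h : ∀ ψ, c.bfz (A ψ) =ᵐ[c.β] fun k => b k (c.bfz ψ k)) : opL b = A := by
  refine ContinuousLinearMap.ext fun ψ => c.bfz.injective (Lp.ext ?_)
  exact (coeFn_bfz_opL b ψ).trans (h ψ).symm

theorem norm_opL_le (b : c.Fam) : ‖opL b‖ ≤ ‖b‖ := by
  refine ContinuousLinearMap.opNorm_le_bound _ (norm_nonneg b) fun ψ => ?_
  rw [← c.bfz.norm_map, ← c.bfz.norm_map ψ, bfz_opL]
  exact norm_mulFamₗ_le b _

variable (c) in
/-- The operator on `𝓗` with the given family of fibres. -/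
def op : c.Fam →ₐ[ℂ] (c.H →L[ℂ] c.H) :=
  AlgHom.ofLinearMap
    { toFun := opL
      map_add' := fun b b' => opL_ext fun ψ => by
        rw [add_apply, map_add]
        filter_upwards [coeFn_bfz_opL b ψ, coeFn_bfz_opL b' ψ,
          Lp.coeFn_add (c.bfz (opL b ψ)) (c.bfz (opL b' ψ))] with k h1 h2 h3
        rw [h3, Pi.add_apply, h1, h2]
        rfl
      map_smul' := fun z b => opL_ext fun ψ => by
        rw [RingHom.id_apply, smul_apply, map_smul]
        filter_upwards [coeFn_bfz_opL b ψ, Lp.coeFn_smul z (c.bfz (opL b ψ))] with k h1 h3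
        rw [h3, Pi.smul_apply, h1]
        rfl }
    (opL_ext fun ψ => ae_of_all _ fun k => rfl)
    (fun b b' => opL_ext fun ψ => by
      change c.bfz (opL b (opL b' ψ)) =ᵐ[c.β] _
      filter_upwards [coeFn_bfz_opL b (opL b' ψ), coeFn_bfz_opL b' ψ] with k h1 h2
      rw [h1, h2]
      rfl)

theorem coeFn_bfz_op (b : c.Fam) (ψ : c.H) :
    c.bfz (c.op b ψ) =ᵐ[c.β] fun k => b k (c.bfz ψ k) := coeFn_bfz_opL b ψ

variable (c) in
theorem continuous_op : Continuous c.op :=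
  AddMonoidHomClass.continuous_of_bound c.op 1 fun b => by rw [one_mul]; exact norm_opL_le b

theorem map_exp_of_continuous {𝔸 𝔹 : Type*} [NormedRing 𝔸] [NormedAlgebra ℂ 𝔸] [CompleteSpace 𝔸]
    [NormedRing 𝔹] [NormedAlgebra ℂ 𝔹] (f : 𝔸 →ₐ[ℂ] 𝔹) (hf : Continuous f) (x : 𝔸) :
    f (NormedSpace.exp x) = NormedSpace.exp (f x) := by
  have := NormedAlgebra.restrictScalars ℚ ℂ 𝔸
  have := NormedAlgebra.restrictScalars ℚ ℂ 𝔹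
  exact NormedSpace.map_exp f hf x

theorem op_exp (b : c.Fam) : c.op (NormedSpace.exp b) = NormedSpace.exp (c.op b) :=
  map_exp_of_continuous c.op c.continuous_op b

variable (c) in
/-- Evaluation of families at `k`. -/
def evalFam (k : Space d) : c.Fam →ₐ[ℂ] (c.Hf →L[ℂ] c.Hf) :=
  AlgHom.ofLinearMap
    { toFun := fun b => b k
      map_add' := fun _ _ => rfl
      map_smul' := fun _ _ => rfl } rfl fun _ _ => rfl

theorem exp_fam_apply (b : c.Fam) (k : Space d) :
    NormedSpace.exp b k = NormedSpace.exp (b k) :=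
  map_exp_of_continuous (c.evalFam k)
    (BoundedContinuousFunction.lipschitz_eval_const k).continuous b

theorem op_star (b : c.Fam) : c.op (star b) = star (c.op b) := by
  rw [ContinuousLinearMap.star_eq_adjoint, ContinuousLinearMap.eq_adjoint_iff]
  intro ψ χ
  rw [← c.bfz.inner_map_map, ← c.bfz.inner_map_map ψ, L2.inner_def, L2.inner_def]
  refine integral_congr_ae ?_
  filter_upwards [coeFn_bfz_op (star b) ψ, coeFn_bfz_op b χ] with k h1 h2
  rw [h1, h2, BoundedContinuousFunction.star_apply, ContinuousLinearMap.star_eq_adjoint,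
    ContinuousLinearMap.adjoint_inner_left]

theorem op_T (b : c.Fam) (γ : c.lattice) (ψ : c.H) : c.op b (c.T γ ψ) = c.T γ (c.op b ψ) := by
  refine c.bfz.injective (Lp.ext ?_)
  filter_upwards [coeFn_bfz_op b (c.T γ ψ), c.bfz_T γ ψ, c.bfz_T γ (c.op b ψ), coeFn_bfz_op b ψ]
    with k h1 h2 h3 h4
  rw [h1, h2, h3, h4, map_smul]

theorem isPeriodic_op (b : c.Fam) : c.IsPeriodic (full (c.op b)) := fun γ ψ =>
  ⟨trivial, op_T b γ ψ⟩

/-- `b(k + κ) ϱ(κ) = ϱ(κ) b(k)`. -/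
def Equivariant (b : Space d → c.Hf →L[ℂ] c.Hf) : Prop :=
  ∀ κ ∈ c.dualLattice, ∀ k u, b (k + κ) (c.rho κ u) = c.rho κ (b k u)

theorem IsBFZ.op {b : c.Fam} (hb : Equivariant b) {ψ : c.H} {φ : Space d → c.Hf}
    (h : c.IsBFZ ψ φ) : c.IsBFZ (c.op b ψ) fun k => b k (φ k) := by
  refine isBFZ_of_bfz (aestronglyMeasurable_fam b h.meas) (fun κ hκ => ?_) ?_
  · filter_upwards [h.equivariant κ hκ] with k hk
    rw [hk, hb κ hκ]
  · filter_upwards [coeFn_bfz_op b ψ, h.ae_eq_bfz] with k h1 h2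
    rw [h1, h2]

theorem eq_zero_of_op_eq_zero {b : c.Fam} (hb : Equivariant b) (h : c.op b = 0) : b = 0 := by
  ext1 k
  refine ContinuousLinearMap.ext fun v => ?_
  -- The wave packet of u with γ = 0 takes the value v at k. Continuity of both sides turns
  -- vanishing almost everywhere into vanishing at k.
  set u := c.phase k v with hu
  have h1 := (c.isBFZ_waveFun 0 u).op hb
  rw [h, zero_apply] at h1
  have h2 : (fun k => b k (c.waveFun 0 u k)) =ᵐ[volume] fun _ => 0 := h1.ae_eq IsBFZ.zero
  have h3 : Continuous fun k => b k (c.waveFun 0 u k) :=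
    b.continuous.clm_apply (c.continuous_waveFun 0 u)
  have h4 := congrFun ((Continuous.ae_eq_iff_eq volume h3 continuous_const).1 h2) k
  have h5 : c.waveFun 0 u k = v := by
    rw [waveFun, hu, phase_neg_phase, wave]
    simp
  rw [h5] at h4
  exact h4

theorem Equivariant.sub {b b' : Space d → c.Hf →L[ℂ] c.Hf} (h : Equivariant b)
    (h' : Equivariant b') : Equivariant fun k => b k - b' k := by
  intro κ hκ k u
  simp only [sub_apply, h κ hκ, h' κ hκ, map_sub]

theorem Equivariant.smul (z : ℂ) {b : Space d → c.Hf →L[ℂ] c.Hf} (h : Equivariant b) :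
    Equivariant fun k => z • b k := by
  intro κ hκ k u
  simp only [smul_apply, h κ hκ, map_smul]

theorem Equivariant.mul {b b' : Space d → c.Hf →L[ℂ] c.Hf} (h : Equivariant b)
    (h' : Equivariant b') : Equivariant fun k => b k * b' k := by
  intro κ hκ k u
  simp only [mul_apply_eq_comp, h κ hκ, h' κ hκ]

theorem inner_rho_left (κ : Space d) (u v : c.Hf) : ⟪c.rho κ u, v⟫_ℂ = ⟪u, c.rho (-κ) v⟫_ℂ :=
  c.inner_phase_left (-κ) u v

theorem Equivariant.star {b : Space d → c.Hf →L[ℂ] c.Hf} (h : Equivariant b) :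
    Equivariant fun k => star (b k) := by
  intro κ hκ k u
  refine ext_inner_right ℂ fun v => ?_
  simp only [ContinuousLinearMap.star_eq_adjoint]
  rw [ContinuousLinearMap.adjoint_inner_left, inner_rho_left, inner_rho_left,
    ContinuousLinearMap.adjoint_inner_left]
  have := h κ hκ k (c.rho (-κ) v)
  rw [rho_rho_neg] at this
  rw [this, rho_neg_rho]

theorem Equivariant.exp {b : Space d → c.Hf →L[ℂ] c.Hf} (h : Equivariant b) :
    Equivariant fun k => NormedSpace.exp (b k) := by
  intro κ hκ k u
  have h1 : (c.rho κ).toContinuousLinearMap ∘L b k = b (k + κ) ∘L (c.rho κ).toContinuousLinearMap :=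
    ContinuousLinearMap.ext fun u => (h κ hκ k u).symm
  exact (congrArg (fun A : c.Hf →L[ℂ] c.Hf => A u) (comp_exp_of_intertwine _ h1)).symm

theorem op_injective {b b' : c.Fam} (hb : Equivariant b) (hb' : Equivariant b')
    (h : c.op b = c.op b') : b = b' := by
  rw [← sub_eq_zero]
  exact eq_zero_of_op_eq_zero (hb.sub hb') (by rw [map_sub, h, sub_self])

theorem Equivariant.norm_eq {b : Space d → c.Hf →L[ℂ] c.Hf} (h : Equivariant b) {κ : Space d}
    (hκ : κ ∈ c.dualLattice) (k : Space d) : ‖b (k + κ)‖ = ‖b k‖ := by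
  refine le_antisymm ?_ ?_
  · refine ContinuousLinearMap.opNorm_le_bound _ (norm_nonneg _) fun u => ?_
    have := h κ hκ k (c.rho (-κ) u)
    rw [rho_rho_neg] at this
    rw [this, LinearIsometry.norm_map, ← (c.rho (-κ)).norm_map u]
    exact (b k).le_opNorm _
  · refine ContinuousLinearMap.opNorm_le_bound _ (norm_nonneg _) fun u => ?_
    rw [← (c.rho κ).norm_map (b k u), ← h κ hκ, ← (c.rho κ).norm_map u]
    exact (b (k + κ)).le_opNorm _

theorem exists_eq_add_dual (k : Space d) : ∃ k' ∈ c.brillouin, ∃ κ ∈ c.dualLattice, k = k' + κ := by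
  refine ⟨ZSpan.fract c.dualBasis k, ?_, ZSpan.floor c.dualBasis k, ?_, ?_⟩
  · rw [brillouin_eq]; exact ZSpan.fract_mem_fundamentalDomain _ _
  · rw [dualLattice_eq]; exact (ZSpan.floor c.dualBasis k).2
  · rw [ZSpan.fract_apply, sub_add_cancel]

theorem Equivariant.norm_le {b : Space d → c.Hf →L[ℂ] c.Hf} (h : Equivariant b) {B : ℝ}
    (hB : ∀ k ∈ c.brillouin, ‖b k‖ ≤ B) (k : Space d) : ‖b k‖ ≤ B := by
  obtain ⟨k', hk', κ, hκ, rfl⟩ := exists_eq_add_dual (c := c) k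
  rw [h.norm_eq hκ]
  exact hB k' hk'

/-- The norms of an equivariant family are periodic under the reciprocal lattice, so the compact
closure of 𝔹 controls them everywhere. -/
theorem Equivariant.exists_bound {b : Space d → c.Hf →L[ℂ] c.Hf} (h : Equivariant b)
    (hc : Continuous b) : ∃ B, ∀ k, ‖b k‖ ≤ B := by
  obtain ⟨B, hB⟩ := c.isCompact_closure_brillouin.exists_bound_of_continuousOn hc.continuousOn
  exact ⟨B, h.norm_le fun k hk => hB k (subset_closure hk)⟩

/-- A continuous equivariant family. -/
def fam (b : Space d → c.Hf →L[ℂ] c.Hf) (hc : Continuous b) (h : Equivariant b) : c.Fam :=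
  BoundedContinuousFunction.ofNormedAddCommGroup b hc (h.exists_bound hc).choose
    (h.exists_bound hc).choose_spec

theorem Equivariant.fderiv {b : Space d → c.Hf →L[ℂ] c.Hf} (h : Equivariant b)
    (hb : ContDiff ℝ ∞ b) (e : Space d) : Equivariant fun k => fderiv ℝ b k e := by
  intro κ hκ k u
  have hd : ∀ k, HasFDerivAt b (_root_.fderiv ℝ b k) k := fun k =>
    (hb.differentiable (by simp) k).hasFDerivAt
  set L₁ : (c.Hf →L[ℂ] c.Hf) →L[ℝ] c.Hf :=
    (ContinuousLinearMap.apply ℂ c.Hf (c.rho κ u)).restrictScalars ℝ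
  set L₂ : (c.Hf →L[ℂ] c.Hf) →L[ℝ] c.Hf :=
    ((c.rho κ).toContinuousLinearMap.comp (ContinuousLinearMap.apply ℂ c.Hf u)).restrictScalars ℝ
  have h1 : HasFDerivAt (fun k => L₁ (b (k + κ))) (L₁.comp (_root_.fderiv ℝ b (k + κ))) k :=
    L₁.hasFDerivAt.comp k ((hasFDerivAt_comp_add_right κ).2 (hd (k + κ)))
  have h2 : HasFDerivAt (fun k => L₂ (b k)) (L₂.comp (_root_.fderiv ℝ b k)) k :=
    L₂.hasFDerivAt.comp k (hd k)
  have h3 : (fun k => L₁ (b (k + κ))) = fun k => L₂ (b k) := funext fun k => h κ hκ k u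
  rw [h3] at h1
  exact congrArg (fun A : Space d →L[ℝ] c.Hf => A e) (h1.unique h2)

theorem contDiff_fderiv_apply {E V : Type*} [NormedAddCommGroup E] [NormedSpace ℝ E]
    [NormedAddCommGroup V] [NormedSpace ℝ V] {b : E → V} (hb : ContDiff ℝ ∞ b) (e : E) :
    ContDiff ℝ ∞ fun k => fderiv ℝ b k e :=
  (hb.fderiv_right (m := ∞) (by simp)).clm_apply contDiff_const

/-! ### Membership in the spaces of periodic operators -/

section MemP

variable {V : Type*} [NormedAddCommGroup V] [NormedSpace ℂ V] {i : V →L[ℂ] c.Hf}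

theorem isFibration_op {b : c.Fam} (hb : Equivariant b) {a : Space d → c.Hf →L[ℂ] V}
    (h : ∀ k, i ∘L a k = b k) :
    c.IsFibration (full (c.op b)) (ContinuousLinearMap.id ℂ c.Hf) i a := by
  intro ψ φ hφ
  refine ⟨⟨fun _ => ⟨φ, c.memLp_β_iff.1 hφ.memLp, ae_of_all _ fun _ => rfl⟩, fun _ => trivial⟩,
    fun _ f hf => ?_⟩
  refine (hφ.op hb).congr ?_
  filter_upwards [hf] with k hk
  rw [← h k, ← hk]
  rfl

theorem memP_op {b : c.Fam} (hb : Equivariant b) {a : Space d → c.Hf →L[ℂ] V}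
    (h : ∀ k, i ∘L a k = b k) (ha : ContDiff ℝ ∞ a) :
    c.MemP (full (c.op b)) (ContinuousLinearMap.id ℂ c.Hf) i :=
  ⟨isPeriodic_op b, a, ha, isFibration_op hb h⟩

theorem memPLe_op {b : c.Fam} (hb : Equivariant b) {a : Space d → c.Hf →L[ℂ] V}
    (h : ∀ k, i ∘L a k = b k) (ha : ContDiff ℝ ∞ a) {B : ℝ} (hB : ∀ k ∈ c.brillouin, ‖a k‖ ≤ B) :
    c.MemPLe (full (c.op b)) (ContinuousLinearMap.id ℂ c.Hf) i B :=
  ⟨isPeriodic_op b, a, ha, isFibration_op hb h, hB⟩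

end MemP

theorem op_mem_smoothCore {b : c.Fam} (hb : Equivariant b) {V : Type*} [NormedAddCommGroup V]
    [NormedSpace ℂ V] {i : V →L[ℂ] c.Hf} {a : Space d → c.Hf →L[ℂ] V} (h : ∀ k, i ∘L a k = b k)
    (ha : ContDiff ℝ ∞ a) {ψ : c.H} (hψ : ψ ∈ c.smoothCore (ContinuousLinearMap.id ℂ c.Hf)) :
    c.op b ψ ∈ c.smoothCore i := by
  obtain ⟨φ, h1, h2⟩ := hψ
  refine ⟨fun k => a k (φ k), contDiff_apply ha h1, (h2.op hb).congr (ae_of_all _ fun k => ?_)⟩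
  change b k (φ k) = _
  rw [← h k]
  rfl

end Crystal

theorem fderiv_apply_apply {E V W : Type*} [NormedAddCommGroup E] [NormedSpace ℝ E]
    [NormedAddCommGroup V] [NormedSpace ℂ V] [NormedAddCommGroup W] [NormedSpace ℂ W]
    {b : E → V →L[ℂ] W} {f : E → V} {x : E} (hb : DifferentiableAt ℝ b x)
    (hf : DifferentiableAt ℝ f x) (e : E) :
    fderiv ℝ (fun x => b x (f x)) x e = fderiv ℝ b x e (f x) + b x (fderiv ℝ f x e) := by
  have h1 := ((isBoundedBilinearMap_apply (𝕜 := ℂ) (E := V) (F := W)).hasFDerivAt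
    (b x, f x)).restrictScalars ℝ
  have h2 : HasFDerivAt (fun x => (b x, f x)) ((fderiv ℝ b x).prod (fderiv ℝ f x)) x :=
    hb.hasFDerivAt.prodMk hf.hasFDerivAt
  have h3 := (h1.comp x h2).fderiv
  have h4 : fderiv ℝ (fun x => b x (f x)) x e = b x (fderiv ℝ f x e) + fderiv ℝ b x e (f x) :=
    congrArg (fun A : E →L[ℝ] W => A e) h3
  rw [h4, add_comm]

namespace Crystal

variable {d N : ℕ} (c : Crystal d N)

/-! ### Integration of derivatives of periodic functions -/

-- The translate of 𝔹 is again a fundamental domain of the reciprocal lattice, and a periodic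
-- function has the same integral over both.
open Pointwise in
theorem integral_translate {q : Space d → ℂ} (hper : ∀ κ ∈ c.dualLattice, ∀ k, q (k + κ) = q k)
    (v : Space d) : ∫ k, q (k + v) ∂c.β = ∫ k, q k ∂c.β := by
  have h1 : IsAddFundamentalDomain (Submodule.span ℤ (range c.dualBasis)) c.brillouin volume := by
    rw [brillouin_eq]
    exact ZSpan.isAddFundamentalDomain c.dualBasis volume
  have h2 : IsAddFundamentalDomain (Submodule.span ℤ (range c.dualBasis)) (v +ᵥ c.brillouin)
      volume := h1.vadd_of_comm v
  have : VAddInvariantMeasure (Submodule.span ℤ (range c.dualBasis)) (Space d) volume :=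
    (inferInstance : VAddInvariantMeasure
      (Submodule.span ℤ (range c.dualBasis)).toAddSubgroup (Space d) volume)
  have h3 := h2.setIntegral_eq h1 (f := q) fun g k => by
    rw [Submodule.vadd_def, vadd_eq_add, add_comm]
    exact hper _ (by rw [dualLattice_eq]; exact g.2) k
  have h4 := (measurePreserving_add_left volume v).setIntegral_preimage_emb
    (measurableEmbedding_addLeft v) q (v +ᵥ c.brillouin)
  have h5 : (fun k => v + k) ⁻¹' (v +ᵥ c.brillouin) = c.brillouin := by
    ext k
    rw [mem_preimage, ← vadd_eq_add, vadd_mem_vadd_set_iff]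
  rw [h5, h3] at h4
  rw [β, integral_smul_measure, integral_smul_measure, ← h4]
  simp only [add_comm]

theorem exists_bound_of_periodic {V : Type*} [NormedAddCommGroup V] {g : Space d → V}
    (hg : Continuous g) (hper : ∀ κ ∈ c.dualLattice, ∀ k, g (k + κ) = g k) :
    ∃ B, ∀ k, ‖g k‖ ≤ B := by
  obtain ⟨B, hB⟩ := c.isCompact_closure_brillouin.exists_bound_of_continuousOn hg.continuousOn
  refine ⟨B, fun k => ?_⟩
  obtain ⟨k', hk', κ, hκ, rfl⟩ := exists_eq_add_dual (c := c) k
  rw [hper κ hκ]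
  exact hB k' (subset_closure hk')

/-- The integral is the derivative at s = 0 of ∫ q(k + se), which is constant in s. -/
theorem integral_fderiv_periodic {q : Space d → ℂ} (hq : ContDiff ℝ ∞ q)
    (hper : ∀ κ ∈ c.dualLattice, ∀ k, q (k + κ) = q k) (e : Space d) :
    ∫ k, fderiv ℝ q k e ∂c.β = 0 := by
  have hq' : Continuous fun k => fderiv ℝ q k e := (contDiff_fderiv_apply hq e).continuous
  have hper' : ∀ κ ∈ c.dualLattice, ∀ k, fderiv ℝ q (k + κ) e = fderiv ℝ q k e := by
    intro κ hκ k
    rw [← fderiv_comp_add_right, funext (hper κ hκ)]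
  obtain ⟨B, hB⟩ := c.exists_bound_of_periodic hq' hper'
  obtain ⟨B', hB'⟩ := c.exists_bound_of_periodic hq.continuous hper
  have h := hasDerivAt_integral_of_dominated_loc_of_deriv_le (μ := c.β)
    (F := fun (s : ℝ) k => q (k + s • e)) (F' := fun s k => fderiv ℝ q (k + s • e) e)
    (x₀ := (0 : ℝ)) (bound := fun _ => B) (s := univ) univ_mem
    (Eventually.of_forall fun s => (hq.continuous.comp (by fun_prop)).aestronglyMeasurable)
    (Integrable.of_bound ((hq.continuous.comp (by fun_prop)).aestronglyMeasurable) B'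
      (ae_of_all _ fun k => hB' _))
    (hq'.comp (by fun_prop : Continuous fun k : Space d => k + (0 : ℝ) • e)).aestronglyMeasurable
    (ae_of_all _ fun k s _ => hB _) (integrable_const _)
    (ae_of_all _ fun k s _ => by
      have h1 : HasDerivAt (fun s : ℝ => k + s • e) e s := by
        simpa using ((hasDerivAt_id s).smul_const e).const_add k
      exact ((hq.differentiable (by simp) (k + s • e)).hasFDerivAt).comp_hasDerivAt s h1)
  have h2 := h.2
  simp only [c.integral_translate hper, zero_smul, add_zero] at h2
  exact h2.unique (hasDerivAt_const _ _)

/-! ### The position operator -/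

variable {c}

theorem IsBFZ.inner_res {χ : c.H} {g : Space d → c.Hf} (h : c.IsBFZ χ g) (γ : c.lattice)
    (u : c.Hf) : ⟪u, c.res γ χ⟫_ℂ = ∫ k, c.wave (-γ) k * ⟪u, c.phase k (g k)⟫_ℂ ∂c.β := by
  rw [← inner_waveIso_bfz, inner_waveIso]
  refine integral_congr_ae ?_
  filter_upwards [h.ae_eq_bfz] with k hk
  rw [hk]

variable (c) in
theorem contDiff_wave (γ : c.lattice) : ContDiff ℝ ∞ (c.wave γ) := by
  have h0 : ContDiff ℝ ∞ fun k : Space d => ((⟪k, (γ : Space d)⟫_ℝ : ℝ) : ℂ) :=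
    Complex.ofRealCLM.contDiff.comp (contDiff_id.inner ℝ contDiff_const)
  exact (h0.mul contDiff_const).cexp

variable (c) in
theorem fderiv_wave (γ : c.lattice) (k e : Space d) :
    fderiv ℝ (c.wave γ) k e = Complex.I * (⟪e, (γ : Space d)⟫_ℝ : ℝ) * c.wave γ k := by
  have h1 : HasFDerivAt (fun k : Space d => ((⟪k, (γ : Space d)⟫_ℝ : ℝ) : ℂ) * Complex.I)
      ((Complex.I • Complex.ofRealCLM).comp (innerSL ℝ (γ : Space d))) k := by
    have h2 := ((Complex.I • Complex.ofRealCLM).comp (innerSL ℝ (γ : Space d))).hasFDerivAt (x := k)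
    refine h2.congr_of_eventuallyEq (Eventually.of_forall fun k' => ?_)
    change _ = Complex.I * ((⟪(γ : Space d), k'⟫_ℝ : ℝ) : ℂ)
    rw [real_inner_comm, mul_comm]
  have h3 := congrArg (fun A : Space d →L[ℝ] ℂ => A e) h1.cexp.fderiv
  refine Eq.trans h3 ?_
  change Complex.exp _ * (Complex.I * ((⟪(γ : Space d), e⟫_ℝ : ℝ) : ℂ)) = _
  rw [real_inner_comm e, mul_comm]
  rfl

theorem fderiv_wave_phase (γ : c.lattice) (k e : Space d) :
    fderiv ℝ (fun k => c.wave γ k • c.phaseL k) k e = c.wave γ k •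
      ((Complex.I • c.cellMul e) * c.phaseL k
        + (Complex.I * (⟪e, (γ : Space d)⟫_ℝ : ℝ)) • c.phaseL k) := by
  have h1 := ((c.contDiff_wave γ).differentiable (by simp) k).hasFDerivAt.smul
    (c.hasFDerivAt_phaseL k)
  have h2 := congrArg (fun A : Space d →L[ℝ] (c.Hf →L[ℂ] c.Hf) => A e) h1.fderiv
  refine Eq.trans h2 ?_
  change c.wave γ k • c.phaseDeriv (c.phaseL k) e + fderiv ℝ (c.wave γ) k e • c.phaseL k = _
  rw [fderiv_wave, phaseDeriv_apply, smul_add, smul_smul, mul_comm (c.wave γ k)]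

/-- The restriction of T_γψ to the cell is a Fourier coefficient of e^{ik·y}φ(k, y). Integrating the
derivative of the periodic function e^{-ik·γ}⟨u, e^{ik·y}φ(k)⟩ over 𝔹 gives zero; the derivative
falling on the exponentials produces i(e·y - e·γ), which is i times the component along e of the
point y - γ where ψ is evaluated. -/
theorem res_of_fderiv {ψ χ : c.H} {φ : Space d → c.Hf} (hφ : ContDiff ℝ ∞ φ) (h : c.IsBFZ ψ φ)
    (e : Space d) (hχ : c.IsBFZ χ fun k => Complex.I • fderiv ℝ φ k e) (γ : c.lattice) :
    c.res γ χ = c.cellMul e (c.res γ ψ) - ((⟪e, (γ : Space d)⟫_ℝ : ℝ) : ℂ) • c.res γ ψ := by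
  refine ext_inner_left ℂ fun u => ?_
  set W : Space d → c.Hf →L[ℂ] c.Hf := fun k => c.wave (-γ) k • c.phaseL k with hW
  have hWs : ContDiff ℝ ∞ W := (c.contDiff_wave (-γ)).smul c.contDiff_phaseL
  have hWφ : ContDiff ℝ ∞ fun k => W k (φ k) := contDiff_apply hWs hφ
  set L : c.Hf →L[ℂ] ℂ := innerSL ℂ u with hL
  set q : Space d → ℂ := fun k => L (W k (φ k)) with hq
  have hqs : ContDiff ℝ ∞ q := (L.restrictScalars ℝ).contDiff.comp hWφ
  have hper : ∀ κ ∈ c.dualLattice, ∀ k, q (k + κ) = q k := by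
    intro κ hκ k
    simp only [hq, hW]
    rw [h.of_continuous hφ.continuous hκ, c.wave_add_dual _ hκ, smul_apply, smul_apply,
      phaseL_apply, phaseL_apply, phase_add, rho_apply, phase_phase_neg]
  have h0 := c.integral_fderiv_periodic hqs hper e
  set M : c.Hf →L[ℂ] c.Hf := c.cellMul e - ((⟪e, (γ : Space d)⟫_ℝ : ℝ) : ℂ) • 1 with hM
  have hd : ∀ k, fderiv ℝ q k e = Complex.I * (c.wave (-γ) k *
      ⟪ContinuousLinearMap.adjoint M u, c.phase k (φ k)⟫_ℂ)
      - Complex.I * (c.wave (-γ) k * ⟪u, c.phase k (Complex.I • fderiv ℝ φ k e)⟫_ℂ) := by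
    intro k
    have h1 : fderiv ℝ q k e = L (fderiv ℝ (fun k => W k (φ k)) k e) := by
      have := ((L.restrictScalars ℝ).hasFDerivAt.comp k
        (hWφ.differentiable (by simp) k).hasFDerivAt).fderiv
      exact congrArg (fun A : Space d →L[ℝ] ℂ => A e) this
    have h5 : fderiv ℝ (fun k => W k (φ k)) k e = fderiv ℝ W k e (φ k) + W k (fderiv ℝ φ k e) :=
      fderiv_apply_apply (hWs.differentiable (by simp) k) (hφ.differentiable (by simp) k) e
    rw [h1, h5, hW, fderiv_wave_phase, map_add, ContinuousLinearMap.adjoint_inner_left]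
    have h2 : L ((c.wave (-γ) k • ((Complex.I • c.cellMul e) * c.phaseL k
        + (Complex.I * (⟪e, ((-γ : c.lattice) : Space d)⟫_ℝ : ℝ)) • c.phaseL k)) (φ k))
        = Complex.I * (c.wave (-γ) k * ⟪u, M (c.phase k (φ k))⟫_ℂ) := by
      have h3 : (c.wave (-γ) k • ((Complex.I • c.cellMul e) * c.phaseL k
          + (Complex.I * (⟪e, ((-γ : c.lattice) : Space d)⟫_ℝ : ℝ)) • c.phaseL k)) (φ k)
          = (Complex.I * c.wave (-γ) k) • M (c.phase k (φ k)) := by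
        rw [Submodule.coe_neg, inner_neg_right, Complex.ofReal_neg, hM, sub_apply, smul_sub]
        change c.wave (-γ) k • (Complex.I • c.cellMul e (c.phase k (φ k))
          + (Complex.I * -((⟪e, (γ : Space d)⟫_ℝ : ℝ) : ℂ)) • c.phase k (φ k))
          = _ - (Complex.I * c.wave (-γ) k) • (((⟪e, (γ : Space d)⟫_ℝ : ℝ) : ℂ) •
            c.phase k (φ k))
        module
      rw [h3, hL, innerSL_apply_apply, inner_smul_right, mul_assoc]
    rw [h2, map_smul, inner_smul_right]
    have h4 : L (W k (fderiv ℝ φ k e)) = c.wave (-γ) k * ⟪u, c.phase k (fderiv ℝ φ k e)⟫_ℂ := by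
      rw [hL, innerSL_apply_apply, hW, ← inner_smul_right]
      rfl
    rw [h4]
    linear_combination ((c.wave (-γ) k * ⟪u, c.phase k (fderiv ℝ φ k e)⟫_ℂ)) * Complex.I_sq
  have hint : ∀ {χ : c.H} {g : Space d → c.Hf} (_ : c.IsBFZ χ g) (v : c.Hf),
      Integrable (fun k => c.wave (-γ) k * ⟪v, c.phase k (g k)⟫_ℂ) c.β := by
    intro χ g hg v
    have hm : MemLp (fun k => c.phase k (g k)) 2 c.β :=
      hg.memLp.of_le (c.aestronglyMeasurable_phase hg.memLp.1)
        (ae_of_all _ fun k => by rw [LinearIsometry.norm_map])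
    have h1 : Integrable (fun k => ⟪v, c.phase k (g k)⟫_ℂ) c.β :=
      ((innerSL ℂ v).comp_memLp' hm).integrable one_le_two
    refine h1.bdd_mul (c := 1) (c.continuous_wave _).aestronglyMeasurable
      (ae_of_all _ fun k => by rw [norm_wave])
  simp only [hd] at h0
  rw [integral_sub ((hint h _).const_mul _) ((hint hχ _).const_mul _), integral_const_mul,
    integral_const_mul, ← mul_sub, mul_eq_zero, or_iff_right Complex.I_ne_zero, ← hχ.inner_res,
    ← h.inner_res, ContinuousLinearMap.adjoint_inner_left, sub_eq_zero] at h0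
  rw [← h0]
  rfl

theorem ae_of_ae_cell {Q : Space d → Prop}
    (h : ∀ γ : c.lattice, ∀ᵐ y ∂c.ν.restrict c.cell, Q (y - (γ : Space d))) : ∀ᵐ x ∂c.ν, Q x := by
  have h1 : ∀ γ : c.lattice, ∀ᵐ x ∂c.ν, x - (γ : Space d) ∈ c.cell → Q x := by
    intro γ
    have h2 := (ae_restrict_iff' c.measurableSet_cell).1 (h (-γ))
    have h3 := (c.measurePreserving_sub γ).quasiMeasurePreserving.ae h2
    filter_upwards [h3] with x hx hm
    have := hx hm
    rwa [Submodule.coe_neg, sub_neg_eq_add, sub_add_cancel] at this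
  filter_upwards [ae_all_iff.2 h1] with x hx
  exact hx (ZSpan.floor c.a x) (ZSpan.fract_mem_fundamentalDomain c.a x)

theorem ae_eq_smul_of_res {ψ χ : c.H} (e : Space d) (h : ∀ γ : c.lattice,
    c.res γ χ = c.cellMul e (c.res γ ψ) - ((⟪e, (γ : Space d)⟫_ℝ : ℝ) : ℂ) • c.res γ ψ) :
    ∀ᵐ x ∂c.ν, χ x = ⟪e, x⟫_ℝ • ψ x := by
  refine ae_of_ae_cell fun γ => ?_
  have h1 := c.coeFn_res γ χ
  rw [h γ] at h1
  filter_upwards [h1, c.coeFn_res γ ψ, ae_restrict_of_ae (c.coeFn_T γ ψ),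
    ae_restrict_of_ae (c.coeFn_T γ χ), c.coeFn_cellMul e (c.res γ ψ),
    Lp.coeFn_sub (c.cellMul e (c.res γ ψ)) (((⟪e, (γ : Space d)⟫_ℝ : ℝ) : ℂ) • c.res γ ψ),
    Lp.coeFn_smul ((⟪e, (γ : Space d)⟫_ℝ : ℝ) : ℂ) (c.res γ ψ)] with y h1 h2 h3 h4 h5 h6 h7
  apply (c.M γ y).injective
  rw [← h4, ← h1, h6, Pi.sub_apply, h5, h7, Pi.smul_apply, h2, h3, ← sub_smul,
    ← Complex.ofReal_sub, ← inner_sub_right, ← Complex.coe_smul, map_smul]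

/-- i∂_jφ is smooth and equivariant, hence the transform of some χ in 𝓗. The Fourier computation in
`res_of_fderiv` identifies χ with x_jψ, so membership in the domain of X_j is a consequence rather
than a prerequisite. -/
theorem isBFZ_position (j : Fin d) {ψ : c.H} {φ : Space d → c.Hf} (hφ : ContDiff ℝ ∞ φ)
    (h : c.IsBFZ ψ φ) : ∃ hd : ψ ∈ (c.position j).domain, c.IsBFZ (c.position j ⟨ψ, hd⟩)
      fun k => Complex.I • fderiv ℝ φ k (EuclideanSpace.single j 1) := by
  set e : Space d := EuclideanSpace.single j 1
  have hs : ContDiff ℝ ∞ fun k => Complex.I • fderiv ℝ φ k e :=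
    (contDiff_fderiv_apply hφ e).const_smul Complex.I
  have heq : ∀ κ ∈ c.dualLattice, ∀ k,
      Complex.I • fderiv ℝ φ (k + κ) e = c.rho κ (Complex.I • fderiv ℝ φ k e) := by
    intro κ hκ k
    have h1 : (fun k => φ (k + κ)) = fun k => c.rho κ (φ k) :=
      funext (h.of_continuous hφ.continuous hκ)
    rw [← fderiv_comp_add_right, h1, map_smul]
    congr 1
    have := (((c.rho κ).toContinuousLinearMap.restrictScalars ℝ).hasFDerivAt.comp k
      (hφ.differentiable (by simp) k).hasFDerivAt).fderiv
    exact congrArg (fun A : Space d →L[ℝ] c.Hf => A e) this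
  obtain ⟨B, hB⟩ := c.exists_bound_of_periodic (g := fun k => ‖Complex.I • fderiv ℝ φ k e‖)
    hs.continuous.norm (fun κ hκ k => by rw [heq κ hκ, LinearIsometry.norm_map])
  obtain ⟨χ, hχ⟩ := exists_isBFZ_of_memLp hs.continuous.aestronglyMeasurable
    (fun κ hκ => ae_of_all _ (heq κ hκ))
    (MemLp.of_bound hs.continuous.aestronglyMeasurable B
      (ae_of_all _ fun k => by simpa only [norm_norm] using hB k))
  have h1 := ae_eq_smul_of_res e (res_of_fderiv hφ h e hχ)
  have h2 : (χ : Space d → Spin N) =ᵐ[c.ν] fun x => x j • ψ x := by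
    filter_upwards [h1] with x hx
    rw [hx, EuclideanSpace.inner_single_left]
    simp
  have hd : MemLp (fun x : Space d => x j • ψ x) 2 c.ν := (Lp.memLp χ).ae_eq h2
  refine ⟨hd, ?_⟩
  have h3 : c.position j ⟨ψ, hd⟩ = χ := Lp.ext (hd.coeFn_toLp.trans h2.symm)
  rw [h3]
  exact hχ

theorem inner_position (j : Fin d) (x y : (c.position j).domain) :
    ⟪c.position j x, (y : c.H)⟫_ℂ = ⟪(x : c.H), c.position j y⟫_ℂ := by
  rw [L2.inner_def, L2.inner_def]
  refine integral_congr_ae ?_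
  have h1 : ∀ z : (c.position j).domain, (c.position j z : Space d → Spin N)
      =ᵐ[c.ν] fun x => x j • (z : c.H) x := fun z => MemLp.coeFn_toLp z.2
  filter_upwards [h1 x, h1 y] with k hx hy
  rw [hx, hy, ← Complex.coe_smul, ← Complex.coe_smul, inner_smul_left, inner_smul_right,
    Complex.conj_ofReal]

/-- The fibres `i ∂_j b` of `[X_j, op b]`. -/
def posDeriv (j : Fin d) (b : Space d → c.Hf →L[ℂ] c.Hf) (k : Space d) : c.Hf →L[ℂ] c.Hf :=
  Complex.I • fderiv ℝ b k (EuclideanSpace.single j 1)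

theorem contDiff_posDeriv (j : Fin d) {b : Space d → c.Hf →L[ℂ] c.Hf} (hb : ContDiff ℝ ∞ b) :
    ContDiff ℝ ∞ (posDeriv j b) :=
  (contDiff_fderiv_apply hb _).const_smul Complex.I

theorem Equivariant.posDeriv (j : Fin d) {b : Space d → c.Hf →L[ℂ] c.Hf} (h : Equivariant b)
    (hb : ContDiff ℝ ∞ b) : Equivariant (posDeriv j b) :=
  (h.fderiv hb _).smul Complex.I

theorem smoothCore_le_position (j : Fin d) :
    c.smoothCore (ContinuousLinearMap.id ℂ c.Hf) ≤ (c.position j).domain := by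
  rintro ψ ⟨φ, h1, h2⟩
  exact (isBFZ_position j h1 h2).1

theorem op_mem_smoothCore_id {b : c.Fam} (hb : ContDiff ℝ ∞ b) (he : Equivariant b) {ψ : c.H}
    (hψ : ψ ∈ c.smoothCore (ContinuousLinearMap.id ℂ c.Hf)) :
    c.op b ψ ∈ c.smoothCore (ContinuousLinearMap.id ℂ c.Hf) :=
  op_mem_smoothCore he (fun _ => ContinuousLinearMap.id_comp _) hb hψ

/-- Leibniz rule: in i∂_j(bφ) - b(i∂_jφ) the terms with ∂_jφ cancel. -/
theorem position_op_sub (j : Fin d) {b b' : c.Fam} (hb : ContDiff ℝ ∞ b) (he : Equivariant b)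
    (hb' : ∀ k, b' k = posDeriv j b k) {ψ : c.H}
    (hψ : ψ ∈ c.smoothCore (ContinuousLinearMap.id ℂ c.Hf)) (h1 : ψ ∈ (c.position j).domain)
    (h2 : c.op b ψ ∈ (c.position j).domain) :
    c.position j ⟨c.op b ψ, h2⟩ - c.op b (c.position j ⟨ψ, h1⟩) = c.op b' ψ := by
  obtain ⟨φ, hφ, hψφ⟩ := hψ
  have hψφ' : c.IsBFZ ψ φ := hψφ
  have he' : Equivariant b' := by
    rw [show (b' : Space d → c.Hf →L[ℂ] c.Hf) = posDeriv j b from funext hb']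
    exact he.posDeriv j hb
  obtain ⟨_, h3⟩ := isBFZ_position j hφ hψφ'
  obtain ⟨_, h4⟩ := isBFZ_position j (contDiff_apply hb hφ) (hψφ'.op he)
  refine (h4.sub (h3.op he)).eq_of_ae (hψφ'.op he') (ae_of_all _ fun k => ?_)
  change Complex.I • fderiv ℝ (fun k => b k (φ k)) k _ - b k (Complex.I • _) = b' k (φ k)
  have h5 : ∀ e, fderiv ℝ (fun k => b k (φ k)) k e = fderiv ℝ b k e (φ k) + b k (fderiv ℝ φ k e) :=
    fderiv_apply_apply (hb.differentiable (by simp) k) (hφ.differentiable (by simp) k)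
  rw [h5, hb', posDeriv, map_smul, smul_add, add_sub_cancel_right]
  rfl

end Crystal

namespace Crystal

variable {d N : ℕ} {c : Crystal d N}

section Gapped

variable {H₀ : c.H →ₗ.[ℂ] c.H} {h : Space d → c.Hf →ₗ.[ℂ] c.Hf} {μ : ℝ} {P : c.H →L[ℂ] c.H}

/-! ### The fibres of the Hamiltonian -/

/-- The fibres of the Hamiltonian as bounded operators on their common domain. -/
def IsGapped.fib (hH : c.IsGapped H₀ h μ P) : Space d → GraphDomain (h 0) →L[ℂ] c.Hf :=
  hH.smooth_fibration.choose

theorem IsGapped.contDiff_fib (hH : c.IsGapped H₀ h μ P) : ContDiff ℝ ∞ hH.fib :=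
  hH.smooth_fibration.choose_spec.2.1

theorem IsGapped.isFibration_fib (hH : c.IsGapped H₀ h μ P) :
    c.IsFibration H₀ (GraphDomain.incl (h 0)) (ContinuousLinearMap.id ℂ c.Hf) hH.fib :=
  hH.smooth_fibration.choose_spec.2.2

theorem IsGapped.fib_eq (hH : c.IsGapped H₀ h μ P) (k : Space d) (u : GraphDomain (h 0)) :
    ∃ hu : GraphDomain.incl (h 0) u ∈ (h k).domain,
      h k ⟨GraphDomain.incl (h 0) u, hu⟩ = hH.fib k u :=
  ⟨by rw [hH.fibre_domain k]; exact GraphDomain.incl_mem u,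
    hH.smooth_fibration.choose_spec.1 k u ⟨_, _⟩ rfl⟩

theorem IsGapped.exists_incl_eq (hH : c.IsGapped H₀ h μ P) {k : Space d} (v : (h k).domain) :
    ∃ u, GraphDomain.incl (h 0) u = v ∧ hH.fib k u = h k v := by
  have hv : (v : c.Hf) ∈ (h 0).domain := by rw [← hH.fibre_domain k]; exact v.2
  exact ⟨⟨v, hv⟩, rfl, (hH.smooth_fibration.choose_spec.1 k _ v rfl).symm⟩

theorem IsGapped.exists_rho (hH : c.IsGapped H₀ h μ P) {κ : Space d} (hκ : κ ∈ c.dualLattice)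
    (u : GraphDomain (h 0)) : ∃ u', GraphDomain.incl (h 0) u' = c.rho κ (GraphDomain.incl (h 0) u) ∧
      ∀ k, hH.fib (k + κ) u' = c.rho κ (hH.fib k u) := by
  have hm := hH.rho_domain κ hκ _ (GraphDomain.incl_mem u)
  refine ⟨⟨_, hm⟩, rfl, fun k => ?_⟩
  obtain ⟨hu, h1⟩ := hH.fib_eq k u
  obtain ⟨hv, h2⟩ := hH.fib_eq (k + κ) ⟨_, hm⟩
  rw [← h1, ← h2]
  exact hH.fibre_equivariant κ hκ k ⟨_, hu⟩ ⟨_, hv⟩ rfl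

theorem IsGapped.completeSpace (hH : c.IsGapped H₀ h μ P) : CompleteSpace (GraphDomain (h 0)) :=
  completeSpace_graphDomain (hH.fibre_selfAdjoint 0).isClosed

theorem eLpNorm_two_sq {α F : Type*} [MeasurableSpace α] {m : Measure α} [NormedAddCommGroup F]
    (f : α → F) : eLpNorm f 2 m ^ 2 = ∫⁻ x, ‖f x‖ₑ ^ 2 ∂m := by
  have := eLpNorm_nnreal_pow_eq_lintegral (f := f) (μ := m) (p := 2) two_ne_zero
  simpa only [NNReal.coe_ofNat, ENNReal.rpow_ofNat, ENNReal.coe_ofNat] using this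

/-- If the inequality failed on a set D of positive measure in 𝔹, the vector whose transform is u on
D and 0 on the rest of 𝔹 would violate ‖ψ‖ ≤ ‖(H₀ - z)⁻¹‖‖(H₀ - z)ψ‖. This passes from the resolvent
of H₀ to its fibres without direct integral theory. -/
theorem IsGapped.ae_bound (hH : c.IsGapped H₀ h μ P) {z : ℂ} (hz : z ∈ resolventSet H₀)
    (u : GraphDomain (h 0)) : ∀ᵐ k ∂c.β, ‖GraphDomain.incl (h 0) u‖
      ≤ ‖resolvent H₀ z‖ * ‖hH.fib k u - z • GraphDomain.incl (h 0) u‖ := by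
  set i := GraphDomain.incl (h 0)
  set R := resolvent H₀ z
  set T : Space d → c.Hf := fun k => hH.fib k u - z • i u with hT
  have hTc : Continuous T :=
    (hH.contDiff_fib.continuous.clm_apply continuous_const).sub continuous_const
  set D : Set (Space d) := c.brillouin ∩ {k | ‖R‖ * ‖T k‖ < ‖i u‖} with hD
  have hDm : MeasurableSet D := c.measurableSet_brillouin.inter
    (measurableSet_lt (measurable_const.mul hTc.norm.measurable) measurable_const)
  set f₀ : Space d → c.Hf := D.indicator fun _ => i u with hf₀
  have hf₀m : StronglyMeasurable f₀ := stronglyMeasurable_const.indicator hDm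
  have hf₀L : MemLp f₀ 2 c.β := (memLp_const (i u)).indicator hDm
  set φ := c.periodize f₀ with hφ
  have hφ𝔹 : ∀ k ∈ c.brillouin, φ k = f₀ k := fun k hk => c.periodize_eq hk
  have hφL : MemLp φ 2 c.β := hf₀L.ae_eq (by
    filter_upwards [c.ae_mem_brillouin] with k hk
    exact (hφ𝔹 k hk).symm)
  obtain ⟨ψ, hψ⟩ := exists_isBFZ_of_memLp (c.aestronglyMeasurable_periodize hf₀m)
    (fun κ hκ => ae_of_all _ (c.periodize_add hκ f₀)) hφL
  rw [← hφ] at hψ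
  have hex : ∀ k, ∃ v, i v = φ k := by
    intro k
    have h1 : ∀ k, ∃ v, i v = f₀ k := by
      intro k
      by_cases hk : k ∈ D
      · exact ⟨u, by rw [hf₀, indicator_of_mem hk]⟩
      · exact ⟨0, by rw [hf₀, indicator_of_notMem hk, map_zero]⟩
    obtain ⟨v, hv⟩ := h1 (ZSpan.fract c.dualBasis k)
    have hκ : k - ZSpan.fract c.dualBasis k ∈ c.dualLattice := by
      rw [dualLattice_eq, ZSpan.fract_apply, sub_sub_cancel]
      exact (ZSpan.floor c.dualBasis k).2
    obtain ⟨v', hv', -⟩ := hH.exists_rho hκ v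
    exact ⟨v', by rw [hv', hv, hφ, periodize]⟩
  choose f hf using hex
  have hf𝔹 : ∀ k ∈ c.brillouin, f k = D.indicator (fun _ => u) k := by
    intro k hk
    apply GraphDomain.incl_injective (h 0)
    rw [hf, hφ𝔹 k hk, hf₀]
    by_cases hk : k ∈ D
    · rw [indicator_of_mem hk, indicator_of_mem hk]
    · rw [indicator_of_notMem hk, indicator_of_notMem hk, map_zero]
  have hfL : MemLp f 2 (volume.restrict c.brillouin) := by
    refine c.memLp_β_iff.1 (((memLp_const u).indicator hDm).ae_eq ?_)
    filter_upwards [c.ae_mem_brillouin] with k hk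
    exact (hf𝔹 k hk).symm
  have hd : ψ ∈ H₀.domain := (hH.isFibration_fib ψ φ hψ).1.2 ⟨f, hfL, ae_of_all _ hf⟩
  have h1 := (hH.isFibration_fib ψ φ hψ).2 hd f (ae_of_all _ hf)
  have h2 := h1.sub (hψ.smul z)
  have h3 : R (H₀ ⟨ψ, hd⟩ - z • ψ) = ψ := (isResolventAt_resolvent hz).2 ⟨ψ, hd⟩
  have h4 : ‖ψ‖ₑ ≤ ‖R‖ₑ * ‖H₀ ⟨ψ, hd⟩ - z • ψ‖ₑ := by
    have := R.le_opENorm (H₀ ⟨ψ, hd⟩ - z • ψ)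
    rwa [h3] at this
  have e1 : ‖ψ‖ₑ ^ 2 = ∫⁻ k, ‖f₀ k‖ₑ ^ 2 ∂c.β := by
    rw [hψ.enorm_eq, eLpNorm_two_sq]
    refine lintegral_congr_ae ?_
    filter_upwards [c.ae_mem_brillouin] with k hk
    rw [hφ𝔹 k hk]
  have e2 : ‖H₀ ⟨ψ, hd⟩ - z • ψ‖ₑ ^ 2 = ∫⁻ k, ‖D.indicator T k‖ₑ ^ 2 ∂c.β := by
    rw [h2.enorm_eq, eLpNorm_two_sq]
    refine lintegral_congr_ae ?_
    filter_upwards [c.ae_mem_brillouin] with k hk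
    rw [hφ𝔹 k hk, hf𝔹 k hk, hf₀]
    by_cases hk : k ∈ D
    · rw [indicator_of_mem hk, indicator_of_mem hk, indicator_of_mem hk]; rfl
    · rw [indicator_of_notMem hk, indicator_of_notMem hk, indicator_of_notMem hk, map_zero,
        map_zero, smul_zero, sub_zero]
  have hTm : Measurable fun k => ‖D.indicator T k‖ₑ ^ 2 :=
    ((hTc.stronglyMeasurable.indicator hDm).enorm).pow_const 2
  have hle : ∫⁻ k, ‖f₀ k‖ₑ ^ 2 ∂c.β ≤ ∫⁻ k, ‖R‖ₑ ^ 2 * ‖D.indicator T k‖ₑ ^ 2 ∂c.β := by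
    rw [lintegral_const_mul _ hTm, ← e1, ← e2, ← mul_pow]
    gcongr
  have hlt : ∀ k ∈ D, ‖R‖ₑ ^ 2 * ‖D.indicator T k‖ₑ ^ 2 < ‖f₀ k‖ₑ ^ 2 := by
    intro k hk
    rw [indicator_of_mem hk, hf₀, indicator_of_mem hk, ← mul_pow]
    refine ENNReal.pow_right_strictMono two_ne_zero ?_
    rw [← ofReal_norm, ← ofReal_norm, ← ofReal_norm, ← ENNReal.ofReal_mul (norm_nonneg _)]
    exact (ENNReal.ofReal_lt_ofReal_iff_of_nonneg (by positivity)).2 hk.2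
  have hle' : ∀ k, ‖R‖ₑ ^ 2 * ‖D.indicator T k‖ₑ ^ 2 ≤ ‖f₀ k‖ₑ ^ 2 := by
    intro k
    by_cases hk : k ∈ D
    · exact (hlt k hk).le
    · rw [indicator_of_notMem hk]; simp
  have hfin : ∫⁻ k, ‖R‖ₑ ^ 2 * ‖D.indicator T k‖ₑ ^ 2 ∂c.β ≠ ⊤ := by
    refine ne_top_of_le_ne_top ?_ (lintegral_mono hle')
    rw [← e1]
    exact ENNReal.pow_ne_top enorm_ne_top
  -- The integrals are ordered opposite to the pointwise inequality, so the integrands agree almost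
  -- everywhere; on D they differ strictly, hence D is null.
  have heq := ae_eq_of_ae_le_of_lintegral_le (ae_of_all _ hle') hfin
    ((hf₀m.enorm.pow_const 2).aemeasurable) hle
  filter_upwards [heq, c.ae_mem_brillouin] with k hk hk𝔹
  by_contra hcon
  exact (hlt k ⟨hk𝔹, not_le.1 hcon⟩).ne hk

/-- Equivariance carries the bound from 𝔹 to almost every k in ℝ^d, and continuity in k then gives
it at every k. -/
theorem IsGapped.bound (hH : c.IsGapped H₀ h μ P) {z : ℂ} (hz : z ∈ resolventSet H₀) (k : Space d)
    (u : GraphDomain (h 0)) : ‖GraphDomain.incl (h 0) u‖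
      ≤ ‖resolvent H₀ z‖ * ‖hH.fib k u - z • GraphDomain.incl (h 0) u‖ := by
  set i := GraphDomain.incl (h 0)
  have h1 : ∀ᵐ k, ‖i u‖ ≤ ‖resolvent H₀ z‖ * ‖hH.fib k u - z • i u‖ := by
    refine c.ae_of_ae_translates fun κ hκ => ?_
    obtain ⟨u', hu', hfu'⟩ := hH.exists_rho (c.neg_mem_dualLattice hκ) u
    filter_upwards [hH.ae_bound hz u'] with k hk
    have h2 := hfu' (k + κ)
    rw [add_neg_cancel_right] at h2
    rwa [hu', h2, ← map_smul, ← map_sub, LinearIsometry.norm_map, LinearIsometry.norm_map] at hk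
  have hc : Continuous fun k => ‖resolvent H₀ z‖ * ‖hH.fib k u - z • i u‖ :=
    continuous_const.mul
      ((hH.contDiff_fib.continuous.clm_apply continuous_const).sub continuous_const).norm
  have hcl : IsClosed {k | ‖i u‖ ≤ ‖resolvent H₀ z‖ * ‖hH.fib k u - z • i u‖} :=
    isClosed_le continuous_const hc
  have h2 : {k | ‖i u‖ ≤ ‖resolvent H₀ z‖ * ‖hH.fib k u - z • i u‖}ᶜ = ∅ :=
    hcl.isOpen_compl.eq_empty_of_measure_zero (μ := volume) h1
  have h3 := (compl_empty_iff.1 h2).symm ▸ mem_univ k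
  exact h3

theorem IsGapped.mem_resolventSet_fibre (hH : c.IsGapped H₀ h μ P) {z : ℂ}
    (hz : z ∈ resolventSet H₀) (k : Space d) : z ∈ resolventSet (h k) := by
  refine mem_resolventSet_of_bounds (hH.fibre_selfAdjoint k) (M := ‖resolvent H₀ z‖)
    (M' := ‖resolvent H₀ (starRingEnd ℂ z)‖) (fun v => ?_) (fun v => ?_)
  · obtain ⟨u, h1, h2⟩ := hH.exists_incl_eq v
    rw [← h1, ← h2]
    exact hH.bound hz k u
  · obtain ⟨u, h1, h2⟩ := hH.exists_incl_eq v
    rw [← h1, ← h2]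
    exact hH.bound (conj_mem_resolventSet hH.selfAdjoint hz) k u

theorem IsGapped.bijective_fib_sub (hH : c.IsGapped H₀ h μ P) {z : ℂ} (hz : z ∈ resolventSet H₀)
    (k : Space d) : Function.Bijective (hH.fib k - z • GraphDomain.incl (h 0)) := by
  constructor
  · rw [injective_iff_map_eq_zero]
    intro u hu
    have h1 := hH.bound hz k u
    have h2 : hH.fib k u - z • GraphDomain.incl (h 0) u = 0 := hu
    rw [h2, norm_zero, mul_zero, norm_le_zero_iff] at h1
    exact GraphDomain.incl_injective (h 0) (h1.trans (map_zero _).symm)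
  · intro v
    obtain ⟨hd, he⟩ := (isResolventAt_resolvent (hH.mem_resolventSet_fibre hz k)).1 v
    obtain ⟨u, h1, h2⟩ := hH.exists_incl_eq ⟨_, hd⟩
    refine ⟨u, ?_⟩
    change hH.fib k u - z • GraphDomain.incl (h 0) u = v
    rw [h1, h2]
    exact he

/-- The fibre `(h(k) - z)⁻¹ ∈ 𝓛(𝓗_f, 𝓓_f)` of the resolvent. -/
def IsGapped.fibResolvent (hH : c.IsGapped H₀ h μ P) (k : Space d) (z : ℂ) :
    c.Hf →L[ℂ] GraphDomain (h 0) :=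
  ContinuousLinearMap.inverse (hH.fib k - z • GraphDomain.incl (h 0))

theorem IsGapped.exists_equiv (hH : c.IsGapped H₀ h μ P) {z : ℂ} (hz : z ∈ resolventSet H₀)
    (k : Space d) : ∃ e : GraphDomain (h 0) ≃L[ℂ] c.Hf,
      (e : GraphDomain (h 0) →L[ℂ] c.Hf) = hH.fib k - z • GraphDomain.incl (h 0) := by
  have := hH.completeSpace
  have hb := hH.bijective_fib_sub hz k
  exact ⟨ContinuousLinearEquiv.ofBijective (hH.fib k - z • GraphDomain.incl (h 0))
    (LinearMap.ker_eq_bot.2 hb.1) (LinearMap.range_eq_top.2 hb.2),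
    ContinuousLinearEquiv.coe_ofBijective _ _ _⟩

theorem IsGapped.fib_fibResolvent (hH : c.IsGapped H₀ h μ P) {z : ℂ} (hz : z ∈ resolventSet H₀)
    (k : Space d) (v : c.Hf) : hH.fib k (hH.fibResolvent k z v)
      - z • GraphDomain.incl (h 0) (hH.fibResolvent k z v) = v := by
  obtain ⟨e, he⟩ := hH.exists_equiv hz k
  have h1 : hH.fibResolvent k z = (e.symm : c.Hf →L[ℂ] GraphDomain (h 0)) := by
    rw [fibResolvent, ← he, ContinuousLinearMap.inverse_equiv]
  have h2 : (hH.fib k - z • GraphDomain.incl (h 0)) (e.symm v) = v := by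
    rw [← he]; exact e.apply_symm_apply v
  rw [h1]
  exact h2

/-- Inversion is smooth at invertible maps between Banach spaces, and 𝓓_f is complete because h(0)
is closed. Joint smoothness in (k, z) is what the contour integrals need. -/
theorem IsGapped.contDiffAt_fibResolvent (hH : c.IsGapped H₀ h μ P) {z : ℂ}
    (hz : z ∈ resolventSet H₀) (k : Space d) :
    ContDiffAt ℝ ∞ (fun p : Space d × ℂ => hH.fibResolvent p.1 p.2) (k, z) := by
  have := hH.completeSpace
  obtain ⟨e, he⟩ := hH.exists_equiv hz k
  have h1 : ContDiff ℝ ∞ fun p : Space d × ℂ => hH.fib p.1 - p.2 • GraphDomain.incl (h 0) :=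
    (hH.contDiff_fib.comp contDiff_fst).sub (contDiff_snd.smul contDiff_const)
  have h2 : ContDiffAt ℝ ∞ (ContinuousLinearMap.inverse :
      (GraphDomain (h 0) →L[ℂ] c.Hf) → c.Hf →L[ℂ] GraphDomain (h 0))
      (hH.fib k - z • GraphDomain.incl (h 0)) := by
    rw [← he]
    exact (contDiffAt_map_inverse (𝕜 := ℂ) (n := ∞) e).restrict_scalars ℝ
  exact ContDiffAt.comp (k, z) h2 h1.contDiffAt

theorem IsGapped.contDiff_fibResolvent (hH : c.IsGapped H₀ h μ P) {z : ℂ}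
    (hz : z ∈ resolventSet H₀) : ContDiff ℝ ∞ fun k => hH.fibResolvent k z := by
  rw [contDiff_iff_contDiffAt]
  intro k
  exact ContDiffAt.comp (f := fun k : Space d => (k, z)) k (hH.contDiffAt_fibResolvent hz k)
    (contDiff_id.prodMk contDiff_const).contDiffAt

theorem IsGapped.equivariant_fibResolvent (hH : c.IsGapped H₀ h μ P) {z : ℂ}
    (hz : z ∈ resolventSet H₀) :
    Equivariant fun k => GraphDomain.incl (h 0) ∘L hH.fibResolvent k z := by
  intro κ hκ k v
  obtain ⟨u', h1, h2⟩ := hH.exists_rho hκ (hH.fibResolvent k z v)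
  have h3 : hH.fibResolvent (k + κ) z (c.rho κ v) = u' := by
    apply (hH.bijective_fib_sub hz (k + κ)).1
    refine (hH.fib_fibResolvent hz (k + κ) _).trans ?_
    change _ = hH.fib (k + κ) u' - z • GraphDomain.incl (h 0) u'
    rw [h1, h2, ← map_smul, ← map_sub, hH.fib_fibResolvent hz]
  change GraphDomain.incl (h 0) (hH.fibResolvent (k + κ) z (c.rho κ v)) = _
  rw [h3, h1]
  rfl

/-! ### Smooth families with values in the domain -/

/-- `b` is an equivariant family with a smooth lift to `𝓛(𝓗_f, V)`. -/
def SmoothInto {V : Type} [NormedAddCommGroup V] [NormedSpace ℂ V] (i : V →L[ℂ] c.Hf)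
    (b : c.Fam) (bV : Space d → c.Hf →L[ℂ] V) : Prop :=
  Equivariant b ∧ ContDiff ℝ ∞ bV ∧ ∀ k, i ∘L bV k = b k

theorem SmoothInto.contDiff {V : Type} [NormedAddCommGroup V] [NormedSpace ℂ V]
    {i : V →L[ℂ] c.Hf} {b : c.Fam} {bV : Space d → c.Hf →L[ℂ] V} (hb : SmoothInto i b bV) :
    ContDiff ℝ ∞ b := by
  rw [← funext hb.2.2]
  exact contDiff_comp contDiff_const hb.2.1

theorem exists_resolventFam (hH : c.IsGapped H₀ h μ P) : ∃ g : ℂ → c.Fam, ∀ z ∈ resolventSet H₀,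
    SmoothInto (GraphDomain.incl (h 0)) (g z) fun k => hH.fibResolvent k z := by
  have h1 : ∀ z, ∃ b : c.Fam, z ∈ resolventSet H₀ →
      SmoothInto (GraphDomain.incl (h 0)) b fun k => hH.fibResolvent k z := by
    intro z
    by_cases hz : z ∈ resolventSet H₀
    · have h2 := hH.contDiff_fibResolvent hz
      exact ⟨fam _ (contDiff_comp (contDiff_const (c := GraphDomain.incl (h 0))) h2).continuous
        (hH.equivariant_fibResolvent hz),
        fun _ => ⟨hH.equivariant_fibResolvent hz, h2, fun k => rfl⟩⟩
    · exact ⟨0, fun hz' => absurd hz' hz⟩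
  choose g hg using h1
  exact ⟨g, hg⟩

/-- The family of fibres of the resolvent. -/
def IsGapped.resolventFam (hH : c.IsGapped H₀ h μ P) : ℂ → c.Fam := (exists_resolventFam hH).choose

theorem IsGapped.smoothInto_resolventFam (hH : c.IsGapped H₀ h μ P) {z : ℂ}
    (hz : z ∈ resolventSet H₀) : SmoothInto (GraphDomain.incl (h 0)) (hH.resolventFam z)
      fun k => hH.fibResolvent k z :=
  (exists_resolventFam hH).choose_spec z hz

/-- `op b` maps into the domain of `H₀` if `b` lifts to the domain of the fibres, and `H₀ op b` is
the operator with the fibres `h(k) b(k)`. -/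
theorem IsGapped.map_op (hH : c.IsGapped H₀ h μ P) {b : c.Fam}
    {bD : Space d → c.Hf →L[ℂ] GraphDomain (h 0)}
    (hb : SmoothInto (GraphDomain.incl (h 0)) b bD) {b' : c.Fam}
    (hb' : ∀ k, b' k = hH.fib k ∘L bD k) (ψ : c.H) :
    ∃ hd : c.op b ψ ∈ H₀.domain, H₀ ⟨c.op b ψ, hd⟩ = c.op b' ψ := by
  obtain ⟨φ, hφ⟩ := c.exists_isBFZ ψ
  have h1 := hφ.op hb.1
  have h2 : ∀ k, GraphDomain.incl (h 0) (bD k (φ k)) = b k (φ k) := fun k => by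
    rw [← hb.2.2 k]; rfl
  obtain ⟨B, hB⟩ := c.isCompact_closure_brillouin.exists_bound_of_continuousOn
    hb.2.1.continuous.continuousOn
  have hm : AEStronglyMeasurable (fun k => bD k (φ k)) c.β := by
    have h3 : AEStronglyMeasurable (fun k => (bD k, φ k)) c.β :=
      hb.2.1.continuous.aestronglyMeasurable.prodMk hφ.memLp.1
    exact (isBoundedBilinearMap_apply (𝕜 := ℂ) (E := c.Hf) (F := GraphDomain (h 0))).continuous
      |>.comp_aestronglyMeasurable h3
  have hL : MemLp (fun k => bD k (φ k)) 2 c.β := by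
    refine hφ.memLp.of_le_mul (c := B) hm ?_
    filter_upwards [c.ae_mem_brillouin] with k hk
    exact ((bD k).le_opNorm _).trans
      (mul_le_mul_of_nonneg_right (hB k (subset_closure hk)) (norm_nonneg _))
  have hf := hH.isFibration_fib _ _ h1
  have hd := hf.1.2 ⟨fun k => bD k (φ k), c.memLp_β_iff.1 hL, ae_of_all _ h2⟩
  refine ⟨hd, ?_⟩
  have h3 := hf.2 hd (fun k => bD k (φ k)) (ae_of_all _ h2)
  refine c.bfz.injective (Lp.ext ?_)
  filter_upwards [h3.ae_eq_bfz, coeFn_bfz_op b' ψ, hφ.ae_eq_bfz] with k e1 e2 e3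
  rw [e2, ← e1, ← e3, hb']
  rfl

/-- The fibres satisfy h(k)g(k) = z g(k) + 1, so H₀ op(g) = z op(g) + 1, and applying the resolvent
of H₀ identifies op(g). -/
theorem IsGapped.op_resolventFam (hH : c.IsGapped H₀ h μ P) {z : ℂ} (hz : z ∈ resolventSet H₀) :
    c.op (hH.resolventFam z) = resolvent H₀ z := by
  have hs := hH.smoothInto_resolventFam hz
  refine ContinuousLinearMap.ext fun ψ => ?_
  obtain ⟨hd, he⟩ := hH.map_op hs (b' := z • hH.resolventFam z + 1) (fun k => by
    refine ContinuousLinearMap.ext fun v => ?_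
    have h1 := hH.fib_fibResolvent hz k v
    rw [sub_eq_iff_eq_add] at h1
    change z • hH.resolventFam z k v + v = hH.fib k (hH.fibResolvent k z v)
    rw [h1, ← hs.2.2 k, add_comm]
    rfl) ψ
  have h1 := (isResolventAt_resolvent hz).2 ⟨_, hd⟩
  rw [he, map_add, map_smul, map_one] at h1
  refine Eq.trans h1.symm (congrArg _ ?_)
  change z • c.op (hH.resolventFam z) ψ + ψ - z • c.op (hH.resolventFam z) ψ = ψ
  abel

/-- `op` is injective on equivariant families, so the resolvent identity for H₀ pulls back to the
families and yields continuity in z for the supremum norm over k. -/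
theorem IsGapped.continuousOn_resolventFam (hH : c.IsGapped H₀ h μ P) :
    ContinuousOn hH.resolventFam (resolventSet H₀) := by
  refine continuousOn_of_resolvent_identity (𝒜 := c.Fam) fun z hz w hw => ?_
  have h1 := (hH.smoothInto_resolventFam hz).1
  have h2 := (hH.smoothInto_resolventFam hw).1
  refine op_injective (h1.sub h2) ((h1.mul h2).smul _) ?_
  rw [map_sub, map_smul, map_mul, hH.op_resolventFam hz, hH.op_resolventFam hw, resolvent_sub hz hw]

end Gapped

end Crystal

/-! ### Commutators of symmetric operators on a core -/

section Core

variable {𝓗 : Type*} [NormedAddCommGroup 𝓗] [InnerProductSpace ℂ 𝓗] [CompleteSpace 𝓗]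
  {A : 𝓗 →ₗ.[ℂ] 𝓗} {B W : 𝓗 →L[ℂ] 𝓗}

theorem inner_comm_skew (hA : ∀ x y : A.domain, ⟪A x, (y : 𝓗)⟫_ℂ = ⟪(x : 𝓗), A y⟫_ℂ)
    (hB : IsSelfAdjoint B) (x y : (comm A B).domain) :
    ⟪comm A B x, (y : 𝓗)⟫_ℂ = -⟪(x : 𝓗), comm A B y⟫_ℂ := by
  have hBs : ∀ u v : 𝓗, ⟪B u, v⟫_ℂ = ⟪u, B v⟫_ℂ := fun u v =>
    ContinuousLinearMap.isSelfAdjoint_iff_isSymmetric.1 hB u v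
  have h1 := hA ⟨B x, x.2.2⟩ ⟨y, y.2.1⟩
  have h2 := hA ⟨x, x.2.1⟩ ⟨B y, y.2.2⟩
  change ⟪A ⟨B x, x.2.2⟩ - B (A ⟨x, x.2.1⟩), (y : 𝓗)⟫_ℂ
    = -⟪(x : 𝓗), A ⟨B y, y.2.2⟩ - B (A ⟨y, y.2.1⟩)⟫_ℂ
  rw [inner_sub_left, inner_sub_right, hBs, h1, h2, hBs]
  ring

theorem skew_of_core (hA : ∀ x y : A.domain, ⟪A x, (y : 𝓗)⟫_ℂ = ⟪(x : 𝓗), A y⟫_ℂ)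
    (hB : IsSelfAdjoint B) {S : Submodule ℂ 𝓗} (hS : Dense (S : Set 𝓗))
    (hSd : S ≤ (comm A B).domain) (hW : ∀ x (hx : x ∈ S), comm A B ⟨x, hSd hx⟩ = W x) (x y : 𝓗) :
    ⟪W x, y⟫_ℂ = -⟪x, W y⟫_ℂ := by
  have h1 : ∀ y ∈ S, ∀ x, ⟪W x, y⟫_ℂ = -⟪x, W y⟫_ℂ := by
    intro y hy
    refine fun x => congrFun (Continuous.ext_on hS (f := fun x => ⟪W x, y⟫_ℂ)
      (g := fun x => -⟪x, W y⟫_ℂ) (by fun_prop) (by fun_prop) fun x hx => ?_) x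
    simp only
    rw [← hW x hx, ← hW y hy]
    exact inner_comm_skew hA hB ⟨x, hSd hx⟩ ⟨y, hSd hy⟩
  exact congrFun (Continuous.ext_on hS (f := fun y => ⟪W x, y⟫_ℂ) (g := fun y => -⟪x, W y⟫_ℂ)
    (by fun_prop) (by fun_prop) fun y hy => h1 y hy x) y

/-- Pairing with y in the dense core moves the commutator onto y by skew-symmetry, where it is W;
skew-symmetry of W moves it back. Thus the commutator on its natural domain is a restriction of the
same bounded operator. -/
theorem comm_eq_of_core (hA : ∀ x y : A.domain, ⟪A x, (y : 𝓗)⟫_ℂ = ⟪(x : 𝓗), A y⟫_ℂ)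
    (hB : IsSelfAdjoint B) {S : Submodule ℂ 𝓗} (hS : Dense (S : Set 𝓗))
    (hSd : S ≤ (comm A B).domain) (hW : ∀ x (hx : x ∈ S), comm A B ⟨x, hSd hx⟩ = W x)
    (x : (comm A B).domain) : comm A B x = W x := by
  refine hS.eq_of_inner_left ℂ fun y hy => ?_
  rw [inner_comm_skew hA hB x ⟨y, hSd hy⟩, hW y hy, skew_of_core hA hB hS hSd hW]

theorem closure_comm_domRestrict {S : Submodule ℂ 𝓗} (hS : Dense (S : Set 𝓗))
    (hSd : S ≤ (comm A B).domain) (hW : ∀ x (hx : x ∈ S), comm A B ⟨x, hSd hx⟩ = W x) :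
    ((comm A B).domRestrict S).closure = full W := by
  refine closure_eq_full ?_ W fun ψ => ?_
  · refine hS.mono fun x hx => ?_
    exact ⟨hx, hSd hx⟩
  · exact hW ψ ψ.2.1

end Core

namespace Crystal

variable {d N : ℕ} {c : Crystal d N}

section Gapped

variable {H₀ : c.H →ₗ.[ℂ] c.H} {h : Space d → c.Hf →ₗ.[ℂ] c.Hf} {μ : ℝ} {P : c.H →L[ℂ] c.H}

/-! ### Fibres of contour integrals -/

theorem equivariant_integral {C : ℝ → ℂ} {L : ℝ≥0} (hC : LipschitzOnWith L C (Icc 0 1))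
    {F : ℝ → c.Fam} (hF : ContinuousOn F (Icc 0 1)) (hE : ∀ t ∈ Icc (0 : ℝ) 1, Equivariant (F t)) :
    Equivariant (∫ t in (0 : ℝ)..1, deriv C t • F t : c.Fam) := by
  intro κ hκ k u
  have hint := intervalIntegrable_deriv_smul (V := c.Fam) hC hF
  set L₁ : c.Fam →L[ℂ] c.Hf := (ContinuousLinearMap.apply ℂ c.Hf (c.rho κ u)).comp
    (BoundedContinuousFunction.evalCLM ℂ (k + κ))
  set L₂ : c.Fam →L[ℂ] c.Hf := (c.rho κ).toContinuousLinearMap.comp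
    ((ContinuousLinearMap.apply ℂ c.Hf u).comp (BoundedContinuousFunction.evalCLM ℂ k))
  change L₁ (∫ t in (0 : ℝ)..1, deriv C t • F t) = L₂ (∫ t in (0 : ℝ)..1, deriv C t • F t)
  refine (ContinuousLinearMap.intervalIntegral_comp_comm (𝕜 := ℂ) (E := c.Fam) (F := c.Hf) L₁ hint).symm.trans
    (Eq.trans ?_ (ContinuousLinearMap.intervalIntegral_comp_comm (𝕜 := ℂ) (E := c.Fam) (F := c.Hf) L₂ hint))
  refine intervalIntegral.integral_congr fun t ht => ?_
  rw [uIcc_of_le zero_le_one] at ht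
  simp only [map_smul]
  congr 1
  exact hE t ht κ hκ k u

/-- The integral is taken twice: in the algebra of families, where `op` can be applied to it, and
for each k in 𝓛(𝓗_f, V), where it is smooth. Evaluation at k and composition with i commute with
integration and identify the two. -/
theorem smoothInto_contourIntegral {V : Type} [NormedAddCommGroup V] [NormedSpace ℂ V]
    [CompleteSpace V] {i : V →L[ℂ] c.Hf} {C : ℝ → ℂ} {L : ℝ≥0}
    (hC : LipschitzOnWith L C (Icc 0 1)) {F : ℝ → c.Fam} (hF : ContinuousOn F (Icc 0 1))
    (hE : ∀ t ∈ Icc (0 : ℝ) 1, Equivariant (F t)) {G : Space d × ℂ → c.Hf →L[ℂ] V}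
    (hG : ∀ k, ∀ t ∈ Icc (0 : ℝ) 1, ContDiffAt ℝ ∞ G (k, C t))
    (hFG : ∀ k, ∀ t ∈ Icc (0 : ℝ) 1, i ∘L G (k, C t) = F t k) :
    SmoothInto i (∫ t in (0 : ℝ)..1, deriv C t • F t : c.Fam)
      fun k => ∫ t in (0 : ℝ)..1, deriv C t • G (k, C t) := by
  refine ⟨equivariant_integral hC hF hE, contDiff_contourIntegral hC hG, fun k => ?_⟩
  have h1 : ContinuousOn (fun t => G (k, C t)) (Icc 0 1) := by
    intro t ht
    exact (hG k t ht).continuousAt.comp_continuousWithinAt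
      (f := fun t => (k, C t)) (continuousWithinAt_const.prodMk (hC.continuousOn t ht))
  set L₁ : (c.Hf →L[ℂ] V) →L[ℂ] (c.Hf →L[ℂ] c.Hf) := ContinuousLinearMap.compL ℂ c.Hf V c.Hf i
  set L₂ : c.Fam →L[ℂ] (c.Hf →L[ℂ] c.Hf) := BoundedContinuousFunction.evalCLM ℂ k
  change L₁ (∫ t in (0 : ℝ)..1, deriv C t • G (k, C t)) = L₂ (∫ t in (0 : ℝ)..1, deriv C t • F t)
  have e1 := L₁.intervalIntegral_comp_comm (intervalIntegrable_deriv_smul hC h1)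
  have e2 := ContinuousLinearMap.intervalIntegral_comp_comm (𝕜 := ℂ) (E := c.Fam)
    (F := c.Hf →L[ℂ] c.Hf) L₂ (intervalIntegrable_deriv_smul (V := c.Fam) hC hF)
  refine e1.symm.trans (Eq.trans ?_ e2)
  refine intervalIntegral.integral_congr fun t ht => ?_
  rw [uIcc_of_le zero_le_one] at ht
  simp only [map_smul]
  congr 1
  exact hFG k t ht

theorem op_contourIntegral {C : ℝ → ℂ} {L : ℝ≥0} (hC : LipschitzOnWith L C (Icc 0 1))
    {F : ℝ → c.Fam} (hF : ContinuousOn F (Icc 0 1)) :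
    c.op (∫ t in (0 : ℝ)..1, deriv C t • F t) = ∫ t in (0 : ℝ)..1, deriv C t • c.op (F t) := by
  set L₁ : c.Fam →L[ℂ] (c.H →L[ℂ] c.H) := ⟨c.op.toLinearMap, c.continuous_op⟩
  have h1 := ContinuousLinearMap.intervalIntegral_comp_comm (𝕜 := ℂ) (E := c.Fam)
    (F := c.H →L[ℂ] c.H) L₁ (intervalIntegrable_deriv_smul (V := c.Fam) hC hF)
  refine h1.symm.trans (intervalIntegral.integral_congr fun t _ => ?_)
  exact map_smul L₁ _ _

theorem SmoothInto.const_smul {V : Type} [NormedAddCommGroup V] [NormedSpace ℂ V]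
    {i : V →L[ℂ] c.Hf} {b : c.Fam} {bV : Space d → c.Hf →L[ℂ] V} (hb : SmoothInto i b bV) (z : ℂ) :
    SmoothInto i (z • b) fun k => z • bV k :=
  ⟨hb.1.smul z, hb.2.1.const_smul z, fun k => by
    rw [ContinuousLinearMap.comp_smul, hb.2.2 k]; rfl⟩

theorem continuousOn_mul_mul {X 𝔸 : Type*} [TopologicalSpace X] [NormedRing 𝔸] {r : X → 𝔸}
    {s : Set X} (hr : ContinuousOn r s) (q : 𝔸) : ContinuousOn (fun t => r t * q * r t) s :=
  (hr.mul continuousOn_const).mul hr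

theorem IsGapped.exists_rieszIntegral_eq_op (hH : c.IsGapped H₀ h μ P) {C : ℝ → ℂ}
    (hC : IsContour H₀ μ C) : ∃ b bD, SmoothInto (GraphDomain.incl (h 0)) b bD ∧
      c.op b = rieszIntegral H₀ C := by
  have := hH.completeSpace
  obtain ⟨L, hL⟩ := hC.lipschitz
  have hF : ContinuousOn (fun t => hH.resolventFam (C t)) (Icc 0 1) :=
    hH.continuousOn_resolventFam.comp hL.continuousOn hC.mem_resolventSet
  have hs := smoothInto_contourIntegral (i := GraphDomain.incl (h 0)) hL hF
    (fun t ht => (hH.smoothInto_resolventFam (hC.mem_resolventSet t ht)).1)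
    (G := fun p => hH.fibResolvent p.1 p.2)
    (fun k t ht => hH.contDiffAt_fibResolvent (hC.mem_resolventSet t ht) k)
    (fun k t ht => (hH.smoothInto_resolventFam (hC.mem_resolventSet t ht)).2.2 k)
  refine ⟨_, _, hs.const_smul (Complex.I / (2 * Real.pi)), ?_⟩
  rw [map_smul, op_contourIntegral hL hF, rieszIntegral]
  congr 1
  refine intervalIntegral.integral_congr fun t ht => ?_
  rw [uIcc_of_le zero_le_one] at ht
  simp only [hH.op_resolventFam (hC.mem_resolventSet t ht)]

theorem IsGapped.exists_sandwich_eq_op (hH : c.IsGapped H₀ h μ P) {C : ℝ → ℂ}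
    (hC : IsContour H₀ μ C) {q : c.Fam} (hq : Equivariant q) (hqs : ContDiff ℝ ∞ q) :
    ∃ b bD, SmoothInto (GraphDomain.incl (h 0)) b bD ∧
      c.op b = sandwich H₀ C (c.op q) := by
  have := hH.completeSpace
  obtain ⟨L, hL⟩ := hC.lipschitz
  have hR : ContinuousOn (fun t => hH.resolventFam (C t)) (Icc 0 1) :=
    hH.continuousOn_resolventFam.comp hL.continuousOn hC.mem_resolventSet
  have hF : ContinuousOn (fun t => hH.resolventFam (C t) * q * hH.resolventFam (C t)) (Icc 0 1) :=
    continuousOn_mul_mul hR q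
  have hsi := fun t ht => hH.smoothInto_resolventFam (hC.mem_resolventSet t ht)
  have hs := smoothInto_contourIntegral (i := GraphDomain.incl (h 0)) hL hF
    (fun t ht => ((hsi t ht).1.mul hq).mul (hsi t ht).1)
    (G := fun p => (hH.fibResolvent p.1 p.2).comp
      ((q p.1).comp ((GraphDomain.incl (h 0)).comp (hH.fibResolvent p.1 p.2))))
    (fun k t ht => by
      have h1 := hH.contDiffAt_fibResolvent (hC.mem_resolventSet t ht) k
      have h2 : ContDiffAt ℝ ∞ (fun p : Space d × ℂ => q p.1) (k, C t) :=
        (hqs.comp contDiff_fst).contDiffAt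
      exact contDiffAt_comp h1 (contDiffAt_comp h2 (contDiffAt_comp contDiffAt_const h1)))
    (fun k t ht => by
      have h1 := (hsi t ht).2.2 k
      change _ = hH.resolventFam (C t) k * q k * hH.resolventFam (C t) k
      rw [← h1]
      rfl)
  refine ⟨_, _, hs.const_smul (Complex.I / (2 * Real.pi)), ?_⟩
  rw [map_smul, op_contourIntegral hL hF, sandwich]
  congr 1
  refine intervalIntegral.integral_congr fun t ht => ?_
  rw [uIcc_of_le zero_le_one] at ht
  simp only [map_mul, hH.op_resolventFam (hC.mem_resolventSet t ht)]

/-! ### Products with the Hamiltonian -/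

theorem IsGapped.equivariant_fib_comp (hH : c.IsGapped H₀ h μ P) {b : c.Fam}
    {bD : Space d → c.Hf →L[ℂ] GraphDomain (h 0)}
    (hb : SmoothInto (GraphDomain.incl (h 0)) b bD) : Equivariant fun k => hH.fib k ∘L bD k := by
  intro κ hκ k u
  obtain ⟨u', h1, h2⟩ := hH.exists_rho hκ (bD k u)
  have h3 : ∀ k u, GraphDomain.incl (h 0) (bD k u) = b k u := fun k u => by
    rw [← hb.2.2 k]; rfl
  have h4 : bD (k + κ) (c.rho κ u) = u' := by
    apply GraphDomain.incl_injective (h 0)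
    rw [h3, hb.1 κ hκ, h1, h3]
  change hH.fib (k + κ) (bD (k + κ) (c.rho κ u)) = _
  rw [h4, h2]
  rfl

theorem IsGapped.contDiff_fib_comp (hH : c.IsGapped H₀ h μ P) {b : c.Fam}
    {bD : Space d → c.Hf →L[ℂ] GraphDomain (h 0)}
    (hb : SmoothInto (GraphDomain.incl (h 0)) b bD) : ContDiff ℝ ∞ fun k => hH.fib k ∘L bD k :=
  contDiff_comp hH.contDiff_fib hb.2.1

/-- The fibres of `H₀ op b`. -/
def IsGapped.fibFam (hH : c.IsGapped H₀ h μ P) {b : c.Fam}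
    {bD : Space d → c.Hf →L[ℂ] GraphDomain (h 0)}
    (hb : SmoothInto (GraphDomain.incl (h 0)) b bD) : c.Fam :=
  fam _ (hH.contDiff_fib_comp hb).continuous (hH.equivariant_fib_comp hb)

theorem IsGapped.map_op_fibFam (hH : c.IsGapped H₀ h μ P) {b : c.Fam}
    {bD : Space d → c.Hf →L[ℂ] GraphDomain (h 0)}
    (hb : SmoothInto (GraphDomain.incl (h 0)) b bD) (ψ : c.H) :
    ∃ hd : c.op b ψ ∈ H₀.domain, H₀ ⟨c.op b ψ, hd⟩ = c.op (hH.fibFam hb) ψ :=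
  hH.map_op hb (fun _ => rfl) ψ

/-- For B = op b self-adjoint, BH₀ is a restriction of (H₀B)*, and H₀B is bounded. This makes both
halves of [H₀, B] bounded and fibred. -/
theorem IsGapped.op_map (hH : c.IsGapped H₀ h μ P) {b : c.Fam}
    {bD : Space d → c.Hf →L[ℂ] GraphDomain (h 0)}
    (hb : SmoothInto (GraphDomain.incl (h 0)) b bD) (hbs : IsSelfAdjoint (c.op b))
    (ψ : H₀.domain) : c.op b (H₀ ψ) = c.op (star (hH.fibFam hb)) ψ := by
  refine ext_inner_right ℂ fun χ => ?_
  obtain ⟨hd, he⟩ := hH.map_op_fibFam hb χ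
  have h1 := inner_map_selfAdjoint hH.selfAdjoint ψ ⟨_, hd⟩
  rw [he] at h1
  rw [op_star, ContinuousLinearMap.star_eq_adjoint, ContinuousLinearMap.adjoint_inner_left, ← h1]
  exact ContinuousLinearMap.isSelfAdjoint_iff_isSymmetric.1 hbs _ _

theorem IsGapped.resolvent_mul_fibFam (hH : c.IsGapped H₀ h μ P) {b : c.Fam}
    {bD : Space d → c.Hf →L[ℂ] GraphDomain (h 0)}
    (hb : SmoothInto (GraphDomain.incl (h 0)) b bD) :
    resolvent H₀ μ * c.op (hH.fibFam hb) = c.op b + (μ : ℂ) • (resolvent H₀ μ * c.op b) := by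
  refine ContinuousLinearMap.ext fun ψ => ?_
  obtain ⟨hd, he⟩ := hH.map_op_fibFam hb ψ
  have h1 := (isResolventAt_resolvent hH.gap).2 ⟨_, hd⟩
  rw [he, map_sub, map_smul, sub_eq_iff_eq_add] at h1
  exact h1

/-- With G the resolvent at μ, this is G[H₀, B]G = BG - GB, which reduces commutators with H₀ to
bounded algebra. -/
theorem IsGapped.resolvent_mul_sub_star_mul (hH : c.IsGapped H₀ h μ P) {b : c.Fam}
    {bD : Space d → c.Hf →L[ℂ] GraphDomain (h 0)}
    (hb : SmoothInto (GraphDomain.incl (h 0)) b bD) (hbs : IsSelfAdjoint (c.op b)) :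
    resolvent H₀ μ * (c.op (hH.fibFam hb) - c.op (star (hH.fibFam hb))) * resolvent H₀ μ
      = c.op b * resolvent H₀ μ - resolvent H₀ μ * c.op b := by
  have hG : IsSelfAdjoint (resolvent H₀ (μ : ℂ)) := isSelfAdjoint_resolvent hH.selfAdjoint hH.gap
  have h1 := hH.resolvent_mul_fibFam hb
  have h2 := congrArg star h1
  rw [star_mul, star_add, star_smul, star_mul, hG.star_eq, hbs.star_eq, ← op_star,
    Complex.star_def, Complex.conj_ofReal] at h2
  rw [mul_sub, sub_mul, h1, mul_assoc _ (c.op (star _)), h2, add_mul, mul_add, smul_mul_assoc,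
    mul_smul_comm, mul_assoc]
  abel

/-- G is injective, and being self-adjoint it can be cancelled on the right by taking adjoints. -/
theorem IsGapped.eq_zero_of_resolvent_mul_mul (hH : c.IsGapped H₀ h μ P) {X : c.H →L[ℂ] c.H}
    (hX : resolvent H₀ μ * X * resolvent H₀ μ = 0) : X = 0 := by
  have hG : IsSelfAdjoint (resolvent H₀ (μ : ℂ)) := isSelfAdjoint_resolvent hH.selfAdjoint hH.gap
  have hinj : ∀ Y : c.H →L[ℂ] c.H, resolvent H₀ μ * Y = 0 → Y = 0 := by
    intro Y hY
    refine ContinuousLinearMap.ext fun ψ => ?_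
    obtain ⟨hd, he⟩ := (isResolventAt_resolvent hH.gap).1 (Y ψ)
    have h1 : resolvent H₀ μ (Y ψ) = 0 := congrArg (fun A : c.H →L[ℂ] c.H => A ψ) hY
    have h2 : (⟨resolvent H₀ μ (Y ψ), hd⟩ : H₀.domain) = 0 := Subtype.ext h1
    rw [h2, h1, smul_zero, sub_zero, LinearPMap.map_zero] at he
    exact he.symm
  rw [mul_assoc] at hX
  have h3 := congrArg star (hinj _ hX)
  rw [star_mul, hG.star_eq, star_zero] at h3
  exact star_eq_zero.1 (hinj _ h3)

/-! ### The smooth core of the Hamiltonian -/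

theorem smoothCore_le {V : Type} [NormedAddCommGroup V] [NormedSpace ℂ V] (i : V →L[ℂ] c.Hf) :
    c.smoothCore i ≤ c.smoothCore (ContinuousLinearMap.id ℂ c.Hf) := by
  rintro ψ ⟨φ, h1, h2⟩
  exact ⟨fun k => i (φ k), (i.restrictScalars ℝ).contDiff.comp h1, h2⟩

theorem IsGapped.smoothCore_le_domain (hH : c.IsGapped H₀ h μ P) :
    c.smoothCore (GraphDomain.incl (h 0)) ≤ H₀.domain := by
  rintro ψ ⟨φ, h1, h2⟩
  refine (hH.isFibration_fib ψ _ h2).1.2 ⟨φ, c.memLp_β_iff.1 ?_, ae_of_all _ fun _ => rfl⟩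
  obtain ⟨B, hB⟩ := c.isCompact_closure_brillouin.exists_bound_of_continuousOn
    h1.continuous.continuousOn
  refine MemLp.of_bound h1.continuous.aestronglyMeasurable B ?_
  filter_upwards [c.ae_mem_brillouin] with k hk
  exact hB k (subset_closure hk)

/-- The resolvent has the dense domain of H₀ as its range, and its smooth fibres map smooth sections
of 𝓗_f to smooth sections of 𝓓_f. -/
theorem IsGapped.dense_smoothCore (hH : c.IsGapped H₀ h μ P) :
    Dense (c.smoothCore (GraphDomain.incl (h 0)) : Set c.H) := by
  have hr : DenseRange (resolvent H₀ (μ : ℂ)) := by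
    refine hH.selfAdjoint.dense_domain.mono fun ψ hψ => ?_
    exact ⟨_, (isResolventAt_resolvent hH.gap).2 ⟨ψ, hψ⟩⟩
  refine (hr.dense_image (resolvent H₀ (μ : ℂ)).continuous c.dense_smoothCore).mono ?_
  rintro _ ⟨ψ, hψ, rfl⟩
  have hs := hH.smoothInto_resolventFam hH.gap
  rw [← hH.op_resolventFam hH.gap]
  exact op_mem_smoothCore hs.1 hs.2.2 hs.2.1 hψ

end Gapped

/-! ### Conjugation by one-parameter groups -/

theorem exists_contDiff_conj_exp {V : Type} [NormedAddCommGroup V] [NormedSpace ℂ V]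
    [CompleteSpace V] {i : V →L[ℂ] c.Hf} {p s : c.Fam} {pV sV : Space d → c.Hf →L[ℂ] V}
    (hp : SmoothInto i p pV) (hs : SmoothInto i s sV) :
    ∃ F : ℝ × Space d → c.Hf →L[ℂ] V, ContDiff ℝ ∞ F ∧ ∀ ε : ℝ, ∀ k, i ∘L F (ε, k)
      = (NormedSpace.exp (-(Complex.I * ε) • s) * p * NormedSpace.exp ((Complex.I * ε) • s)) k := by
  have hz : ContDiff ℝ ∞ fun q : ℝ × Space d => Complex.I * (q.1 : ℂ) :=
    contDiff_const.mul (Complex.ofRealCLM.contDiff.comp contDiff_fst)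
  -- The left exponential must act inside V for the product to take values in V: on V it is the
  -- exponential of sV ∘ i in 𝓛(V). The right exponential acts on 𝓗_f.
  have h1 : ContDiff ℝ ∞ fun q : ℝ × Space d =>
      NormedSpace.exp (-(Complex.I * (q.1 : ℂ)) • (sV q.2 ∘L i)) :=
    contDiff_exp.comp (hz.neg.smul (contDiff_comp (hs.2.1.comp contDiff_snd) contDiff_const))
  have h2 : ContDiff ℝ ∞ fun q : ℝ × Space d =>
      NormedSpace.exp ((Complex.I * (q.1 : ℂ)) • s q.2) :=
    contDiff_exp.comp (hz.smul (hs.contDiff.comp contDiff_snd))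
  refine ⟨fun q => NormedSpace.exp (-(Complex.I * (q.1 : ℂ)) • (sV q.2 ∘L i)) ∘L
    (pV q.2 ∘L NormedSpace.exp ((Complex.I * (q.1 : ℂ)) • s q.2)),
    contDiff_comp h1 (contDiff_comp (hp.2.1.comp contDiff_snd) h2), fun ε k => ?_⟩
  have h3 : i ∘L (-(Complex.I * (ε : ℂ)) • (sV k ∘L i)) = (-(Complex.I * (ε : ℂ)) • s k) ∘L i := by
    rw [ContinuousLinearMap.comp_smul, ContinuousLinearMap.smul_comp, ← hs.2.2 k]
    rfl
  have h4 := comp_exp_of_intertwine i h3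
  rw [← ContinuousLinearMap.comp_assoc, h4, ContinuousLinearMap.comp_assoc,
    ← ContinuousLinearMap.comp_assoc i, hp.2.2 k]
  change _ = NormedSpace.exp (-(Complex.I * ε) • s) k * p k * NormedSpace.exp ((Complex.I * ε) • s) k
  rw [exp_fam_apply, exp_fam_apply]
  rfl

end Crystal

theorem hasDerivAt_conj_exp {𝔸 : Type*} [NormedRing 𝔸] [NormedAlgebra ℂ 𝔸] [CompleteSpace 𝔸]
    (p s : 𝔸) : HasDerivAt (fun ε : ℝ => NormedSpace.exp (-(Complex.I * ε) • s) * p *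
      NormedSpace.exp ((Complex.I * ε) • s)) (-Complex.I • (s * p - p * s)) 0 := by
  have h1 : ∀ x : 𝔸, HasDerivAt (fun ε : ℝ => NormedSpace.exp (ε • x)) x 0 := by
    intro x
    have := hasDerivAt_exp_smul_const (𝕂 := ℝ) x 0
    simpa using this
  have h2 := ((h1 (-Complex.I • s)).mul_const p).mul (h1 (Complex.I • s))
  have e : ∀ (ε : ℝ) (z : ℂ), ε • (z • s) = (z * ε) • s := fun ε z => by
    rw [← Complex.coe_smul, smul_smul, mul_comm]
  simp only [e, Complex.ofReal_zero, mul_zero, zero_smul, NormedSpace.exp_zero, mul_one, one_mul]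
    at h2
  simp only [neg_mul] at h2
  refine h2.congr_deriv ?_
  rw [smul_mul_assoc, mul_smul_comm, smul_sub, neg_smul, neg_smul]
  abel

/-- Multiplying the hypothesis by P on the left gives PKP = 0, and the double bracket then reduces
to KP + PK. -/
theorem lie_lie_of_offDiagonal {𝒜 : Type*} [Ring 𝒜] {P K : 𝒜} (hP : P * P = P)
    (hK : K * P + P * K = K) : ⁅⁅K, P⁆, P⁆ = K := by
  have h1 : P * K * P = 0 := by
    have h2 := congrArg (fun x => P * x) hK
    simp only [mul_add, ← mul_assoc, hP] at h2
    exact left_eq_add.1 (by rw [add_comm]; exact h2.symm)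
  have h3 : P * (K * P) = 0 := by rw [← mul_assoc, h1]
  rw [Ring.lie_def, Ring.lie_def, sub_mul, mul_sub, h3, h1, mul_assoc, hP, ← mul_assoc, hP, sub_zero,
    zero_sub, sub_neg_eq_add, hK]

/-! ### Commutators with the position operator, and Taylor remainders of smooth curves of families
-/

namespace Crystal

variable {d N : ℕ} {c : Crystal d N}

theorem op_sub (b b' : c.Fam) : c.op (b - b') = c.op b - c.op b' := by
  have h : b - b' + b' = b := by ext1 k; exact sub_add_cancel _ _
  rw [eq_sub_iff_add_eq, ← map_add c.op, h]

theorem op_smul (z : ℂ) (b : c.Fam) : c.op (z • b) = z • c.op b := map_smul c.op z b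

theorem op_mul (b b' : c.Fam) : c.op (b * b') = c.op b * c.op b' := map_mul c.op b b'

theorem op_zero : c.op (0 : c.Fam) = 0 := map_zero c.op

/-- The fibres of `[X_j, op b]`. -/
def posFam (j : Fin d) (b : c.Fam) (hb : ContDiff ℝ ∞ b) (he : Equivariant b) : c.Fam :=
  fam (posDeriv j b) (contDiff_posDeriv j hb).continuous (he.posDeriv j hb)

theorem comm_position_op (j : Fin d) {b : c.Fam} (hb : ContDiff ℝ ∞ b) (he : Equivariant b) :
    ∃ hle : c.smoothCore (ContinuousLinearMap.id ℂ c.Hf) ≤ (comm (c.position j) (c.op b)).domain,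
      ∀ ψ (hψ : ψ ∈ c.smoothCore (ContinuousLinearMap.id ℂ c.Hf)),
        comm (c.position j) (c.op b) ⟨ψ, hle hψ⟩ = c.op (posFam j b hb he) ψ :=
  ⟨fun _ hψ => ⟨smoothCore_le_position j hψ,
    smoothCore_le_position j (op_mem_smoothCore_id hb he hψ)⟩,
    fun _ hψ => position_op_sub j hb he (fun _ => rfl) hψ _ _⟩

/-- [X_j, ·] is a derivation; applied to b² = b on the smooth core, which b preserves, it yields the
identity there, and density extends it. -/
theorem op_posFam_offDiagonal (j : Fin d) {b : c.Fam} (hb : ContDiff ℝ ∞ b) (he : Equivariant b)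
    (hbb : c.op b * c.op b = c.op b) :
    c.op (posFam j b hb he) * c.op b + c.op b * c.op (posFam j b hb he)
      = c.op (posFam j b hb he) := by
  have hbb' : ∀ ψ, c.op b (c.op b ψ) = c.op b ψ := fun ψ => by
    rw [← mul_apply_eq_comp, hbb]
  have hmem := fun ψ hψ => smoothCore_le_position (c := c) (x := ψ) j hψ
  have hK := fun ψ hψ => position_op_sub (b' := posFam j b hb he) (ψ := ψ) j hb he (fun _ => rfl)
    hψ (hmem ψ hψ) (hmem _ (op_mem_smoothCore_id hb he hψ))
  refine ContinuousLinearMap.ext fun ψ => congrFun (Continuous.ext_on c.dense_smoothCore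
    (ContinuousLinearMap.continuous _) (ContinuousLinearMap.continuous _) fun ψ hψ => ?_) ψ
  have hbψ := op_mem_smoothCore_id hb he hψ
  have h3 : ∀ (x y : c.H) (hx : x ∈ (c.position j).domain) (hy : y ∈ (c.position j).domain),
      x = y → c.position j ⟨x, hx⟩ = c.position j ⟨y, hy⟩ := by
    rintro x _ hx _ rfl; rfl
  rw [add_apply, mul_apply_eq_comp, mul_apply_eq_comp, ← hK ψ hψ,
    ← hK _ hbψ, map_sub, hbb' (c.position j ⟨ψ, _⟩),
    h3 (c.op b (c.op b ψ)) (c.op b ψ) _ (hmem _ hbψ) (hbb' ψ)]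
  abel

theorem star_op_posFam (j : Fin d) {b : c.Fam} (hb : ContDiff ℝ ∞ b) (he : Equivariant b)
    (hbs : IsSelfAdjoint (c.op b)) :
    star (c.op (posFam j b hb he)) = -c.op (posFam j b hb he) := by
  obtain ⟨hle, hK⟩ := comm_position_op j hb he
  rw [ContinuousLinearMap.star_eq_adjoint]
  refine ContinuousLinearMap.ext fun ψ => ext_inner_right ℂ fun χ => ?_
  rw [ContinuousLinearMap.adjoint_inner_left, ← neg_eq_iff_eq_neg.2
    (skew_of_core (inner_position j) hbs c.dense_smoothCore hle hK ψ χ), neg_apply,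
    inner_neg_left]

/-- The second order remainder of a smooth curve of families. -/
theorem exists_remainder {V : Type} [NormedAddCommGroup V] [NormedSpace ℂ V] {i : V →L[ℂ] c.Hf}
    {F : ℝ × Space d → c.Hf →L[ℂ] V} (hF : ContDiff ℝ ∞ F) {f : ℝ → c.Fam}
    (hfe : ∀ ε, Equivariant (f ε)) (hFf : ∀ ε k, i ∘L F (ε, k) = f ε k) {b₀ b₁ : c.Fam}
    {b₀V b₁V : Space d → c.Hf →L[ℂ] V} (h₀ : SmoothInto i b₀ b₀V) (h₁ : SmoothInto i b₁ b₁V)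
    (hF₀ : ∀ k, F (0, k) = b₀V k) (hF₁ : ∀ k, fderiv ℝ F (0, k) (1, 0) = b₁V k) :
    ∃ r : ℝ → c.Fam,
      (∀ ε : ℝ, c.op (f ε) = c.op b₀ + (ε : ℂ) • c.op b₁ + (ε : ℂ) ^ 2 • c.op (r ε)) ∧
      ∃ B, ∀ ε ∈ Icc (0 : ℝ) 1,
        c.MemPLe (full (c.op (r ε))) (ContinuousLinearMap.id ℂ c.Hf) i B := by
  obtain ⟨B, hB0, hB⟩ := exists_taylor_bound hF c.isCompact_closure_brillouin
  -- The remainder is the Taylor defect divided by ε². At ε = 0 the inverse is 0, so the remainder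
  -- is 0 there, consistent with f(0) = b₀; only boundedness in ε is required.
  refine ⟨fun ε => ((ε : ℂ) ^ 2)⁻¹ • (f ε - b₀ - (ε : ℂ) • b₁), fun ε => ?_, B, fun ε hε => ?_⟩
  · by_cases hε : ε = 0
    · have h1 : f 0 = b₀ := by
        ext1 k
        rw [← hFf, hF₀, h₀.2.2]
      simp [hε, h1]
    · have h2 : (ε : ℂ) ^ 2 ≠ 0 := pow_ne_zero 2 (Complex.ofReal_ne_zero.2 hε)
      rw [op_smul, smul_smul, mul_inv_cancel₀ h2, one_smul, op_sub, op_sub, op_smul]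
      abel
  · refine memPLe_op (a := fun k => ((ε : ℂ) ^ 2)⁻¹ • (F (ε, k) - b₀V k - (ε : ℂ) • b₁V k))
      (((hfe ε).sub h₀.1).sub (h₁.1.smul _) |>.smul _) (fun k => ?_) ?_ fun k hk => ?_
    · rw [ContinuousLinearMap.comp_smul, ContinuousLinearMap.comp_sub, ContinuousLinearMap.comp_sub,
        ContinuousLinearMap.comp_smul, hFf, h₀.2.2, h₁.2.2]
      rfl
    · have h3 : ContDiff ℝ ∞ fun k => F (ε, k) := hF.comp (contDiff_const.prodMk contDiff_id)
      exact ((h3.sub h₀.2.1).sub (h₁.2.1.const_smul _)).const_smul _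
    · have h4 := hB ε hε k (subset_closure hk)
      rw [hF₀, hF₁, ← Complex.coe_smul] at h4
      rw [norm_smul, norm_inv, norm_pow, Complex.norm_real, Real.norm_eq_abs, sq_abs]
      by_cases hε0 : ε = 0
      · simpa [hε0] using hB0
      · rw [inv_mul_le_iff₀ (by positivity), mul_comm]
        exact h4

/-- The adjoint as a real linear map. -/
def adjointℝ : (c.Hf →L[ℂ] c.Hf) →L[ℝ] (c.Hf →L[ℂ] c.Hf) :=
  LinearMap.mkContinuous
    { toFun := fun A => star A
      map_add' := star_add
      map_smul' := fun r A => by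
        change ContinuousLinearMap.adjoint (((r : ℝ) : ℂ) • A) = ((r : ℝ) : ℂ) • _
        rw [map_smulₛₗ, Complex.conj_ofReal]
        rfl } 1 fun A => by
    rw [one_mul]
    exact (ContinuousLinearMap.adjoint.norm_map A).le

/-! ### The commutator with H₀ - ε X_j and its vanishing to second order -/

section Gapped

variable {H₀ : c.H →ₗ.[ℂ] c.H} {h : Space d → c.Hf →ₗ.[ℂ] c.Hf} {μ : ℝ} {P : c.H →L[ℂ] c.H}

/-- The fibres of `[H₀ - ε X_j, op b]`. -/
def IsGapped.commFam (hH : c.IsGapped H₀ h μ P) (j : Fin d) (ε : ℝ) {b : c.Fam}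
    {bD : Space d → c.Hf →L[ℂ] GraphDomain (h 0)}
    (hb : SmoothInto (GraphDomain.incl (h 0)) b bD) : c.Fam :=
  hH.fibFam hb - star (hH.fibFam hb) - (ε : ℂ) • posFam j b hb.contDiff hb.1

theorem IsGapped.equivariant_commFam (hH : c.IsGapped H₀ h μ P) (j : Fin d) (ε : ℝ) {b : c.Fam}
    {bD : Space d → c.Hf →L[ℂ] GraphDomain (h 0)}
    (hb : SmoothInto (GraphDomain.incl (h 0)) b bD) : Equivariant (hH.commFam j ε hb) :=
  ((hH.equivariant_fib_comp hb).sub (hH.equivariant_fib_comp hb).star).sub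
    ((hb.1.posDeriv j hb.contDiff).smul _)

theorem IsGapped.comm_op (hH : c.IsGapped H₀ h μ P) (j : Fin d) (ε : ℝ) {b : c.Fam}
    {bD : Space d → c.Hf →L[ℂ] GraphDomain (h 0)}
    (hb : SmoothInto (GraphDomain.incl (h 0)) b bD) (hbs : IsSelfAdjoint (c.op b)) :
    ∃ hle : c.smoothCore (GraphDomain.incl (h 0))
        ≤ (comm (H₀ - (ε : ℂ) • c.position j) (c.op b)).domain,
      ∀ ψ (hψ : ψ ∈ c.smoothCore (GraphDomain.incl (h 0))),
        comm (H₀ - (ε : ℂ) • c.position j) (c.op b) ⟨ψ, hle hψ⟩ = c.op (hH.commFam j ε hb) ψ := by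
  obtain ⟨hle, hK⟩ := comm_position_op j hb.contDiff hb.1
  have hdom : c.smoothCore (GraphDomain.incl (h 0))
      ≤ (comm (H₀ - (ε : ℂ) • c.position j) (c.op b)).domain := by
    intro ψ hψ
    have h1 := hle (smoothCore_le _ hψ)
    exact ⟨⟨hH.smoothCore_le_domain hψ, h1.1⟩, ⟨(hH.map_op_fibFam hb ψ).1, h1.2⟩⟩
  refine ⟨hdom, fun ψ hψ => ?_⟩
  have h1 := hK ψ (smoothCore_le _ hψ)
  obtain ⟨hd, he⟩ := hH.map_op_fibFam hb ψ
  have h2 := hH.op_map hb hbs ⟨ψ, hH.smoothCore_le_domain hψ⟩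
  have hx := hle (smoothCore_le _ hψ)
  change (H₀ ⟨c.op b ψ, hd⟩ - (ε : ℂ) • c.position j ⟨c.op b ψ, hx.2⟩)
    - c.op b (H₀ ⟨ψ, hH.smoothCore_le_domain hψ⟩ - (ε : ℂ) • c.position j ⟨ψ, hx.1⟩) = _
  have h3 : c.position j ⟨c.op b ψ, hx.2⟩ - c.op b (c.position j ⟨ψ, hx.1⟩)
      = c.op (posFam j b hb.contDiff hb.1) ψ := h1
  have h4 : c.op (hH.commFam j ε hb) ψ = c.op (hH.fibFam hb) ψ - c.op (star (hH.fibFam hb)) ψ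
      - (ε : ℂ) • c.op (posFam j b hb.contDiff hb.1) ψ := by
    rw [commFam, op_sub, op_sub, op_smul]
    rfl
  rw [map_sub, map_smul, he, h2, h4, ← h3, smul_sub]
  abel

theorem IsGapped.inner_sub_position (hH : c.IsGapped H₀ h μ P) (j : Fin d) (ε : ℝ)
    (x y : (H₀ - (ε : ℂ) • c.position j).domain) :
    ⟪(H₀ - (ε : ℂ) • c.position j) x, (y : c.H)⟫_ℂ
      = ⟪(x : c.H), (H₀ - (ε : ℂ) • c.position j) y⟫_ℂ := by
  obtain ⟨x, hx⟩ := x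
  obtain ⟨y, hy⟩ := y
  have hx1 : x ∈ H₀.domain := hx.1
  have hx2 : x ∈ (c.position j).domain := hx.2
  have hy1 : y ∈ H₀.domain := hy.1
  have hy2 : y ∈ (c.position j).domain := hy.2
  have h1 := inner_map_selfAdjoint hH.selfAdjoint ⟨x, hx1⟩ ⟨y, hy1⟩
  have h2 := inner_position j ⟨x, hx2⟩ ⟨y, hy2⟩
  change ⟪H₀ ⟨x, hx1⟩ - (ε : ℂ) • c.position j ⟨x, hx2⟩, y⟫_ℂ
    = ⟪x, H₀ ⟨y, hy1⟩ - (ε : ℂ) • c.position j ⟨y, hy2⟩⟫_ℂ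
  rw [inner_sub_left, inner_sub_right, inner_smul_left, inner_smul_right, Complex.conj_ofReal]
  exact congrArg₂ _ h1 (congrArg _ h2)

theorem IsGapped.closure_comm_op (hH : c.IsGapped H₀ h μ P) (j : Fin d) (ε : ℝ) {b : c.Fam}
    {bD : Space d → c.Hf →L[ℂ] GraphDomain (h 0)}
    (hb : SmoothInto (GraphDomain.incl (h 0)) b bD) (hbs : IsSelfAdjoint (c.op b)) :
    c.smoothCore (GraphDomain.incl (h 0))
        ≤ (comm (H₀ - (ε : ℂ) • c.position j) (c.op b)).domain ∧
      ((comm (H₀ - (ε : ℂ) • c.position j) (c.op b)).domRestrict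
        (c.smoothCore (GraphDomain.incl (h 0)))).closure = full (c.op (hH.commFam j ε hb)) ∧
      (comm (H₀ - (ε : ℂ) • c.position j) (c.op b)).closure = full (c.op (hH.commFam j ε hb)) := by
  obtain ⟨hle, hW⟩ := hH.comm_op j ε hb hbs
  refine ⟨hle, closure_comm_domRestrict hH.dense_smoothCore hle hW,
    closure_eq_full (hH.dense_smoothCore.mono hle) _ ?_⟩
  exact comm_eq_of_core (hH.inner_sub_position j ε) hbs hH.dense_smoothCore hle hW

/-- The fibres of `[H₀ - ε X_j, A]` in terms of the fibres `F (ε, k)` of a curve of operators. -/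
def IsGapped.commFib (hH : c.IsGapped H₀ h μ P) (j : Fin d)
    (F : ℝ × Space d → c.Hf →L[ℂ] GraphDomain (h 0)) (q : ℝ × Space d) : c.Hf →L[ℂ] c.Hf :=
  hH.fib q.2 ∘L F q - adjointℝ (hH.fib q.2 ∘L F q) - Complex.ofRealCLM q.1 • (Complex.I •
    fderiv ℝ (fun q => GraphDomain.incl (h 0) ∘L F q) q (0, EuclideanSpace.single j 1))

theorem IsGapped.contDiff_commFib (hH : c.IsGapped H₀ h μ P) (j : Fin d)
    {F : ℝ × Space d → c.Hf →L[ℂ] GraphDomain (h 0)} (hF : ContDiff ℝ ∞ F) :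
    ContDiff ℝ ∞ (hH.commFib j F) := by
  have hN : ContDiff ℝ ∞ fun q : ℝ × Space d => hH.fib q.2 ∘L F q :=
    contDiff_comp (hH.contDiff_fib.comp contDiff_snd) hF
  have hιF : ContDiff ℝ ∞ fun q => GraphDomain.incl (h 0) ∘L F q := contDiff_comp contDiff_const hF
  exact (hN.sub (adjointℝ.contDiff.comp hN)).sub ((Complex.ofRealCLM.contDiff.comp
    contDiff_fst).smul ((contDiff_fderiv_apply hιF _).const_smul Complex.I))

/-- The position term carries an explicit factor ε, so at ε = 0 its derivative is minus its
coefficient and no mixed derivative of F survives. -/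
theorem IsGapped.fderiv_commFib (hH : c.IsGapped H₀ h μ P) (j : Fin d)
    {F : ℝ × Space d → c.Hf →L[ℂ] GraphDomain (h 0)} (hF : ContDiff ℝ ∞ F) (k : Space d) :
    fderiv ℝ (hH.commFib j F) (0, k) (1, 0) = hH.fib k ∘L fderiv ℝ F (0, k) (1, 0)
      - adjointℝ (hH.fib k ∘L fderiv ℝ F (0, k) (1, 0)) - Complex.I •
      fderiv ℝ (fun q => GraphDomain.incl (h 0) ∘L F q) (0, k) (0, EuclideanSpace.single j 1) := by
  have hιF : ContDiff ℝ ∞ fun q => GraphDomain.incl (h 0) ∘L F q := contDiff_comp contDiff_const hF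
  have hl : HasDerivAt (fun ε : ℝ => (ε, k)) ((1 : ℝ), (0 : Space d)) 0 :=
    (hasDerivAt_id (0 : ℝ)).prodMk (hasDerivAt_const _ _)
  have h0 : HasFDerivAt (hH.commFib j F) (fderiv ℝ (hH.commFib j F) (0, k)) (0, k) :=
    ((hH.contDiff_commFib j hF).differentiable (by simp) (0, k)).hasFDerivAt
  have h1 : HasDerivAt (fun ε : ℝ => hH.commFib j F (ε, k))
      (fderiv ℝ (hH.commFib j F) (0, k) (1, 0)) 0 := by
    have := h0.comp_hasDerivAt 0 hl
    exact this
  have h2 : HasDerivAt (fun ε : ℝ => F (ε, k)) (fderiv ℝ F (0, k) (1, 0)) 0 :=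
    (hF.differentiable (by simp) (0, k)).hasFDerivAt.comp_hasDerivAt 0 hl
  have h3 : HasDerivAt (fun ε : ℝ => hH.fib k ∘L F (ε, k))
      (hH.fib k ∘L fderiv ℝ F (0, k) (1, 0)) 0 :=
    ((ContinuousLinearMap.compL ℂ c.Hf (GraphDomain (h 0)) c.Hf (hH.fib k)).restrictScalars
      ℝ).hasFDerivAt.comp_hasDerivAt 0 h2
  have h4 := ((contDiff_fderiv_apply hιF (0, EuclideanSpace.single j 1)).const_smul
    Complex.I).differentiable (by simp) (0, k) |>.hasFDerivAt.comp_hasDerivAt 0 hl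
  have h5 := (Complex.ofRealCLM.hasDerivAt (x := (0 : ℝ))).smul h4
  have h6 := (h3.sub (adjointℝ.hasFDerivAt.comp_hasDerivAt 0 h3)).sub h5
  refine (h1.unique h6).trans (congrArg _ ?_)
  rw [map_zero, zero_smul, zero_add, Complex.ofRealCLM_apply, Complex.ofReal_one, one_smul]
  rfl

/-- The field strength t is kept separate from the curve parameter ε: t = ε gives the fibres of the
full commutator, while ε = 0 with t = 1 reads off the derivative of f(0) in k. -/
theorem IsGapped.commFam_apply (hH : c.IsGapped H₀ h μ P) (j : Fin d)
    {F : ℝ × Space d → c.Hf →L[ℂ] GraphDomain (h 0)} (hF : ContDiff ℝ ∞ F) {ε : ℝ} {b : c.Fam}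
    (hb : SmoothInto (GraphDomain.incl (h 0)) b fun k => F (ε, k)) (t : ℝ) (k : Space d) :
    hH.commFam j t hb k = hH.fib k ∘L F (ε, k) - adjointℝ (hH.fib k ∘L F (ε, k)) -
      (t : ℂ) • (Complex.I • fderiv ℝ (fun q => GraphDomain.incl (h 0) ∘L F q) (ε, k)
        (0, EuclideanSpace.single j 1)) := by
  have hιF : ContDiff ℝ ∞ fun q => GraphDomain.incl (h 0) ∘L F q := contDiff_comp contDiff_const hF
  have h1 : HasFDerivAt (fun k : Space d => (ε, k)) (ContinuousLinearMap.inr ℝ ℝ (Space d)) k :=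
    hasFDerivAt_prodMk_right ε k
  have h2 : fderiv ℝ b k = (fderiv ℝ (fun q => GraphDomain.incl (h 0) ∘L F q) (ε, k)).comp
      (ContinuousLinearMap.inr ℝ ℝ (Space d)) := by
    rw [← ((hιF.differentiable (by simp) (ε, k)).hasFDerivAt.comp k h1).fderiv]
    exact congrArg (fun g => fderiv ℝ g k) (funext hb.2.2).symm
  have h3 : fderiv ℝ (fun q => GraphDomain.incl (h 0) ∘L F q) (ε, k)
      (0, EuclideanSpace.single j 1) = fderiv ℝ b k (EuclideanSpace.single j 1) := by
    rw [h2]; rfl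
  rw [h3]
  rfl

/-- If `b₀` commutes with `H₀`, and `[H₀, b₁] = [X_j, b₀]`, then the fibres of
`[H₀ - ε X_j, b₀ + ε b₁ + …]` vanish to second order in `ε`. -/
theorem IsGapped.exists_commFam_remainder (hH : c.IsGapped H₀ h μ P) (j : Fin d)
    {F : ℝ × Space d → c.Hf →L[ℂ] GraphDomain (h 0)} (hF : ContDiff ℝ ∞ F) {f : ℝ → c.Fam}
    (hf : ∀ ε, SmoothInto (GraphDomain.incl (h 0)) (f ε) fun k => F (ε, k)) {b₁ : c.Fam}
    {b₁D : Space d → c.Hf →L[ℂ] GraphDomain (h 0)}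
    (h₁ : SmoothInto (GraphDomain.incl (h 0)) b₁ b₁D)
    (hF₁ : ∀ k, fderiv ℝ F (0, k) (1, 0) = b₁D k) (hz₀ : hH.commFam j 0 (hf 0) = 0)
    (hz₁ : hH.fibFam h₁ - star (hH.fibFam h₁) - posFam j (f 0) (hf 0).contDiff (hf 0).1 = 0) :
    ∃ r : ℝ → c.Fam, (∀ ε : ℝ, c.op (hH.commFam j ε (hf ε)) = (ε : ℂ) ^ 2 • c.op (r ε)) ∧
      ∃ B, ∀ ε ∈ Icc (0 : ℝ) 1, c.MemPLe (full (c.op (r ε))) (ContinuousLinearMap.id ℂ c.Hf)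
        (ContinuousLinearMap.id ℂ c.Hf) B := by
  have hWf : ∀ ε k, hH.commFib j F (ε, k) = hH.commFam j ε (hf ε) k := fun ε k =>
    (hH.commFam_apply j hF (hf ε) ε k).symm
  have hz₁' : ∀ k, hH.fib k ∘L b₁D k - adjointℝ (hH.fib k ∘L b₁D k)
      - posDeriv j (f 0) k = 0 := fun k => congrArg (fun b : c.Fam => b k) hz₁
  have hW₁ : ∀ k, fderiv ℝ (hH.commFib j F) (0, k) (1, 0) = 0 := by
    intro k
    have h2 := hH.commFam_apply j hF (hf 0) 1 k
    have h3 : hH.commFam j 1 (hf 0) k = hH.fib k ∘L F (0, k) - adjointℝ (hH.fib k ∘L F (0, k)) -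
      ((1 : ℝ) : ℂ) • posDeriv j (f 0) k := rfl
    rw [h3, sub_right_inj, Complex.ofReal_one, one_smul, one_smul] at h2
    rw [hH.fderiv_commFib j hF, ← h2, hF₁]
    exact hz₁' k
  have hid : ∀ b : c.Hf →L[ℂ] c.Hf, ContinuousLinearMap.id ℂ c.Hf ∘L b = b :=
    ContinuousLinearMap.id_comp
  have hzero : SmoothInto (ContinuousLinearMap.id ℂ c.Hf) (0 : c.Fam) fun _ => 0 :=
    ⟨fun κ _ k u => (map_zero (c.rho κ)).symm, contDiff_const, fun k => hid _⟩
  obtain ⟨r, hr, B, hB⟩ := exists_remainder (i := ContinuousLinearMap.id ℂ c.Hf)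
    (hH.contDiff_commFib j hF)
    (f := fun ε => hH.commFam j ε (hf ε)) (fun ε => hH.equivariant_commFam j ε (hf ε))
    (fun ε k => (hid _).trans (hWf ε k)) hzero hzero
    (fun k => (hWf 0 k).trans (congrArg (fun b : c.Fam => b k) hz₀)) hW₁
  refine ⟨r, fun ε => ?_, B, hB⟩
  rw [hr ε, op_zero, smul_zero, zero_add, zero_add]

end Gapped

end Crystal

theorem isSelfAdjoint_conj_exp {𝔸 : Type*} [NormedRing 𝔸] [NormedAlgebra ℂ 𝔸] [CompleteSpace 𝔸]
    [StarRing 𝔸] [ContinuousStar 𝔸] [StarModule ℂ 𝔸] {p s : 𝔸} (hp : IsSelfAdjoint p)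
    (hs : IsSelfAdjoint s) (ε : ℝ) : IsSelfAdjoint (NormedSpace.exp (-(Complex.I * ε) • s) * p *
      NormedSpace.exp ((Complex.I * ε) • s)) := by
  have h1 : star ((Complex.I * ε) • s) = -(Complex.I * ε) • s := by
    rw [star_smul, hs.star_eq]
    simp
  rw [IsSelfAdjoint, star_mul, star_mul, NormedSpace.star_exp, NormedSpace.star_exp, h1, hp.star_eq,
    ← h1, star_star, mul_assoc]

/-! ### The curve e^{-iεs} p e^{iεs} and its first-order data -/

namespace Crystal

variable {d N : ℕ} {c : Crystal d N}

theorem exists_op_eq_lie {q p : c.Fam} (hq : Equivariant q) (hqs : ContDiff ℝ ∞ q)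
    (hp : Equivariant p) (hps : ContDiff ℝ ∞ p) :
    ∃ r : c.Fam, Equivariant r ∧ ContDiff ℝ ∞ r ∧ c.op r = ⁅c.op q, c.op p⁆ :=
  ⟨q * p - p * q, (hq.mul hp).sub (hp.mul hq), (contDiff_comp hqs hps).sub (contDiff_comp hps hqs),
    by rw [op_sub, op_mul, op_mul, Ring.lie_def]⟩

/-- The curve `ε ↦ e^{-iεs} p e^{iεs}`. -/
def conjFam (p s : c.Fam) (ε : ℝ) : c.Fam :=
  NormedSpace.exp (-(Complex.I * ε) • s) * p * NormedSpace.exp ((Complex.I * ε) • s)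

theorem op_conjFam (p s : c.Fam) (ε : ℝ) : c.op (conjFam p s ε) =
    NormedSpace.exp (-(Complex.I * ε) • c.op s) * c.op p *
      NormedSpace.exp ((Complex.I * ε) • c.op s) := by
  rw [conjFam, op_mul, op_mul, op_exp, op_exp, op_smul, op_smul]

theorem conjFam_apply (p s : c.Fam) (ε : ℝ) (k : Space d) : conjFam p s ε k =
    NormedSpace.exp (-(Complex.I * ε) • s k) * p k * NormedSpace.exp ((Complex.I * ε) • s k) := by
  change NormedSpace.exp (-(Complex.I * ε) • s) k * p k * NormedSpace.exp ((Complex.I * ε) • s) k = _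
  rw [exp_fam_apply, exp_fam_apply]
  rfl

theorem conjFam_zero (p s : c.Fam) : conjFam p s 0 = p := by
  ext1 k
  rw [conjFam_apply]
  simp

theorem equivariant_conjFam {p s : c.Fam} (hp : Equivariant p) (hs : Equivariant s) (ε : ℝ) :
    Equivariant (conjFam p s ε) := by
  rw [funext (conjFam_apply p s ε)]
  exact ((hs.smul _).exp.mul hp).mul (hs.smul _).exp

theorem fderiv_eq_of_conjFam {V : Type} [NormedAddCommGroup V] [NormedSpace ℂ V]
    {i : V →L[ℂ] c.Hf} (hi : Function.Injective i) {p s p₁ : c.Fam}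
    {F : ℝ × Space d → c.Hf →L[ℂ] V} (hF : ContDiff ℝ ∞ F)
    (hFf : ∀ ε k, i ∘L F (ε, k) = conjFam p s ε k) {p₁V : Space d → c.Hf →L[ℂ] V}
    (h₁ : SmoothInto i p₁ p₁V) (hp₁ : -Complex.I • (s * p - p * s) = p₁) (k : Space d) :
    fderiv ℝ F (0, k) (1, 0) = p₁V k := by
  have hl : HasDerivAt (fun ε : ℝ => (ε, k)) ((1 : ℝ), (0 : Space d)) 0 :=
    (hasDerivAt_id (0 : ℝ)).prodMk (hasDerivAt_const _ _)
  have h2 : HasDerivAt (fun ε : ℝ => F (ε, k)) (fderiv ℝ F (0, k) (1, 0)) 0 := by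
    have := (hF.differentiable (by simp) (0, k)).hasFDerivAt.comp_hasDerivAt 0 hl
    exact this
  have h3 : HasDerivAt (fun ε : ℝ => i ∘L F (ε, k)) (i ∘L fderiv ℝ F (0, k) (1, 0)) 0 :=
    ((ContinuousLinearMap.compL ℂ c.Hf V c.Hf i).restrictScalars ℝ).hasFDerivAt.comp_hasDerivAt 0 h2
  have h4 := hasDerivAt_conj_exp (p k) (s k)
  rw [← funext fun ε => (hFf ε k).trans (conjFam_apply p s ε k)] at h4
  have h5 : i ∘L fderiv ℝ F (0, k) (1, 0) = i ∘L p₁V k := by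
    rw [h3.unique h4, h₁.2.2 k, ← hp₁]
    rfl
  exact ContinuousLinearMap.ext fun u => hi (congrArg (fun A : c.Hf →L[ℂ] c.Hf => A u) h5)

section Gapped

variable {H₀ : c.H →ₗ.[ℂ] c.H} {h : Space d → c.Hf →ₗ.[ℂ] c.Hf} {μ : ℝ} {P : c.H →L[ℂ] c.H}

theorem IsGapped.commFam_zero (hH : c.IsGapped H₀ h μ P) (j : Fin d) {b : c.Fam}
    {bD : Space d → c.Hf →L[ℂ] GraphDomain (h 0)} (hb : SmoothInto (GraphDomain.incl (h 0)) b bD)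
    (hbs : IsSelfAdjoint (c.op b)) (hbG : Commute (c.op b) (resolvent H₀ μ)) :
    hH.commFam j 0 hb = 0 := by
  refine eq_zero_of_op_eq_zero (hH.equivariant_commFam j 0 hb) ?_
  rw [IsGapped.commFam, op_sub, op_sub, op_smul, Complex.ofReal_zero, zero_smul, sub_zero]
  refine hH.eq_zero_of_resolvent_mul_mul ?_
  rw [hH.resolvent_mul_sub_star_mul hb hbs, hbG.eq, sub_self]

/-- The hypothesis on the resolvent at μ says G[H₀, b₁]G = GκG, and the outer resolvents can be
cancelled. -/
theorem IsGapped.fibFam_sub_star (hH : c.IsGapped H₀ h μ P) {b₁ : c.Fam}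
    {b₁D : Space d → c.Hf →L[ℂ] GraphDomain (h 0)}
    (h₁ : SmoothInto (GraphDomain.incl (h 0)) b₁ b₁D) (hbs : IsSelfAdjoint (c.op b₁)) {κ : c.Fam}
    (hκ : Equivariant κ) (hG : resolvent H₀ μ * c.op b₁ - c.op b₁ * resolvent H₀ μ
      = -(resolvent H₀ μ * c.op κ * resolvent H₀ μ)) :
    hH.fibFam h₁ - star (hH.fibFam h₁) - κ = 0 := by
  refine eq_zero_of_op_eq_zero
    (((hH.equivariant_fib_comp h₁).sub (hH.equivariant_fib_comp h₁).star).sub hκ) ?_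
  rw [op_sub, op_sub]
  refine hH.eq_zero_of_resolvent_mul_mul ?_
  rw [mul_sub, sub_mul, hH.resolvent_mul_sub_star_mul h₁ hbs,
    ← neg_sub (resolvent H₀ μ * c.op b₁), hG, neg_neg, sub_self]

/-- Apart from regularity and self-adjointness, three relations suffice: p commutes with H₀, -i[s,
p] = p₁, and [H₀, p₁] = [X_j, p]. The first and third are expressed through the resolvent at μ; they
kill the terms of order 0 and 1 of the commutator. -/
theorem IsGapped.exists_conj_remainders (hH : c.IsGapped H₀ h μ P) (j : Fin d) {p s p₁ : c.Fam}
    {pD sD p₁D : Space d → c.Hf →L[ℂ] GraphDomain (h 0)}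
    (hp : SmoothInto (GraphDomain.incl (h 0)) p pD) (hs : SmoothInto (GraphDomain.incl (h 0)) s sD)
    (hp₁ : SmoothInto (GraphDomain.incl (h 0)) p₁ p₁D) (hps : IsSelfAdjoint (c.op p))
    (hss : IsSelfAdjoint (c.op s)) (hp₁s : IsSelfAdjoint (c.op p₁))
    (hpG : Commute (c.op p) (resolvent H₀ μ))
    (hsp : -Complex.I • (c.op s * c.op p - c.op p * c.op s) = c.op p₁)
    (hG : resolvent H₀ μ * c.op p₁ - c.op p₁ * resolvent H₀ μ
      = -(resolvent H₀ μ * c.op (posFam j p hp.contDiff hp.1) * resolvent H₀ μ)) :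
    (∃ r : ℝ → c.H →L[ℂ] c.H,
      (∀ ε : ℝ, NormedSpace.exp (-(Complex.I * ε) • c.op s) * c.op p *
        NormedSpace.exp ((Complex.I * ε) • c.op s)
          = c.op p + (ε : ℂ) • c.op p₁ + (ε : ℂ) ^ 2 • r ε) ∧
      ∃ B, ∀ ε ∈ Icc (0 : ℝ) 1,
        c.MemPLe (full (r ε)) (ContinuousLinearMap.id ℂ c.Hf) (GraphDomain.incl (h 0)) B) ∧
    ∃ R : ℝ → c.H →L[ℂ] c.H,
      (∀ ε : ℝ,
        c.smoothCore (GraphDomain.incl (h 0)) ≤ (comm (H₀ - (ε : ℂ) • c.position j)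
          (NormedSpace.exp (-(Complex.I * ε) • c.op s) * c.op p *
            NormedSpace.exp ((Complex.I * ε) • c.op s))).domain ∧
        ((comm (H₀ - (ε : ℂ) • c.position j) (NormedSpace.exp (-(Complex.I * ε) • c.op s) * c.op p *
            NormedSpace.exp ((Complex.I * ε) • c.op s))).domRestrict
          (c.smoothCore (GraphDomain.incl (h 0)))).closure = full ((ε : ℂ) ^ 2 • R ε) ∧
        (comm (H₀ - (ε : ℂ) • c.position j) (NormedSpace.exp (-(Complex.I * ε) • c.op s) * c.op p *
          NormedSpace.exp ((Complex.I * ε) • c.op s))).closure = full ((ε : ℂ) ^ 2 • R ε)) ∧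
      ∃ B, ∀ ε ∈ Icc (0 : ℝ) 1,
        c.MemPLe (full (R ε)) (ContinuousLinearMap.id ℂ c.Hf) (ContinuousLinearMap.id ℂ c.Hf) B := by
  have hfs : ∀ ε, IsSelfAdjoint (c.op (conjFam p s ε)) := fun ε => by
    rw [op_conjFam]
    exact isSelfAdjoint_conj_exp hps hss ε
  have hfe := equivariant_conjFam hp.1 hs.1
  have := hH.completeSpace
  obtain ⟨F, hF, hFf⟩ := exists_contDiff_conj_exp hp hs
  replace hFf : ∀ ε k, GraphDomain.incl (h 0) ∘L F (ε, k) = conjFam p s ε k := hFf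
  have hf : ∀ ε, SmoothInto (GraphDomain.incl (h 0)) (conjFam p s ε) fun k => F (ε, k) := fun ε =>
    ⟨hfe ε, hF.comp (contDiff_const.prodMk contDiff_id), hFf ε⟩
  have hF₀ : ∀ k, F (0, k) = pD k := fun k => by
    have h1 : GraphDomain.incl (h 0) ∘L F (0, k) = GraphDomain.incl (h 0) ∘L pD k := by
      rw [hFf, conjFam_zero, hp.2.2]
    exact ContinuousLinearMap.ext fun u => GraphDomain.incl_injective (h 0)
      (congrArg (fun A : c.Hf →L[ℂ] c.Hf => A u) h1)
  have hsp' : -Complex.I • (s * p - p * s) = p₁ := by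
    refine op_injective (((hs.1.mul hp.1).sub (hp.1.mul hs.1)).smul _) hp₁.1 ?_
    rw [op_smul, op_sub, op_mul, op_mul, hsp]
  have hF₁ := fderiv_eq_of_conjFam (GraphDomain.incl_injective (h 0)) hF hFf hp₁ hsp'
  obtain ⟨r, hr, B, hB⟩ := exists_remainder hF hfe hFf hp hp₁ hF₀ hF₁
  have hz₀ : hH.commFam j 0 (hf 0) = 0 := hH.commFam_zero j (hf 0) (hfs 0) (by rwa [conjFam_zero])
  have hz₁ : hH.fibFam hp₁ - star (hH.fibFam hp₁)
      - posFam j (conjFam p s 0) (hf 0).contDiff (hf 0).1 = 0 := by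
    have h1 : posFam j (conjFam p s 0) (hf 0).contDiff (hf 0).1
        = posFam j p hp.contDiff hp.1 := by
      simp only [conjFam_zero]
    rw [h1]
    exact hH.fibFam_sub_star hp₁ hp₁s (hp.1.posDeriv j hp.contDiff) hG
  obtain ⟨R, hR, B', hB'⟩ := hH.exists_commFam_remainder j hF hf hp₁ hF₁ hz₀ hz₁
  refine ⟨⟨fun ε => c.op (r ε), fun ε => ?_, B, hB⟩,
    ⟨fun ε => c.op (R ε), fun ε => ?_, B', hB'⟩⟩
  · rw [← op_conjFam, hr]
  · have h1 := hH.closure_comm_op j ε (hf ε) (hfs ε)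
    rw [op_conjFam, hR] at h1
    exact h1

end Gapped

end Crystal

end Neass

/-! ### The proposition -/

set_option maxHeartbeats 2000000 in
open Neass Crystal in
theorem proposition4p1 {d N : ℕ} (c : Neass.Crystal d N) (H₀ : c.H →ₗ.[ℂ] c.H)
    (h : Neass.Space d → c.Hf →ₗ.[ℂ] c.Hf) (μ : ℝ) (P : c.H →L[ℂ] c.H) (hH : c.IsGapped H₀ h μ P)
    (C : ℝ → ℂ) (hC : Neass.IsContour H₀ μ C) (j : Fin d) :
    ∃ K : c.H →L[ℂ] c.H,
      c.smoothCore (ContinuousLinearMap.id ℂ c.Hf) ≤ (Neass.comm (c.position j) P).domain ∧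
      ((Neass.comm (c.position j) P).domRestrict
        (c.smoothCore (ContinuousLinearMap.id ℂ c.Hf))).closure = Neass.full K ∧
      let S : c.H →L[ℂ] c.H := Complex.I • Neass.invLiouvillian H₀ P C ⁅K, P⁆
      let P₁ : c.H →L[ℂ] c.H := Neass.invLiouvillian H₀ P C K
      let Pε : ℝ → c.H →L[ℂ] c.H := fun ε =>
        NormedSpace.exp (-(Complex.I * ε) • S) * P * NormedSpace.exp ((Complex.I * ε) • S)
      let Hε : ℝ → c.H →ₗ.[ℂ] c.H := fun ε => H₀ - (ε : ℂ) • c.position j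
      (c.MemP (Neass.full S) (ContinuousLinearMap.id ℂ c.Hf) (Neass.GraphDomain.incl (h 0)) ∧
        IsSelfAdjoint S) ∧
      c.MemP (Neass.full P₁) (ContinuousLinearMap.id ℂ c.Hf) (Neass.GraphDomain.incl (h 0)) ∧
      (∃ Pr : ℝ → c.H →L[ℂ] c.H,
        (∀ ε ∈ Set.Icc (0 : ℝ) 1, Pε ε = P + (ε : ℂ) • P₁ + (ε : ℂ) ^ 2 • Pr ε) ∧
        ∃ B : ℝ, ∀ ε ∈ Set.Icc (0 : ℝ) 1,
          c.MemPLe (Neass.full (Pr ε)) (ContinuousLinearMap.id ℂ c.Hf) (Neass.GraphDomain.incl (h 0)) B) ∧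
      ∃ R : ℝ → c.H →L[ℂ] c.H,
        (∀ ε ∈ Set.Icc (0 : ℝ) 1,
          c.smoothCore (Neass.GraphDomain.incl (h 0)) ≤ (Neass.comm (Hε ε) (Pε ε)).domain ∧
          ((Neass.comm (Hε ε) (Pε ε)).domRestrict (c.smoothCore (Neass.GraphDomain.incl (h 0)))).closure
            = Neass.full ((ε : ℂ) ^ 2 • R ε) ∧
          (Neass.comm (Hε ε) (Pε ε)).closure = Neass.full ((ε : ℂ) ^ 2 • R ε)) ∧
        ∃ B : ℝ, ∀ ε ∈ Set.Icc (0 : ℝ) 1,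
          c.MemPLe (Neass.full (R ε)) (ContinuousLinearMap.id ℂ c.Hf)
            (ContinuousLinearMap.id ℂ c.Hf) B := by
  have hPR := hH.fermi.eq_rieszIntegral hH.selfAdjoint hH.gap hC
  have hPstar := hH.fermi.isStarProjection measurableSet_Iio
  have hPP : P * P = P := hPstar.isIdempotentElem
  have hPs : IsSelfAdjoint P := hPstar.isSelfAdjoint
  have hPG := commute_of_eq_rieszIntegral hC hPR _ hH.gap
  obtain ⟨p, pD, hp, hpP⟩ := hH.exists_rieszIntegral_eq_op hC
  rw [← hPR] at hpP
  have hps := hp.contDiff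
  set κ : c.Fam := posFam j p hps hp.1 with hκ
  have hκe : Equivariant κ := hp.1.posDeriv j hps
  have hκs : ContDiff ℝ ∞ κ := contDiff_posDeriv j hps
  have hcomm := comm_position_op j hps hp.1
  have hoff := op_posFam_offDiagonal j hps hp.1 (by rw [hpP, hPP])
  have hskew := star_op_posFam j hps hp.1 (by rw [hpP]; exact hPs)
  rw [← hκ, hpP] at hoff
  rw [← hκ] at hskew
  rw [← hκ, hpP] at hcomm
  obtain ⟨hle, hK⟩ := hcomm
  have hKPP := lie_lie_of_offDiagonal hPP hoff
  -- q₁ and q₂ are the fibres of [K, P] and [[K, P], P], the operators sandwiched between resolvents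
  -- in 𝓘(K) and 𝓘([K, P]) respectively.
  obtain ⟨q₁, hq₁e, hq₁s, hq₁⟩ := exists_op_eq_lie hκe hκs hp.1 hps
  obtain ⟨q₂, hq₂e, hq₂s, hq₂⟩ := exists_op_eq_lie hq₁e hq₁s hp.1 hps
  rw [hpP] at hq₁
  rw [hq₁, hpP] at hq₂
  obtain ⟨p₁, p₁D, hp₁, hp₁P⟩ := hH.exists_sandwich_eq_op hC hq₁e hq₁s
  obtain ⟨s₀, s₀D, hs₀, hs₀S⟩ := hH.exists_sandwich_eq_op hC hq₂e hq₂s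
  rw [hq₁, ← invLiouvillian_eq] at hp₁P
  rw [hq₂, ← invLiouvillian_eq] at hs₀S
  refine ⟨c.op κ, hle, closure_comm_domRestrict c.dense_smoothCore hle hK, ?_⟩
  intro S P₁ Pε Hε
  have hs := hs₀.const_smul Complex.I
  have hsS : c.op (Complex.I • s₀) = S := by rw [op_smul, hs₀S]
  set s : c.Fam := Complex.I • s₀
  have hSs : IsSelfAdjoint S := by
    refine isSelfAdjoint_invLiouvillian hH.selfAdjoint hC hH.gap hPR hPP hPs ?_
    -- For Y = [K, P] the double bracket [[Y, P], P] is [K, P] again, which is self-adjoint because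
    -- K is skew-adjoint and P self-adjoint.
    rw [lie_lie_lie_of_idempotent hPP, Ring.lie_def, IsSelfAdjoint, star_sub, star_mul, star_mul,
      hskew, hPs.star_eq, mul_neg, neg_mul]
    abel
  have hSP : -Complex.I • (S * P - P * S) = P₁ := by
    have h1 := lie_invLiouvillian hC hPR hPP (c.op κ)
    rw [Ring.lie_def] at h1
    change -Complex.I • ((Complex.I • _) * P - P * (Complex.I • _)) = P₁
    rw [smul_mul_assoc, mul_smul_comm, ← smul_sub, smul_smul, neg_mul, Complex.I_mul_I, neg_neg,
      one_smul, h1]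
  -- Self-adjointness of P₁ is inherited from S through P₁ = -i[S, P].
  have hP₁s : IsSelfAdjoint P₁ := by
    have h1 : star (-Complex.I • (S * P - P * S)) = -Complex.I • (S * P - P * S) := by
      rw [star_smul, star_sub, star_mul, star_mul, hPs.star_eq, hSs.star_eq,
        star_neg, Complex.star_def, Complex.conj_I, neg_neg, neg_smul, ← smul_neg, neg_sub]
    rwa [hSP] at h1
  -- The last condition is [H₀, P₁] = K: the inverse Liouvillian gives [H₀, P₁] = [[K, P], P], and
  -- this is K because K is off-diagonal.
  obtain ⟨⟨r, hr, hrB⟩, R, hR, hRB⟩ := hH.exists_conj_remainders j hp hs hp₁ (by rwa [hpP])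
    (by rwa [hsS]) (by rwa [hp₁P]) (by rwa [hpP]) (by rw [hsS, hpP, hp₁P, hSP])
    (by rw [hp₁P, ← hκ, resolvent_lie_invLiouvillian hC hPR (c.op κ) hH.gap, hKPP])
  rw [hsS, hpP] at hR
  rw [hsS, hpP, hp₁P] at hr
  refine ⟨⟨?_, hSs⟩, ?_, ⟨r, fun ε _ => hr ε, hrB⟩, ⟨R, fun ε _ => hR ε, hRB⟩⟩
  · rw [← hsS]
    exact memP_op hs.1 hs.2.2 hs.2.1
  · rw [← show c.op p₁ = P₁ from hp₁P]
    exact memP_op hp₁.1 hp₁.2.2 hp₁.2.1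

end
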